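/- Let $n\ge 1$, $m>0$, $r_0>0$, $0\le k<m/4$ and $\lambda=\frac{1-\sqrt{1-4k/m}}{2}\in[0,\tfrac12)$; here $k$ is the constant for which the coefficient of the time-decaying harmonic oscillator $\frac{p^2}{2m}+\frac{k(t)}{2}x^2$ is $k(t)=k\,t^{-2}$ for $|t|>r_0$. Write $p=-i\nabla$. Consider the real-valued potentials $V:\mathbb{R}\times\mathbb{R}^n\to\mathbb{R}$ of the following two types. (S) $V^{\mathrm S}\in C(\mathbb{R};C(\mathbb{R}^n))$ is short-range: for some $\rho_{\mathrm S}>\frac1{1-\lambda}$ there is $C>0$ with $|V^{\mathrm S}(t,x)|\le C(1+|x|)^{-\rho_{\mathrm S}}$ for all $t,x$. (D) $V^{\mathrm L}_D\in C(\mathbb{R};C^2(\mathbb{R}^n))$ is of Dollard long-range type: for some $\rho_{D,\mathrm L}$ with $\frac{2\lambda+1}{2(1-\lambda)}<\rho_{D,\mathrm L}\le\frac1{1-\lambda}$ and every multi-index $\alpha$ with $|\alpha|\le 2$ there is $C_\alpha>0$ with $|\partial_x^\alpha V^{\mathrm L}_D(t,x)|\le C_\alpha(1+|x|)^{-\rho_{D,\mathrm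 L}-|\alpha|}$ for all $t,x$. On $L^2(\mathbb{R}^n)$, for $t>0$ and for $t<0$, let $U_{S,0}(t,s)$ and $U_S(t,s)$ be the unitary propagators of the reduced Hamiltonians $$H_{0,S}(t)=\frac{p^2}{2m|t|^{2\lambda}},\qquad H_S(t)=\frac{p^2}{2m|t|^{2\lambda}}+V(t,|t|^\lambda x),$$ that is, the strongly continuous families of unitary operators ($t,s>0$, respectively $t,s<0$) with $U(t,\theta)U(\theta,s)=U(t,s)$, $U(s,s)=\mathrm{Id}$, that solve $i\partial_tU(t,s)=H(t)U(t,s)$ weakly against Schwartz functions. For the potentials below these propagators exist, and the following holds. 1. If $V=V^{\mathrm S}$ with $V^{\mathrm S}$ as in (S), then the reduced wave operators $$W_S^\pm=\operatorname*{s-lim}_{t\to\pm\infty}U_S(t,\pm r_0)^*\,U_{S,0}(t,\pm r_0)$$ exist. 2. If $V=V^{\mathrm S}+V^{\mathrm L}_D$ with $V^{\mathrm S}$ as in (S) and $V^{\mathrm L}_D$ as in (D), then the Dollard-modified reduced wave operators $$W_{S,D}^\pm=\operatorname*{s-lim}_{t\to\pm\infty}U_S(t,\pm r_0)^*\,U_{S,0}(t,\pm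 r_0)\,\exp\!\Big(-i\int_{\pm r_0}^tV^{\mathrm L}_D\Big(s,\frac{s|s|^{-\lambda}p}{m(1-2\lambda)}\Big)ds\Big)$$ exist. -/

import Mathlib

open MeasureTheory Filter Topology SchwartzMap

noncomputable section

/-- Configuration space `ℝⁿ` with the Euclidean norm. -/
abbrev RSpace (n : ℕ) : Type := EuclideanSpace ℝ (Fin n)

/-- The Hilbert space `L²(ℝⁿ; ℂ)`. -/
abbrev L2Space (n : ℕ) : Type := Lp ℂ 2 (volume : Measure (RSpace n))

/-- The `L²` pairing `⟨f, u⟩ = ∫ conj (f x) * u x dx` of a square integrable function `f` with a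
vector `u`, conjugate linear in `f`. -/
def l2Pairing {n : ℕ} (f : RSpace n → ℂ) (u : L2Space n) : ℂ :=
  ∫ x, (starRingEnd ℂ) (f x) * u x

/-- The free reduced Hamiltonian `p² / (2 m |t|^{2λ})`, where `p = -i∇`, on Schwartz functions,
which form a core. -/
def freeReducedHamiltonian {n : ℕ} (m lam t : ℝ) (φ : 𝓢(RSpace n, ℂ)) : RSpace n → ℂ :=
  fun x => -((1 / (2 * m * |t| ^ (2 * lam)) : ℝ) : ℂ) * Laplacian.laplacian (φ : RSpace n → ℂ) x

/-- The reduced Hamiltonian `p² / (2 m |t|^{2λ}) + V(t, |t|^λ x)` on Schwartz functions. For bounded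
continuous `V` they form a core of it. -/
def reducedHamiltonian {n : ℕ} (m lam : ℝ) (V : ℝ → RSpace n → ℝ) (t : ℝ) (φ : 𝓢(RSpace n, ℂ)) :
    RSpace n → ℂ :=
  fun x => freeReducedHamiltonian m lam t φ x + ((V t (|t| ^ lam • x) : ℝ) : ℂ) * φ x

/-- `U` is the propagator on the open interval `J` of the time-dependent Hamiltonian `H`, given on
Schwartz functions: a strongly continuous family of unitary operators `U t s` (`t, s ∈ J`) with
`U t θ * U θ s = U t s`, `U s s = 1` and `i ∂ₜ U t s = H t * U t s`. As the potentials are only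
continuous in time, the Schrödinger equation is understood in the weak sense,
`∂ₜ ⟨φ, U t s ψ⟩ = -i ⟨H t φ, U t s ψ⟩` for all Schwartz functions `φ` and all `ψ` in `L²`.
Since `U t s` is the adjoint of `U s t`, the conjugate of this is the equation
`i ∂ₛ U t s = -U t s * H s`. -/
structure IsPropagator {n : ℕ} (H : ℝ → 𝓢(RSpace n, ℂ) → RSpace n → ℂ) (J : Set ℝ)
    (U : ℝ → ℝ → (L2Space n ≃ₗᵢ[ℂ] L2Space n)) : Prop where
  self_eq : ∀ s ∈ J, ∀ ψ, U s s ψ = ψ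
  comp_eq : ∀ t ∈ J, ∀ θ ∈ J, ∀ s ∈ J, ∀ ψ, U t θ (U θ s ψ) = U t s ψ
  continuousOn : ∀ ψ, ContinuousOn (fun q : ℝ × ℝ => U q.1 q.2 ψ) (J ×ˢ J)
  schrodinger : ∀ s ∈ J, ∀ ψ : L2Space n, ∀ φ : 𝓢(RSpace n, ℂ), ∀ t ∈ J,
    HasDerivAt (fun τ : ℝ => l2Pairing φ (U τ s ψ))
      (-Complex.I * l2Pairing (H t φ) (U t s ψ)) t

/-- Short-range potentials: `V ∈ C(ℝ; C(ℝⁿ))`, and for some `ρ > 1/(1-λ)` one has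
`|V(t,x)| ≤ C (1+|x|)^{-ρ}` uniformly in `t`. -/
def IsShortRange {n : ℕ} (lam : ℝ) (V : ℝ → RSpace n → ℝ) : Prop :=
  Continuous (fun q : ℝ × RSpace n => V q.1 q.2) ∧
  ∃ ρ : ℝ, 1 / (1 - lam) < ρ ∧ ∃ C : ℝ, 0 < C ∧ ∀ t x, |V t x| ≤ C * (1 + ‖x‖) ^ (-ρ)

/-- Dollard-type long-range potentials: `V ∈ C(ℝ; C²(ℝⁿ))`, and for some `ρ` with
`(2λ+1)/(2(1-λ)) < ρ ≤ 1/(1-λ)` the spatial derivatives of order `j ≤ 2` are bounded by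
`C_j (1+|x|)^{-ρ-j}` uniformly in `t`. -/
def IsDollardLongRange {n : ℕ} (lam : ℝ) (V : ℝ → RSpace n → ℝ) : Prop :=
  (∀ t, ContDiff ℝ 2 (V t)) ∧
  (∀ j : ℕ, j ≤ 2 → Continuous (fun q : ℝ × RSpace n => iteratedFDeriv ℝ j (V q.1) q.2)) ∧
  ∃ ρ : ℝ, (2 * lam + 1) / (2 * (1 - lam)) < ρ ∧ ρ ≤ 1 / (1 - lam) ∧
    ∀ j : ℕ, j ≤ 2 → ∃ C : ℝ, 0 < C ∧
      ∀ t x, ‖iteratedFDeriv ℝ j (V t) x‖ ≤ C * (1 + ‖x‖) ^ (-ρ - j)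

/-- Multiplication of `ψ ∈ L²` by the unimodular function `e^{-i a}`. -/
def phaseMul {n : ℕ} (a : RSpace n → ℝ) (ψ : L2Space n) : L2Space n := by
  classical
  exact if h : MemLp (fun ξ => Complex.exp (-Complex.I * (a ξ : ℂ)) * ψ ξ) 2 volume
    then h.toLp _ else 0

/-- For a measurable phase, `phaseMul` is the pointwise product. -/
theorem coeFn_phaseMul {n : ℕ} {a : RSpace n → ℝ} (ha : Measurable a) (ψ : L2Space n) :
    phaseMul a ψ =ᵐ[volume] fun ξ => Complex.exp (-Complex.I * (a ξ : ℂ)) * ψ ξ := by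
  have h : MemLp (fun ξ => Complex.exp (-Complex.I * (a ξ : ℂ)) * ψ ξ) 2 volume := by
    refine (Lp.memLp ψ).of_le ?_ (Eventually.of_forall fun ξ => ?_)
    · exact (by fun_prop : Measurable fun ξ => Complex.exp (-Complex.I * (a ξ : ℂ)))
        |>.aestronglyMeasurable.mul (Lp.aestronglyMeasurable ψ)
    · rw [norm_mul, Complex.norm_exp]
      simp
  unfold phaseMul
  rw [dif_pos h]
  exact h.coeFn_toLp

/-- The unitary operator `e^{-i a(p)}` on `L²`, `p = -i∇`, with `a` a real function. Mathlib's
Fourier transform has the kernel `e^{-2πi x·ξ}`, which turns `p` into multiplication by `2πξ`. -/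
def momentumPhase {n : ℕ} (a : RSpace n → ℝ) (ψ : L2Space n) : L2Space n :=
  (Lp.fourierTransformₗᵢ (RSpace n) ℂ).symm
    (phaseMul (fun ξ => a ((2 * Real.pi) • ξ)) (Lp.fourierTransformₗᵢ (RSpace n) ℂ ψ))

/-- The Dollard modifier `exp (-i ∫_{s₀}^t V(s, s |s|^{-λ} p / (m (1-2λ))) ds)`. -/
def dollardModifier {n : ℕ} (m lam : ℝ) (V : ℝ → RSpace n → ℝ) (s₀ t : ℝ) :
    L2Space n → L2Space n :=
  momentumPhase fun p => ∫ s in s₀..t, V s ((s * |s| ^ (-lam) / (m * (1 - 2 * lam))) • p)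

/-- Existence of the strong limit of `U_S(t,s₀)^* U_{S,0}(t,s₀) G(t)` as `t` tends to infinity along
`l`, where `U_S` and `U_{S,0}` are the propagators on `J` of the full and the free reduced
Hamiltonian. The propagators exist, and the limit exists for every choice of them.
For a unitary operator, `symm` is the adjoint. -/
def ReducedWaveOperatorExists {n : ℕ} (m lam : ℝ) (V : ℝ → RSpace n → ℝ) (J : Set ℝ) (s₀ : ℝ)
    (l : Filter ℝ) (G : ℝ → L2Space n → L2Space n) : Prop :=
  (∃ U₀ : ℝ → ℝ → (L2Space n ≃ₗᵢ[ℂ] L2Space n),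
    IsPropagator (freeReducedHamiltonian m lam) J U₀) ∧
  (∃ U : ℝ → ℝ → (L2Space n ≃ₗᵢ[ℂ] L2Space n),
    IsPropagator (reducedHamiltonian m lam V) J U) ∧
  ∀ U₀ U : ℝ → ℝ → (L2Space n ≃ₗᵢ[ℂ] L2Space n),
    IsPropagator (freeReducedHamiltonian m lam) J U₀ →
    IsPropagator (reducedHamiltonian m lam V) J U →
    ∃ W : L2Space n →L[ℂ] L2Space n, ∀ ψ : L2Space n,
      Tendsto (fun t => (U t s₀).symm (U₀ t s₀ (G t ψ))) l (𝓝 (W ψ))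

end

open MeasureTheory Filter Topology SchwartzMap

/-! ### Multiplication operators and unitary phases on `L²` -/

noncomputable section

open scoped BoundedContinuousFunction ComplexConjugate

variable {n : ℕ}

/-! Put `τ(t) = t|t|^{-2λ}/(m(1-2λ))`, a primitive of `1/(m|t|^{2λ})`. It is continuous through `0`
because `2λ < 1`, and the free propagator is `E(t)E(s)⁻¹` with `E(t) = e^{-iτ(t)p²/2}`. All
operators in the limit are isometries, so it suffices to treat a total set (`exists_clm_of_total`):
the vectors `E(s)𝓕⁻¹κ` with `κ` smooth and compactly supported away from `0`. On such a vector the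
family is `U(t,s)* E(t) u(t)` with `u(t) = 𝓕⁻¹ e^{-iΦ(t)} κ`, where `Φ(t,ξ) = ∫ₛᵗ V_D(σ, c(σ)ξ) dσ`
and `c(t) = 2π|t|^λ τ(t)`.

The main device is to insert the phase `M(t) = e^{-i|x|²/(2τ(t))}`. The operator `E(t) M(t) 𝓕⁻¹`
carries multiplication by `h(2πτξ)` to multiplication by `h(x)` with no error (`mulL_galilei`), so
`V(t,|t|^λ x)` becomes exactly `V(t, c(t)ξ)`. In the derivative of `U(t,s)* E(t) M(t) u(t)` the
`V_D` term is therefore cancelled by the derivative of `Φ`, and two terms remain. The short-range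
one is `V_S(t,c(t)ξ)κ`, of size `|t|^{-(1-λ)ρ_S}` since `κ` vanishes near `0`; this is integrable.
The other comes from differentiating `M` and has size `|t|^{2λ-2} ‖|x|²u(t)‖`.

The second moment is controlled by second `ξ`-derivatives of `e^{-iΦ}κ`. The first two derivatives
of `Φ` on the support of `κ` are `O(|t|^{1-δ})` with `δ = (1-λ)ρ'` and `ρ' < ρ`, so `‖|x|²u(t)‖ =
O(|t|^{2-2δ})` and the term is `O(|t|^{2λ-2δ})`. It is integrable precisely because `δ > λ + 1/2`,
which is the lower bound on the Dollard exponent. Cook's method (`exists_limit_of_cook`) gives the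
limit with `M` inserted; the same inequality makes `‖(1-M(t))u(t)‖` tend to `0`, so `M` can be
removed. The short-range statement is the case `V_D = 0`.

Propagators are handled in the interaction picture, where the generator `E(t)⁻¹ V E(t)` is bounded
and strongly continuous. Existence follows by a fixed point argument. Conversely, any weak
propagator solves the interaction equation strongly (`IsPropagator.hasDerivAt_interaction`), which
supplies the derivatives needed for Cook's method and the uniqueness of the free propagator. -/

theorem norm_sq_eq_integral_norm_sq (u : L2Space n) : ‖u‖ ^ 2 = ∫ x, ‖u x‖ ^ 2 := by
  have h := inner_self_eq_norm_sq (𝕜 := ℂ) u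
  rw [← h, L2.inner_def]
  have : ∀ x, inner ℂ (u x) (u x) = ((‖u x‖ ^ 2 : ℝ) : ℂ) := fun x => by
    rw [inner_self_eq_norm_sq_to_K]; push_cast; rfl
  simp_rw [this]
  rw [integral_complex_ofReal]
  simp

theorem integrable_norm_sq (u : L2Space n) : Integrable fun x => ‖u x‖ ^ 2 :=
  (Lp.memLp u).integrable_norm_pow (by norm_num)

theorem memLp_mul (h : RSpace n →ᵇ ℂ) (u : L2Space n) :
    MemLp (fun x => h x * u x) 2 volume := by
  refine (Lp.memLp u).of_le_mul (c := ‖h‖)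
    (h.continuous.aestronglyMeasurable.mul (Lp.aestronglyMeasurable u))
    (Eventually.of_forall fun x => ?_)
  rw [norm_mul]
  gcongr
  exact h.norm_coe_le_norm x

/-- Multiplication by a bounded continuous function on `L²`. -/
def mulL (h : RSpace n →ᵇ ℂ) : L2Space n →L[ℂ] L2Space n :=
  LinearMap.mkContinuous
    { toFun := fun u => (memLp_mul h u).toLp _
      map_add' := fun u v => by
        apply Lp.ext
        filter_upwards [(memLp_mul h (u + v)).coeFn_toLp, (memLp_mul h u).coeFn_toLp,
          (memLp_mul h v).coeFn_toLp, Lp.coeFn_add u v,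
          Lp.coeFn_add ((memLp_mul h u).toLp _) ((memLp_mul h v).toLp _)] with x h1 h2 h3 h4 h5
        rw [h1, h5, Pi.add_apply, h2, h3, h4, Pi.add_apply, mul_add]
      map_smul' := fun c u => by
        apply Lp.ext
        filter_upwards [(memLp_mul h (c • u)).coeFn_toLp, (memLp_mul h u).coeFn_toLp,
          Lp.coeFn_smul c u, Lp.coeFn_smul c ((memLp_mul h u).toLp _)] with x h1 h2 h3 h4
        simp only [RingHom.id_apply]
        rw [h1, h4, Pi.smul_apply, h2, h3, Pi.smul_apply, smul_eq_mul, smul_eq_mul]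
        ring } ‖h‖ (fun u => by
      refine Lp.norm_le_mul_norm_of_ae_le_mul ?_
      filter_upwards [(memLp_mul h u).coeFn_toLp] with x h1
      simp only [LinearMap.coe_mk, AddHom.coe_mk]
      rw [h1, norm_mul]
      gcongr
      exact h.norm_coe_le_norm x)

theorem coeFn_mulL (h : RSpace n →ᵇ ℂ) (u : L2Space n) :
    mulL h u =ᵐ[volume] fun x => h x * u x :=
  (memLp_mul h u).coeFn_toLp

theorem norm_mulL_le_of_ae {h : RSpace n →ᵇ ℂ} {u : L2Space n} {C : ℝ}
    (hC : ∀ᵐ x, ‖h x * u x‖ ≤ C * ‖u x‖) : ‖mulL h u‖ ≤ C * ‖u‖ := by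
  refine Lp.norm_le_mul_norm_of_ae_le_mul ?_
  filter_upwards [coeFn_mulL h u, hC] with x h1 h2
  rwa [h1]

theorem norm_mulL_le {h : RSpace n →ᵇ ℂ} {C : ℝ} (hC : ∀ x, ‖h x‖ ≤ C) (u : L2Space n) :
    ‖mulL h u‖ ≤ C * ‖u‖ :=
  norm_mulL_le_of_ae (Eventually.of_forall fun x => by rw [norm_mul]; gcongr; exact hC x)

theorem mulL_mulL (h k : RSpace n →ᵇ ℂ) (u : L2Space n) : mulL h (mulL k u) = mulL (h * k) u := by
  apply Lp.ext
  filter_upwards [coeFn_mulL h (mulL k u), coeFn_mulL k u, coeFn_mulL (h * k) u] with x h1 h2 h3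
  rw [h1, h2, h3, BoundedContinuousFunction.mul_apply, mul_assoc]

theorem mulL_one (u : L2Space n) : mulL 1 u = u := by
  apply Lp.ext
  filter_upwards [coeFn_mulL 1 u] with x h1
  rw [h1, BoundedContinuousFunction.coe_one, Pi.one_apply, one_mul]

theorem mulL_add (h k : RSpace n →ᵇ ℂ) (u : L2Space n) :
    mulL (h + k) u = mulL h u + mulL k u := by
  apply Lp.ext
  filter_upwards [coeFn_mulL h u, coeFn_mulL k u, coeFn_mulL (h + k) u,
    Lp.coeFn_add (mulL h u) (mulL k u)] with x h1 h2 h3 h4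
  rw [h3, h4, Pi.add_apply, h1, h2, BoundedContinuousFunction.add_apply, add_mul]

theorem inner_mulL_right (h : RSpace n →ᵇ ℂ) (u v : L2Space n) :
    inner ℂ u (mulL h v) = ∫ x, h x * (v x * conj (u x)) := by
  rw [L2.inner_def]
  refine integral_congr_ae ?_
  filter_upwards [coeFn_mulL h v] with x h1
  rw [h1, RCLike.inner_apply, mul_assoc]

theorem inner_mulL_left (h : RSpace n →ᵇ ℂ) (u v : L2Space n) :
    inner ℂ (mulL h u) v = inner ℂ u (mulL (star h) v) := by
  rw [inner_mulL_right, L2.inner_def]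
  refine integral_congr_ae ?_
  filter_upwards [coeFn_mulL h u] with x h1
  rw [h1, RCLike.inner_apply, BoundedContinuousFunction.star_apply, map_mul]
  simp only [RCLike.star_def]
  ring

theorem l2Pairing_eq_inner {f : RSpace n → ℂ} {v : L2Space n} (hf : v =ᵐ[volume] f)
    (u : L2Space n) : l2Pairing f u = inner ℂ v u := by
  rw [L2.inner_def, l2Pairing]
  refine integral_congr_ae ?_
  filter_upwards [hf] with x h1
  rw [← h1, RCLike.inner_apply, mul_comm]

/-- The unimodular function `e^{-i a}`. -/
def expPhase (a : C(RSpace n, ℝ)) : RSpace n →ᵇ ℂ :=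
  BoundedContinuousFunction.ofNormedAddCommGroup (fun x => Complex.exp (-Complex.I * (a x : ℂ)))
    (by fun_prop) 1 (fun x => by rw [Complex.norm_exp]; simp)

@[simp] theorem expPhase_apply (a : C(RSpace n, ℝ)) (x : RSpace n) :
    expPhase a x = Complex.exp (-Complex.I * (a x : ℂ)) := rfl

theorem norm_expPhase_apply (a : C(RSpace n, ℝ)) (x : RSpace n) : ‖expPhase a x‖ = 1 := by
  rw [expPhase_apply, Complex.norm_exp]; simp

theorem expPhase_mul (a b : C(RSpace n, ℝ)) : expPhase a * expPhase b = expPhase (a + b) := by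
  ext x
  simp only [BoundedContinuousFunction.mul_apply, expPhase_apply, ContinuousMap.add_apply]
  rw [← Complex.exp_add]
  congr 1
  push_cast
  ring

theorem expPhase_zero : expPhase (0 : C(RSpace n, ℝ)) = 1 := by
  ext x
  simp

/-- The unitary operator of multiplication by `e^{-i a}`. -/
def phase (a : C(RSpace n, ℝ)) : L2Space n ≃ₗᵢ[ℂ] L2Space n where
  toFun := mulL (expPhase a)
  invFun := mulL (expPhase (-a))
  map_add' := map_add _
  map_smul' := map_smul _
  left_inv u := by
    rw [mulL_mulL, expPhase_mul, neg_add_cancel, expPhase_zero, mulL_one]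
  right_inv u := by
    rw [mulL_mulL, expPhase_mul, add_neg_cancel, expPhase_zero, mulL_one]
  norm_map' u := by
    have h : ∀ a : C(RSpace n, ℝ), ∀ u, ‖mulL (expPhase a) u‖ ≤ ‖u‖ := fun a u => by
      simpa using norm_mulL_le (h := expPhase a) (C := 1) (fun x => (norm_expPhase_apply a x).le) u
    refine le_antisymm (h a u) ?_
    have h2 := h (-a) (mulL (expPhase a) u)
    rwa [mulL_mulL, expPhase_mul, neg_add_cancel, expPhase_zero, mulL_one] at h2

theorem phase_eq (a : C(RSpace n, ℝ)) (u : L2Space n) : phase a u = mulL (expPhase a) u := rfl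

theorem phase_symm_eq (a : C(RSpace n, ℝ)) (u : L2Space n) : (phase a).symm u = phase (-a) u := rfl

theorem coeFn_phase (a : C(RSpace n, ℝ)) (u : L2Space n) :
    phase a u =ᵐ[volume] fun x => Complex.exp (-Complex.I * (a x : ℂ)) * u x :=
  coeFn_mulL _ _

theorem phase_phase (a b : C(RSpace n, ℝ)) (u : L2Space n) :
    phase a (phase b u) = phase (a + b) u := by
  rw [phase_eq, phase_eq, mulL_mulL, expPhase_mul, phase_eq]

theorem phase_zero (u : L2Space n) : phase 0 u = u := by
  rw [phase_eq, expPhase_zero, mulL_one]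

theorem phaseMul_eq_phase (a : C(RSpace n, ℝ)) (u : L2Space n) : phaseMul a u = phase a u :=
  Lp.ext ((coeFn_phaseMul a.measurable u).trans (coeFn_phase a u).symm)

/-- Dominated convergence in `L²`. -/
theorem tendsto_L2_of_dominated {ι : Type*} {l : Filter ι} [l.IsCountablyGenerated]
    {F : ι → L2Space n} {f : L2Space n} {G : ι → RSpace n → ℂ} {g : RSpace n → ℂ}
    {B : RSpace n → ℝ} (hF : ∀ i, F i =ᵐ[volume] G i) (hf : f =ᵐ[volume] g)
    (hB : MemLp B 2 volume) (hb : ∀ᶠ i in l, ∀ᵐ x, ‖G i x‖ ≤ B x)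
    (hg : ∀ᵐ x, ‖g x‖ ≤ B x)
    (hlim : ∀ᵐ x, Tendsto (fun i => G i x) l (𝓝 (g x))) : Tendsto F l (𝓝 f) := by
  rw [tendsto_iff_norm_sub_tendsto_zero]
  have hsq : Tendsto (fun i => ‖F i - f‖ ^ 2) l (𝓝 0) := by
    have h1 : ∀ i, ‖F i - f‖ ^ 2 = ∫ x, ‖G i x - g x‖ ^ 2 := fun i => by
      rw [norm_sq_eq_integral_norm_sq]
      refine integral_congr_ae ?_
      filter_upwards [Lp.coeFn_sub (F i) f, hF i, hf] with x h2 h3 h4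
      rw [h2, Pi.sub_apply, h3, h4]
    simp_rw [h1]
    have h0 : (0 : ℝ) = ∫ _x : RSpace n, (0 : ℝ) := by simp
    rw [h0]
    refine tendsto_integral_filter_of_dominated_convergence (fun x => (2 * B x) ^ 2) ?_ ?_ ?_ ?_
    · refine Eventually.of_forall fun i => ?_
      have : AEStronglyMeasurable (fun x => F i x - f x) volume :=
        (Lp.aestronglyMeasurable _).sub (Lp.aestronglyMeasurable _)
      refine (this.congr ?_).norm.pow 2
      filter_upwards [hF i, hf] with x h3 h4
      rw [h3, h4]
    · filter_upwards [hb] with i hi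
      filter_upwards [hi, hg] with x h1 h2
      rw [Real.norm_eq_abs, abs_of_nonneg (by positivity)]
      have := norm_sub_le (G i x) (g x)
      gcongr
      linarith
    · exact (hB.const_mul 2).integrable_sq
    · filter_upwards [hlim] with x hx
      have := ((hx.sub_const (g x)).norm.pow 2)
      simpa using this
  have := hsq.sqrt
  simpa [Real.sqrt_sq (norm_nonneg _)] using this

/-- Multiplication by a family of uniformly bounded functions depending continuously on a
parameter is strongly continuous. -/
theorem tendsto_mulL {ι : Type*} {l : Filter ι} [l.IsCountablyGenerated]
    {h : ι → RSpace n →ᵇ ℂ} {k : RSpace n →ᵇ ℂ} {C : ℝ} (hC : ∀ i x, ‖h i x‖ ≤ C)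
    (hk : ∀ x, ‖k x‖ ≤ C)
    (hlim : ∀ x, Tendsto (fun i => h i x) l (𝓝 (k x))) (u : L2Space n) :
    Tendsto (fun i => mulL (h i) u) l (𝓝 (mulL k u)) := by
  refine tendsto_L2_of_dominated (B := fun x => C * ‖u x‖) (fun i => coeFn_mulL (h i) u)
    (coeFn_mulL k u) ((Lp.memLp u).norm.const_mul C) ?_ ?_ ?_
  · refine Eventually.of_forall fun i => Eventually.of_forall fun x => ?_
    rw [norm_mul]; gcongr; exact hC i x
  · refine Eventually.of_forall fun x => ?_
    rw [norm_mul]; gcongr; exact hk x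
  · exact Eventually.of_forall fun x => (hlim x).mul_const _

theorem continuous_mulL {h : ℝ → RSpace n →ᵇ ℂ} {C : ℝ} (hC : ∀ t x, ‖h t x‖ ≤ C)
    (hc : ∀ x, Continuous fun t => h t x) (u : L2Space n) : Continuous fun t => mulL (h t) u :=
  continuous_iff_continuousAt.2 fun t => tendsto_mulL hC (hC t) (fun x => (hc x).continuousAt) u

theorem continuous_phase {a : ℝ → C(RSpace n, ℝ)} (ha : ∀ x, Continuous fun t => a t x)
    (u : L2Space n) : Continuous fun t => phase (a t) u :=
  continuous_mulL (C := 1) (fun t x => (norm_expPhase_apply (a t) x).le)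
    (fun x => by have := ha x; simp only [expPhase_apply]; fun_prop) u

/-- A phase depending differentiably on a parameter gives a strongly differentiable family of
multiplication operators. -/
theorem hasDerivAt_phase {a : ℝ → C(RSpace n, ℝ)} {a' : ℝ → RSpace n → ℝ} {b : RSpace n → ℝ}
    (hd : ∀ s x, HasDerivAt (fun s => a s x) (a' s x) s) (hb : ∀ s x, |a' s x| ≤ b x)
    {u v : L2Space n} (hbu : MemLp (fun x => b x * ‖u x‖) 2 volume) {t : ℝ}
    (hv : v =ᵐ[volume] fun x =>
      -Complex.I * (a' t x : ℂ) * (Complex.exp (-Complex.I * (a t x : ℂ)) * u x)) :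
    HasDerivAt (fun s => phase (a s) u) v t := by
  have hde : ∀ s x, HasDerivAt (fun s => Complex.exp (-Complex.I * (a s x : ℂ)) * u x)
      (-Complex.I * (a' s x : ℂ) * (Complex.exp (-Complex.I * (a s x : ℂ)) * u x)) s := by
    intro s x
    have := (((hd s x).ofReal_comp.const_mul (-Complex.I)).cexp).mul_const (u x)
    exact this.congr_deriv (by ring)
  have hnorm : ∀ s x, ‖-Complex.I * (a' s x : ℂ) *
      (Complex.exp (-Complex.I * (a s x : ℂ)) * u x)‖ ≤ b x * ‖u x‖ := by
    intro s x
    have h1 : ‖Complex.exp (-Complex.I * (a s x : ℂ))‖ = 1 := norm_expPhase_apply (a s) x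
    rw [norm_mul, norm_mul, norm_mul, h1, norm_neg, Complex.norm_I, Complex.norm_real,
      Real.norm_eq_abs, one_mul, one_mul]
    gcongr
    exact hb s x
  rw [hasDerivAt_iff_tendsto_slope]
  refine tendsto_L2_of_dominated (B := fun x => b x * ‖u x‖)
    (G := fun s x => slope (fun s => Complex.exp (-Complex.I * (a s x : ℂ)) * u x) t s)
    (fun s => ?_) hv hbu ?_ ?_ ?_
  · have h1 := Lp.coeFn_smul ((s - t)⁻¹ : ℝ) (phase (a s) u - phase (a t) u)
    simp only [slope, vsub_eq_sub]
    filter_upwards [h1, Lp.coeFn_sub (phase (a s) u) (phase (a t) u), coeFn_phase (a s) u,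
      coeFn_phase (a t) u] with x h1 h2 h3 h4
    rw [h1, Pi.smul_apply, h2, Pi.sub_apply, h3, h4]
  · refine Eventually.of_forall fun s => Eventually.of_forall fun x => ?_
    -- By the mean value inequality `b x * ‖u x‖` dominates every difference quotient.
    have := Convex.norm_image_sub_le_of_norm_hasDerivWithin_le (s := Set.univ) (x := t) (y := s)
      (fun s _ => (hde s x).hasDerivWithinAt) (fun s _ => hnorm s x) convex_univ trivial trivial
    rw [slope, vsub_eq_sub, norm_smul, norm_inv, Real.norm_eq_abs]
    rw [Real.norm_eq_abs] at this
    have hbx : 0 ≤ b x * ‖u x‖ := (norm_nonneg _).trans (hnorm t x)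
    rcases eq_or_ne s t with rfl | hst
    · simpa using hbx
    · rw [inv_mul_le_iff₀ (abs_pos.2 (sub_ne_zero.2 hst)), mul_comm |s - t|]
      exact this
  · exact Eventually.of_forall fun x => hnorm t x
  · exact Eventually.of_forall fun x => hasDerivAt_iff_tendsto_slope.1 (hde t x)

end

/-! ### Fourier transform, translations and the Galilei transformation -/

noncomputable section

open scoped BoundedContinuousFunction ComplexConjugate ContDiff FourierTransform

variable {n : ℕ}

/-- The Fourier transform on `L²`. -/
abbrev fourierL (n : ℕ) : L2Space n ≃ₗᵢ[ℂ] L2Space n := Lp.fourierTransformₗᵢ (RSpace n) ℂ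

theorem fourierL_eq (u : L2Space n) : fourierL n u = 𝓕 u := rfl

theorem fourierL_symm_eq (u : L2Space n) : (fourierL n).symm u = 𝓕⁻ u := rfl

/-- The `L²` Fourier transform of an integrable function is given by the Fourier integral. -/
theorem coeFn_fourierL_of_integrable {u : L2Space n} {f : RSpace n → ℂ} (hu : u =ᵐ[volume] f)
    (hf : Integrable f) : fourierL n u =ᵐ[volume] 𝓕 f := by
  have hcont : Continuous (𝓕 f) :=
    VectorFourier.fourierIntegral_continuous Real.continuous_fourierChar continuous_inner hf
  refine ae_eq_of_integral_contDiff_smul_eq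
    ((Lp.memLp (fourierL n u)).locallyIntegrable (by norm_num)) hcont.locallyIntegrable ?_
  -- Tested against `g`, the transform moves onto `g` on both sides: through tempered distributions
  -- for the `L²` transform, by Fubini for the Fourier integral.
  intro g g_smooth g_cpt
  have hg₁ : HasCompactSupport (Complex.ofRealCLM ∘ g) := g_cpt.comp_left rfl
  have hg₂ : ContDiff ℝ ∞ (Complex.ofRealCLM ∘ g) := by fun_prop
  set G := hg₁.toSchwartzMap hg₂
  have h1 : ∫ x, g x • fourierL n u x = Lp.toTemperedDistribution (𝓕 u) G := by
    simp [G, fourierL_eq]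
  have h2 : Lp.toTemperedDistribution u (𝓕 G) = ∫ x, (𝓕 (G : RSpace n → ℂ)) x • f x := by
    rw [Lp.toTemperedDistribution_apply]
    refine integral_congr_ae ?_
    filter_upwards [hu] with x hx
    rw [hx, fourier_coe]
  rw [h1, ← Lp.fourier_toTemperedDistribution_eq, TemperedDistribution.fourier_apply, h2]
  have h3 := VectorFourier.integral_fourierIntegral_smul_eq_flip (L := innerₗ (RSpace n))
    (μ := volume) (ν := volume) Real.continuous_fourierChar continuous_inner G.integrable hf
  rw [flip_innerₗ] at h3
  refine Eq.trans h3 ?_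
  simp [G]
  rfl

/-- Translation on `L²`. -/
def shift (y : RSpace n) : L2Space n →ₗᵢ[ℂ] L2Space n :=
  Lp.compMeasurePreservingₗᵢ ℂ (fun x => x + y) (measurePreserving_add_right volume y)

theorem coeFn_shift (y : RSpace n) (u : L2Space n) :
    shift y u =ᵐ[volume] fun x => u (x + y) :=
  Lp.coeFn_compMeasurePreserving u (measurePreserving_add_right volume y)

/-- The linear function `x ↦ ⟨x, y⟩`. -/
def lin (y : RSpace n) : C(RSpace n, ℝ) := ⟨fun x => inner ℝ x y, by fun_prop⟩

@[simp] theorem lin_apply (y x : RSpace n) : lin y x = inner ℝ x y := rfl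

/-- The quadratic function `x ↦ ‖x‖²`. -/
def normSq (n : ℕ) : C(RSpace n, ℝ) := ⟨fun x => ‖x‖ ^ 2, by fun_prop⟩

@[simp] theorem normSq_apply (x : RSpace n) : normSq n x = ‖x‖ ^ 2 := rfl

/-- Translation of a continuous function. -/
def translateC (y : RSpace n) (a : C(RSpace n, ℝ)) : C(RSpace n, ℝ) :=
  ⟨fun x => a (x + y), by fun_prop⟩

@[simp] theorem translateC_apply (y : RSpace n) (a : C(RSpace n, ℝ)) (x : RSpace n) :
    translateC y a x = a (x + y) := rfl

theorem shift_phase (y : RSpace n) (a : C(RSpace n, ℝ)) (u : L2Space n) :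
    shift y (phase a u) = phase (translateC y a) (shift y u) := by
  apply Lp.ext
  have h := (quasiMeasurePreserving_add_right (volume : Measure (RSpace n)) y).ae_eq_comp
    (coeFn_phase a u)
  filter_upwards [coeFn_shift y (phase a u), coeFn_phase (translateC y a) (shift y u),
    coeFn_shift y u, h] with x h1 h2 h3 h4
  rw [h1, h2, h3]
  exact h4

/-- Schwartz functions are dense, and on them the `L²` transform is an honest integral; this reduces
operator identities to changes of variable. -/
theorem ext_on_schwartz {A B : L2Space n → L2Space n} (hA : Continuous A) (hB : Continuous B)
    (h : ∀ φ : 𝓢(RSpace n, ℂ), A (φ.toLp 2) = B (φ.toLp 2)) (u : L2Space n) : A u = B u :=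
  DenseRange.induction_on (p := fun u => A u = B u)
    (SchwartzMap.denseRange_toLpCLM (E := RSpace n) (F := ℂ) (p := 2) (μ := volume)
      ENNReal.ofNat_ne_top) u (isClosed_eq hA hB) h

theorem fourierL_shift (y : RSpace n) (u : L2Space n) :
    fourierL n (shift y u) = phase (lin (-(2 * Real.pi) • y)) (fourierL n u) := by
  refine ext_on_schwartz (A := fun u => fourierL n (shift y u))
    (B := fun u => phase (lin (-(2 * Real.pi) • y)) (fourierL n u))
    ((fourierL n).continuous.comp (shift y).continuous)
    ((phase _).continuous.comp (fourierL n).continuous) (fun φ => ?_) u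
  apply Lp.ext
  have h00 := (quasiMeasurePreserving_add_right (volume : Measure (RSpace n)) y).ae_eq_comp
    (φ.coeFn_toLp 2 volume)
  have h0 : shift y (φ.toLp 2) =ᵐ[volume] fun x => φ (x + y) := by
    filter_upwards [coeFn_shift y (φ.toLp 2), h00] with x h1 h2
    rw [h1]
    exact h2
  filter_upwards [coeFn_fourierL_of_integrable h0 (φ.integrable.comp_add_right y),
    coeFn_phase (lin (-(2 * Real.pi) • y)) (fourierL n (φ.toLp 2)),
    coeFn_fourierL_of_integrable (φ.coeFn_toLp 2 volume) φ.integrable] with x h1 h2 h3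
  rw [h1, h2, h3]
  have h4 := congrFun (VectorFourier.fourierIntegral_comp_add_right Real.fourierChar
    (volume : Measure (RSpace n)) (innerₗ (RSpace n)) φ y) x
  refine Eq.trans h4 ?_
  rw [Circle.smul_def, smul_eq_mul, Real.fourierChar_apply]
  congr 2
  simp only [lin_apply, innerₗ_apply_apply, inner_smul_right, real_inner_comm]
  push_cast
  ring

theorem fourierL_phase_lin (y : RSpace n) (u : L2Space n) :
    fourierL n (phase (lin ((2 * Real.pi) • y)) u) = shift y (fourierL n u) := by
  refine ext_on_schwartz (A := fun u => fourierL n (phase (lin ((2 * Real.pi) • y)) u))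
    (B := fun u => shift y (fourierL n u))
    ((fourierL n).continuous.comp (phase _).continuous)
    ((shift y).continuous.comp (fourierL n).continuous) (fun φ => ?_) u
  apply Lp.ext
  have h0 : phase (lin ((2 * Real.pi) • y)) (φ.toLp 2) =ᵐ[volume]
      fun x => expPhase (lin ((2 * Real.pi) • y)) x * φ x := by
    filter_upwards [coeFn_phase (lin ((2 * Real.pi) • y)) (φ.toLp 2), φ.coeFn_toLp 2 volume]
      with x h1 h2
    rw [h1, h2, expPhase_apply]
  have hint : Integrable fun x => expPhase (lin ((2 * Real.pi) • y)) x * φ x :=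
    φ.integrable.bdd_mul (c := 1) (expPhase _).continuous.aestronglyMeasurable
      (Eventually.of_forall fun x => (norm_expPhase_apply _ x).le)
  have h5 := (quasiMeasurePreserving_add_right (volume : Measure (RSpace n)) y).ae_eq_comp
    (coeFn_fourierL_of_integrable (φ.coeFn_toLp 2 volume) φ.integrable)
  filter_upwards [coeFn_fourierL_of_integrable h0 hint, coeFn_shift y (fourierL n (φ.toLp 2)), h5]
    with x h1 h2 h3
  rw [h1, h2]
  refine Eq.trans ?_ h3.symm
  simp only [Function.comp_apply, Real.fourier_eq]
  refine integral_congr_ae (Eventually.of_forall fun z => ?_)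
  simp only [Circle.smul_def, smul_eq_mul, Real.fourierChar_apply, expPhase_apply, lin_apply]
  rw [← mul_assoc, ← Complex.exp_add]
  congr 2
  simp only [inner_smul_right, inner_add_right]
  push_cast
  ring

/-- The unitary group `e^{-iθ|ξ|²}` in the Fourier variable `ξ`. -/
def freeEvol (θ : ℝ) : L2Space n ≃ₗᵢ[ℂ] L2Space n :=
  (fourierL n).trans ((phase (θ • normSq n)).trans (fourierL n).symm)

theorem freeEvol_apply (θ : ℝ) (u : L2Space n) :
    freeEvol θ u = (fourierL n).symm (phase (θ • normSq n) (fourierL n u)) := rfl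

theorem freeEvol_symm_apply (θ : ℝ) (u : L2Space n) :
    (freeEvol θ).symm u = (fourierL n).symm ((phase (θ • normSq n)).symm (fourierL n u)) := rfl

theorem fourierL_symm_phase_lin (y : RSpace n) (u : L2Space n) :
    (fourierL n).symm (phase (lin (-(2 * Real.pi) • y)) u) = shift y ((fourierL n).symm u) := by
  rw [LinearIsometryEquiv.symm_apply_eq, fourierL_shift, LinearIsometryEquiv.apply_symm_apply]

theorem fourierL_symm_shift (y : RSpace n) (u : L2Space n) :
    (fourierL n).symm (shift y u) = phase (lin ((2 * Real.pi) • y)) ((fourierL n).symm u) := by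
  rw [LinearIsometryEquiv.symm_apply_eq, fourierL_phase_lin, LinearIsometryEquiv.apply_symm_apply]

/-- The operator `e^{-iτp²/2} e^{-i|x|²/(2τ)} 𝓕⁻¹`, which turns position into `2πτ` times
frequency. -/
def galilei (τ : ℝ) : L2Space n ≃ₗᵢ[ℂ] L2Space n :=
  (fourierL n).symm.trans ((phase ((2 * τ)⁻¹ • normSq n)).trans (freeEvol (2 * Real.pi ^ 2 * τ)))

theorem galilei_apply (τ : ℝ) (u : L2Space n) : galilei τ u = freeEvol (2 * Real.pi ^ 2 * τ)
    (phase ((2 * τ)⁻¹ • normSq n) ((fourierL n).symm u)) := rfl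

/-- Commuting `e^{-i⟨x,y⟩}` through `e^{-iτp²/2}` produces a translation by `-τy` and the constant
phase `τ‖y‖²/2`. The translation acts on `e^{-i‖x‖²/(2τ)}` by completing the square, which absorbs
both the constant and the character; only a translation of `𝓕⁻¹u` is left, that is, a character
acting on `u`. -/
theorem phase_lin_galilei {τ : ℝ} (hτ : τ ≠ 0) (y : RSpace n) (u : L2Space n) :
    phase (lin y) (galilei τ u) = galilei τ (phase (lin ((2 * Real.pi * τ) • y)) u) := by
  have hpi := Real.pi_ne_zero
  have hy : y = (2 * Real.pi) • ((2 * Real.pi)⁻¹ • y) := by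
    rw [smul_smul, mul_inv_cancel₀ (by positivity), one_smul]
  have h1 : ∀ g : L2Space n, phase (lin y) (freeEvol (2 * Real.pi ^ 2 * τ) g) =
      freeEvol (2 * Real.pi ^ 2 * τ) (phase (ContinuousMap.const _ (τ * ‖y‖ ^ 2 / 2))
        (shift (-τ • y) (phase (lin y) g))) := by
    intro g
    apply (fourierL n).injective
    rw [freeEvol_apply, freeEvol_apply, LinearIsometryEquiv.apply_symm_apply]
    conv_lhs => rw [hy, fourierL_phase_lin, LinearIsometryEquiv.apply_symm_apply, shift_phase,
      ← fourierL_phase_lin, ← hy]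
    have hc : ∀ (c : ℝ) (u : L2Space n), fourierL n (phase (ContinuousMap.const _ c) u) =
        phase (ContinuousMap.const _ c) (fourierL n u) := by
      intro c u
      have : ∀ u : L2Space n, phase (ContinuousMap.const _ c) u =
          Complex.exp (-Complex.I * (c : ℂ)) • u := fun u => by
        apply Lp.ext
        filter_upwards [coeFn_phase (ContinuousMap.const _ c) u,
          Lp.coeFn_smul (Complex.exp (-Complex.I * (c : ℂ))) u] with x h1 h2
        rw [h1, h2]
        rfl
      rw [this, this, map_smul]
    rw [hc, fourierL_shift, phase_phase, phase_phase]
    congr 2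
    ext x
    simp only [translateC_apply, ContinuousMap.coe_smul, Pi.smul_apply, normSq_apply, smul_eq_mul,
      ContinuousMap.add_apply, ContinuousMap.const_apply, lin_apply, norm_add_sq_real,
      inner_smul_right, norm_smul, norm_inv, Real.norm_eq_abs, mul_pow, inv_pow, sq_abs]
    field_simp
    ring
  rw [galilei_apply, galilei_apply, h1]
  congr 1
  have h2 : phase (lin ((2 * Real.pi * τ) • y)) u = phase (lin (-(2 * Real.pi) • (-τ • y))) u := by
    rw [smul_smul, neg_mul_neg]
  rw [h2, fourierL_symm_phase_lin, phase_phase, shift_phase, phase_phase]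
  congr 2
  ext x
  simp only [translateC_apply, ContinuousMap.coe_smul, Pi.smul_apply, normSq_apply, smul_eq_mul,
    ContinuousMap.add_apply, ContinuousMap.const_apply, lin_apply, norm_add_sq_real,
    inner_smul_right, inner_add_left, norm_smul, real_inner_smul_left, real_inner_self_eq_norm_sq,
    norm_neg, Real.norm_eq_abs, mul_pow, sq_abs]
  field_simp
  ring

/-! ### From characters to arbitrary bounded multipliers -/

/-- The measure with density `|u|²`. -/
def l2Density (u : L2Space n) : Measure (RSpace n) :=
  volume.withDensity fun x => ENNReal.ofReal (‖u x‖ ^ 2)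

instance (u : L2Space n) : IsFiniteMeasure (l2Density u) :=
  isFiniteMeasure_withDensity_ofReal (integrable_norm_sq u).2

theorem integral_l2Density (h : RSpace n →ᵇ ℂ) (u : L2Space n) :
    ∫ x, h x ∂(l2Density u) = inner ℂ u (mulL h u) := by
  rw [l2Density, integral_withDensity_eq_integral_toReal_smul₀
    ((Lp.aestronglyMeasurable u).norm.aemeasurable.pow_const 2).ennreal_ofReal
    (Eventually.of_forall fun x => ENNReal.ofReal_lt_top), inner_mulL_right]
  refine integral_congr_ae (Eventually.of_forall fun x => ?_)
  simp only
  rw [ENNReal.toReal_ofReal (by positivity), Complex.mul_conj, Complex.normSq_eq_norm_sq,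
    Complex.real_smul, mul_comm]

/-- A unitary operator which intertwines characters intertwines all multiplication operators. -/
theorem mulL_intertwine {T : L2Space n ≃ₗᵢ[ℂ] L2Space n} {c : ℝ}
    (hT : ∀ y u, phase (lin y) (T u) = T (phase (lin (c • y)) u)) (h : RSpace n →ᵇ ℂ)
    (u : L2Space n) :
    mulL h (T u) = T (mulL (h.compContinuous ⟨fun x => c • x, by fun_prop⟩) u) := by
  have hm : Measurable fun x : RSpace n => c • x := measurable_const_smul c
  -- The hypothesis says that `|Tu|²` and the dilated `|u|²` have the same characteristic function,
  -- and this determines a finite measure.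
  have hmeas : ∀ u : L2Space n, l2Density (T u) = (l2Density u).map (fun x => c • x) := by
    intro u
    have : IsFiniteMeasure ((l2Density u).map (fun x => c • x)) := Measure.isFiniteMeasure_map _ _
    apply Measure.ext_of_charFun
    ext y
    have he : ∀ y x : RSpace n, Complex.exp ((inner ℝ x y : ℝ) * Complex.I) =
        expPhase (lin (-y)) x := fun y x => by
      rw [expPhase_apply, lin_apply, inner_neg_right]
      congr 1
      push_cast
      ring
    rw [charFun_apply, charFun_apply,
      integral_map hm.aemeasurable (by fun_prop)]
    simp_rw [he]
    have he2 : ∀ x : RSpace n, expPhase (lin (-y)) (c • x) = expPhase (lin (c • -y)) x := fun x => by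
      simp [inner_smul_left, inner_smul_right]
    simp_rw [he2]
    rw [integral_l2Density, integral_l2Density, ← phase_eq, ← phase_eq, hT,
      LinearIsometryEquiv.inner_map_map]
  set k : RSpace n →ᵇ ℂ := h.compContinuous ⟨fun x => c • x, by fun_prop⟩
  have hq : ∀ u, inner ℂ u (T.symm (mulL h (T u)) - mulL k u) = 0 := fun u => by
    have h1 : inner ℂ (T u) (mulL h (T u)) = inner ℂ u (mulL k u) := by
      rw [← integral_l2Density, ← integral_l2Density, hmeas,
        integral_map hm.aemeasurable h.continuous.aestronglyMeasurable]
      rfl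
    rw [inner_sub_right, ← h1, ← LinearIsometryEquiv.inner_map_map T,
      LinearIsometryEquiv.apply_symm_apply, sub_self]
  -- On a complex Hilbert space equality of quadratic forms implies equality of operators.
  have h0 := (inner_map_self_eq_zero
    ((T.symm.toLinearEquiv.toLinearMap ∘ₗ (mulL h).toLinearMap ∘ₗ T.toLinearEquiv.toLinearMap) -
      (mulL k).toLinearMap)).1 (fun u => inner_eq_zero_symm.1 (hq u))
  have h1 := LinearMap.congr_fun h0 u
  have h2 : T.symm (mulL h (T u)) = mulL k u := sub_eq_zero.1 h1
  rw [← h2, LinearIsometryEquiv.apply_symm_apply]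

theorem mulL_galilei {τ : ℝ} (hτ : τ ≠ 0) (h : RSpace n →ᵇ ℂ) (u : L2Space n) :
    mulL h (galilei τ u) =
      galilei τ (mulL (h.compContinuous ⟨fun x => (2 * Real.pi * τ) • x, by fun_prop⟩) u) :=
  mulL_intertwine (phase_lin_galilei hτ) h u

end

/-! ### Second moments from difference quotients in the Fourier variable -/

noncomputable section

open scoped BoundedContinuousFunction ComplexConjugate ContDiff FourierTransform

variable {n : ℕ}

/-- The function `e^{-ih⟨x, e⟩} - 1`. -/
def phaseSubOne (h : ℝ) (e : RSpace n) : RSpace n →ᵇ ℂ := expPhase (lin (h • e)) - 1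

theorem tendsto_phaseSubOne (e x : RSpace n) :
    Tendsto (fun k : ℕ => ((1 / ((k : ℝ) + 1) : ℝ) : ℂ)⁻¹ * phaseSubOne (1 / ((k : ℝ) + 1)) e x)
      atTop (𝓝 (-Complex.I * (inner ℝ x e : ℝ))) := by
  have hd : HasDerivAt (fun h : ℝ => Complex.exp (-Complex.I * ((h * inner ℝ x e : ℝ) : ℂ)))
      (-Complex.I * (inner ℝ x e : ℝ)) 0 := by
    have := ((((hasDerivAt_id (0 : ℝ)).mul_const (inner ℝ x e)).ofReal_comp).const_mul
      (-Complex.I)).cexp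
    simpa using this
  have h1 := hd.tendsto_slope_zero_right
  have h2 : Tendsto (fun k : ℕ => 1 / ((k : ℝ) + 1)) atTop (𝓝[>] 0) :=
    tendsto_nhdsWithin_iff.2 ⟨tendsto_one_div_add_atTop_nhds_zero_nat,
      Eventually.of_forall fun k => by simp only [Set.mem_Ioi]; positivity⟩
  refine (h1.comp h2).congr fun k => ?_
  simp only [Function.comp_apply, phaseSubOne, BoundedContinuousFunction.sub_apply,
    expPhase_apply, lin_apply, inner_smul_right, BoundedContinuousFunction.coe_one, Pi.one_apply,
    Complex.real_smul, Complex.ofReal_inv]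
  simp

/-- A bound on second difference quotients in the Fourier variable gives a bound on the second
moment. -/
theorem exists_second_moment (e : RSpace n) (u : L2Space n) {K : ℝ} (hK : 0 ≤ K)
    (h : ∀ h : ℝ, 0 < h → h ≤ 1 →
      ‖mulL (phaseSubOne h e) (mulL (phaseSubOne h e) u)‖ ≤ K * h ^ 2) :
    ∃ v : L2Space n, v =ᵐ[volume] (fun x => ((inner ℝ x e ^ 2 : ℝ) : ℂ) * u x) ∧ ‖v‖ ≤ K := by
  set hk : ℕ → ℝ := fun k => 1 / ((k : ℝ) + 1) with hkdef
  set f : ℕ → RSpace n → ℂ := fun k x =>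
    (((hk k : ℝ) : ℂ)⁻¹ * phaseSubOne (hk k) e x) ^ 2 * u x with hf
  set g : RSpace n → ℂ := fun x => (-Complex.I * (inner ℝ x e : ℝ)) ^ 2 * u x with hg
  have hpos : ∀ k, 0 < hk k := fun k => by simp only [hkdef]; positivity
  have hle : ∀ k, hk k ≤ 1 := fun k => by
    simp only [hkdef]
    rw [div_le_one (by positivity)]
    linarith [Nat.cast_nonneg (α := ℝ) k]
  have hfae : ∀ k, (((((hk k : ℝ) : ℂ)⁻¹) ^ 2 •
      mulL (phaseSubOne (hk k) e) (mulL (phaseSubOne (hk k) e) u) : L2Space n)) =ᵐ[volume] f k := by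
    intro k
    filter_upwards [Lp.coeFn_smul ((((hk k : ℝ) : ℂ)⁻¹) ^ 2)
      (mulL (phaseSubOne (hk k) e) (mulL (phaseSubOne (hk k) e) u)),
      coeFn_mulL (phaseSubOne (hk k) e) (mulL (phaseSubOne (hk k) e) u),
      coeFn_mulL (phaseSubOne (hk k) e) u] with x h1 h2 h3
    rw [h1, Pi.smul_apply, h2, h3, hf, smul_eq_mul]
    ring
  have hfm : ∀ k, AEStronglyMeasurable (f k) volume := fun k =>
    (Lp.aestronglyMeasurable _).congr (hfae k)
  have hfn : ∀ k, eLpNorm (f k) 2 volume ≤ ENNReal.ofReal K := by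
    intro k
    rw [← eLpNorm_congr_ae (hfae k), ← Lp.enorm_def, ← ofReal_norm]
    apply ENNReal.ofReal_le_ofReal
    rw [norm_smul, norm_pow, norm_inv, Complex.norm_real, Real.norm_eq_abs, abs_of_pos (hpos k),
      inv_pow, inv_mul_le_iff₀ (pow_pos (hpos k) 2), mul_comm]
    exact h (hk k) (hpos k) (hle k)
  have hlim : ∀ᵐ x, Tendsto (fun k => f k x) atTop (𝓝 (g x)) :=
    Eventually.of_forall fun x => ((tendsto_phaseSubOne e x).pow 2).mul_const _
  -- Fatou's lemma along `h = 1/(k+1)`: this proves square integrability of the limit and bounds it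
  -- at once.
  have hbound : eLpNorm g 2 volume ≤ ENNReal.ofReal K := by
    refine (Lp.eLpNorm_lim_le_liminf_eLpNorm hfm g hlim).trans ?_
    refine liminf_le_of_le (by isBoundedDefault) fun b hb => ?_
    obtain ⟨k, hk'⟩ := hb.exists
    exact hk'.trans (hfn k)
  have hgm : AEStronglyMeasurable g volume := aestronglyMeasurable_of_tendsto_ae atTop hfm hlim
  have hmem : MemLp g 2 volume := ⟨hgm, hbound.trans_lt ENNReal.ofReal_lt_top⟩
  -- The quotients converge to `(-i⟨x,e⟩)² u = -⟨x,e⟩² u`, hence the sign.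
  refine ⟨-hmem.toLp g, ?_, ?_⟩
  · filter_upwards [Lp.coeFn_neg (hmem.toLp g), hmem.coeFn_toLp] with x h1 h2
    rw [h1, Pi.neg_apply, h2, hg]
    simp only [mul_pow, neg_sq, Complex.I_sq]
    push_cast
    ring
  · rw [norm_neg, Lp.norm_toLp]
    exact ENNReal.toReal_le_of_le_ofReal hK hbound

/-- The mean value inequality, applied to `φ₁` and then to `φ(· + h) - φ`. -/
theorem norm_second_difference_le {φ φ₁ φ₂ : ℝ → ℂ} {M : ℝ}
    (h1 : ∀ r, HasDerivAt φ (φ₁ r) r) (h2 : ∀ r, HasDerivAt φ₁ (φ₂ r) r) (hM : ∀ r, ‖φ₂ r‖ ≤ M)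
    {h : ℝ} (hh : 0 < h) : ‖φ (2 * h) - φ h - (φ h - φ 0)‖ ≤ M * h ^ 2 := by
  have hd : ∀ r, ‖φ₁ (r + h) - φ₁ r‖ ≤ M * h := fun r => by
    have := Convex.norm_image_sub_le_of_norm_hasDerivWithin_le (s := Set.univ) (x := r) (y := r + h)
      (fun s _ => (h2 s).hasDerivWithinAt) (fun s _ => hM s) convex_univ trivial trivial
    simpa [abs_of_pos hh] using this
  have := Convex.norm_image_sub_le_of_norm_hasDerivWithin_le (s := Set.univ) (x := 0) (y := h)
    (f := fun r => φ (r + h) - φ r) (f' := fun r => φ₁ (r + h) - φ₁ r)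
    (fun s _ => (((h1 (s + h)).comp_add_const s h).sub (h1 s)).hasDerivWithinAt)
    (fun s _ => hd s) convex_univ trivial trivial
  simp only [sub_zero, zero_add, Real.norm_eq_abs, abs_of_pos hh] at this
  rw [two_mul]
  linarith

/-- A character in `x` is a translation in the Fourier variable, so multiplication by `e^{-ih⟨x,e⟩}
- 1` is a finite difference there. -/
theorem fourierL_symm_mulL_phaseSubOne (h : ℝ) (e : RSpace n) (u : L2Space n) :
    mulL (phaseSubOne h e) ((fourierL n).symm u) =
      (fourierL n).symm (shift ((h / (2 * Real.pi)) • e) u - u) := by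
  have : phaseSubOne h e = expPhase (lin (h • e)) + (-1) := by
    rw [phaseSubOne, sub_eq_add_neg]
  have hneg : ∀ v : L2Space n, mulL (-1) v = -v := fun v => by
    apply Lp.ext
    filter_upwards [coeFn_mulL (-1) v, Lp.coeFn_neg v] with x h1 h2
    rw [h1, h2]
    simp
  rw [this, mulL_add, hneg, map_sub, fourierL_symm_shift, ← phase_eq, smul_smul,
    mul_div_cancel₀ _ (by positivity), sub_eq_add_neg]

/-- The second moment of the inverse Fourier transform of a twice differentiable compactly
supported function is controlled by its second derivative. -/
theorem exists_second_moment_fourier {R : ℝ} {e : RSpace n} (he : ‖e‖ = 1)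
    {f f₁ f₂ : RSpace n → ℂ} {M : ℝ}
    (h1 : ∀ x r, HasDerivAt (fun r : ℝ => f (x + r • e)) (f₁ (x + r • e)) r)
    (h2 : ∀ x r, HasDerivAt (fun r : ℝ => f₁ (x + r • e)) (f₂ (x + r • e)) r)
    (hM : ∀ x, ‖f₂ x‖ ≤ M) (hsupp : ∀ x, R < ‖x‖ → f x = 0) {w : L2Space n}
    (hw : w =ᵐ[volume] f) :
    ∃ v : L2Space n, v =ᵐ[volume] (fun x => ((inner ℝ x e ^ 2 : ℝ) : ℂ) * (fourierL n).symm w x) ∧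
      ‖v‖ ≤ M * √(volume.real (Metric.closedBall (0 : RSpace n) (R + 2))) := by
  have hM0 : 0 ≤ M := (norm_nonneg _).trans (hM 0)
  refine exists_second_moment e _ (by positivity) fun h hh hh1 => ?_
  rw [fourierL_symm_mulL_phaseSubOne, fourierL_symm_mulL_phaseSubOne, LinearIsometryEquiv.norm_map]
  set c := h / (2 * Real.pi) with hc
  have hc0 : 0 < c := by positivity
  have hch : c ≤ h := div_le_self hh.le (by linarith [Real.pi_gt_three])
  -- Each of the two translations has length at most `1`, so the second difference of a function
  -- vanishing beyond radius `R` vanishes outside `B`.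
  set B := Metric.closedBall (0 : RSpace n) (R + 2)
  set d := shift (c • e) (shift (c • e) w - w) - (shift (c • e) w - w)
  have hq := (quasiMeasurePreserving_add_right (volume : Measure (RSpace n)) (c • e))
  have hae : ∀ᵐ x, ‖d x‖ ^ 2 ≤ B.indicator (fun _ => (M * h ^ 2) ^ 2) x := by
    filter_upwards [Lp.coeFn_sub (shift (c • e) (shift (c • e) w - w)) (shift (c • e) w - w),
      coeFn_shift (c • e) (shift (c • e) w - w), hq.ae_eq_comp (Lp.coeFn_sub (shift (c • e) w) w),
      Lp.coeFn_sub (shift (c • e) w) w, hq.ae_eq_comp (coeFn_shift (c • e) w),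
      coeFn_shift (c • e) w, hw, hq.ae_eq_comp hw, hq.ae_eq_comp (hq.ae_eq_comp hw)]
      with x k1 k2 k3 k4 k5 k6 k7 k8 k9
    simp only [Function.comp_apply, Pi.sub_apply] at k3 k5 k8 k9
    have hdx : d x = f (x + c • e + c • e) - f (x + c • e) - (f (x + c • e) - f x) := by
      rw [k1, Pi.sub_apply, k2, k3, k4, Pi.sub_apply, k5, k6, k7, k8, k9]
    rw [hdx]
    by_cases hx : x ∈ B
    · rw [Set.indicator_of_mem hx]
      have := norm_second_difference_le (h1 x) (h2 x) (fun r => hM _) hc0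
      rw [two_mul, add_smul, ← add_assoc, zero_smul, add_zero] at this
      refine pow_le_pow_left₀ (norm_nonneg _) (this.trans ?_) 2
      gcongr
    · rw [Set.indicator_of_notMem hx]
      have hx' : R + 2 < ‖x‖ := by simpa [B] using hx
      have hce : ‖c • e‖ ≤ 1 := by
        rw [norm_smul, he, mul_one, Real.norm_eq_abs, abs_of_pos hc0]; linarith
      have n1 : ‖x‖ ≤ ‖x + c • e‖ + ‖c • e‖ := by
        simpa using norm_sub_le (x + c • e) (c • e)
      have n2 : ‖x + c • e‖ ≤ ‖x + c • e + c • e‖ + ‖c • e‖ := by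
        simpa using norm_sub_le (x + c • e + c • e) (c • e)
      rw [hsupp x (by linarith), hsupp (x + c • e) (by linarith),
        hsupp (x + c • e + c • e) (by linarith)]
      simp
  have hBm : MeasurableSet B := Metric.isClosed_closedBall.measurableSet
  have hBf : volume B ≠ ⊤ := (isCompact_closedBall _ _).measure_lt_top.ne
  have hsq : ‖d‖ ^ 2 ≤ (M * √(volume.real B) * h ^ 2) ^ 2 := by
    rw [norm_sq_eq_integral_norm_sq]
    refine (integral_mono_ae (integrable_norm_sq d)
      ((integrable_indicator_iff hBm).2 (integrableOn_const hBf)) hae).trans (le_of_eq ?_)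
    rw [integral_indicator_const _ hBm, smul_eq_mul]
    have := Real.sq_sqrt (measureReal_nonneg (μ := volume) (s := B))
    linear_combination -(M * h ^ 2) ^ 2 * this
  exact (sq_le_sq₀ (norm_nonneg _) (by positivity)).1 hsq

end

/-! ### Strongly continuous families of operators and bounded linear evolution equations -/

noncomputable section

open scoped BoundedContinuousFunction

section StrongContinuity

variable {H : Type*} [NormedAddCommGroup H] [NormedSpace ℂ H]

/-- A uniformly bounded strongly convergent family of operators applied to a convergent family of
vectors. -/
theorem tendsto_apply_of_strong {ι : Type*} {l : Filter ι} {B : ι → H →L[ℂ] H} {B₀ : H →L[ℂ] H}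
    {C : ℝ} (hC : ∀ i ψ, ‖B i ψ‖ ≤ C * ‖ψ‖) (hB : ∀ ψ, Tendsto (fun i => B i ψ) l (𝓝 (B₀ ψ)))
    {u : ι → H} {u₀ : H} (hu : Tendsto u l (𝓝 u₀)) :
    Tendsto (fun i => B i (u i)) l (𝓝 (B₀ u₀)) := by
  have h1 : Tendsto (fun i => B i (u i - u₀)) l (𝓝 0) := by
    have h2 : Tendsto (fun i => C * ‖u i - u₀‖) l (𝓝 0) := by
      simpa using (tendsto_iff_norm_sub_tendsto_zero.1 hu).const_mul C
    exact squeeze_zero_norm (fun i => hC i _) h2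
  have h3 := h1.add (hB u₀)
  simpa using h3

theorem continuousOn_apply_of_strong {B : ℝ → H →L[ℂ] H} {C : ℝ}
    (hC : ∀ t ψ, ‖B t ψ‖ ≤ C * ‖ψ‖) (hB : ∀ ψ, Continuous fun t => B t ψ) {u : ℝ → H} {J : Set ℝ}
    (hu : ContinuousOn u J) : ContinuousOn (fun t => B t (u t)) J := fun t ht =>
  tendsto_apply_of_strong hC (fun ψ => (hB ψ).continuousWithinAt (s := J) (x := t)) (hu t ht)

theorem continuous_apply_of_strong {B : ℝ → H →L[ℂ] H} {C : ℝ}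
    (hC : ∀ t ψ, ‖B t ψ‖ ≤ C * ‖ψ‖) (hB : ∀ ψ, Continuous fun t => B t ψ) {u : ℝ → H}
    (hu : Continuous u) : Continuous fun t => B t (u t) := by
  rw [← continuousOn_univ] at hu ⊢
  exact continuousOn_apply_of_strong hC hB hu

/-- Product rule for a strongly continuous family of operators applied to a differentiable
vector. -/
theorem hasDerivAt_apply_of_strong {B : ℝ → H →L[ℂ] H} {C : ℝ}
    (hC : ∀ t ψ, ‖B t ψ‖ ≤ C * ‖ψ‖) {u : ℝ → H}
    {u' d : H} {t : ℝ} (hB : ∀ ψ, ContinuousAt (fun t => B t ψ) t) (hu : HasDerivAt u u' t) (hd : HasDerivAt (fun s => B s (u t)) d t) :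
    HasDerivAt (fun s => B s (u s)) (d + B t u') t := by
  rw [hasDerivAt_iff_tendsto_slope] at hu hd ⊢
  have h1 := tendsto_apply_of_strong hC
    (fun ψ => (hB ψ).tendsto.mono_left (nhdsWithin_le_nhds (s := {t}ᶜ))) hu
  refine (hd.add h1).congr fun s => ?_
  simp only [slope, vsub_eq_sub]
  rw [← Complex.coe_smul, ← Complex.coe_smul, ← Complex.coe_smul, map_smul, map_sub, ← smul_add]
  congr 1
  abel

end StrongContinuity

/-- Integration against the weight `e^{L|t|}` gains a factor `1/L`; this is the contraction factor
in the fixed point argument. -/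
theorem abs_integral_exp_abs_le {L : ℝ} (hL : 0 < L) (s : ℝ) :
    |∫ τ in (0 : ℝ)..s, Real.exp (L * |τ|)| ≤ Real.exp (L * |s|) / L := by
  have key : ∀ s : ℝ, 0 ≤ s → |∫ τ in (0 : ℝ)..s, Real.exp (L * |τ|)| ≤ Real.exp (L * |s|) / L := by
    intro s hs
    have h1 : ∫ τ in (0 : ℝ)..s, Real.exp (L * |τ|) = (Real.exp (L * s) - 1) / L := by
      have h2 : ∫ τ in (0 : ℝ)..s, Real.exp (L * |τ|) = ∫ τ in (0 : ℝ)..s, Real.exp (L * τ) := by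
        refine intervalIntegral.integral_congr fun τ hτ => ?_
        rw [Set.uIcc_of_le hs] at hτ
        simp only [abs_of_nonneg hτ.1]
      rw [h2, intervalIntegral.integral_comp_mul_left (fun x => Real.exp x) hL.ne', integral_exp,
        mul_zero, Real.exp_zero, smul_eq_mul]
      ring
    rw [h1, abs_of_nonneg hs, abs_of_nonneg]
    · gcongr
      linarith
    · have : 1 ≤ Real.exp (L * s) := Real.one_le_exp (by positivity)
      apply div_nonneg _ hL.le
      linarith
  rcases le_total 0 s with hs | hs
  · exact key s hs
  · have h := key (-s) (by linarith)
    rw [abs_neg s] at h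
    have h1 : ∫ τ in (0 : ℝ)..s, Real.exp (L * |τ|) =
        -∫ τ in (0 : ℝ)..(-s), Real.exp (L * |τ|) := by
      have := intervalIntegral.integral_comp_neg (a := 0) (b := s) (fun τ => Real.exp (L * |τ|))
      simp only [abs_neg, neg_zero] at this
      rw [this, intervalIntegral.integral_symm]
    rw [h1, abs_neg]
    exact h

section LinearEvolution

variable {H : Type*} [NormedAddCommGroup H] [InnerProductSpace ℂ H]

/-- A Picard fixed point on all of `ℝ` at once: the unknown is the bounded function `p(t) =
e^{-L|t|} v(t)`, for which the integral operator contracts with ratio `|C|/L < 1`, where `L = |C| +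
1`. -/
theorem exists_solution_zero [CompleteSpace H] {B : ℝ → H →L[ℂ] H} {C : ℝ} (hC : ∀ t ψ, ‖B t ψ‖ ≤ C * ‖ψ‖)
    (hB : ∀ ψ, Continuous fun t => B t ψ) (ψ : H) :
    ∃ v : ℝ → H, v 0 = ψ ∧ ∀ t, HasDerivAt v (-Complex.I • B t (v t)) t := by
  set L := |C| + 1 with hLdef
  have hL : 0 < L := by positivity
  have hC' : ∀ t ψ, ‖B t ψ‖ ≤ |C| * ‖ψ‖ := fun t ψ => (hC t ψ).trans (by gcongr; exact le_abs_self C)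
  set w : ℝ → ℝ := fun t => Real.exp (L * |t|) with hw
  have hwpos : ∀ t, 0 < w t := fun t => Real.exp_pos _
  have hwc : Continuous w := by fun_prop
  have hint : ∀ p : ℝ → H, Continuous p → Continuous fun τ => -Complex.I • B τ (w τ • p τ) :=
    fun p hp => (continuous_apply_of_strong hC hB (hwc.smul hp)).const_smul _
  have hbound : ∀ (p : ℝ → H) (M : ℝ), (∀ τ, ‖p τ‖ ≤ M) → ∀ t,
      ‖∫ τ in (0 : ℝ)..t, -Complex.I • B τ (w τ • p τ)‖ ≤ |C| * M * (w t / L) := by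
    intro p M hM t
    have hM0 : 0 ≤ M := (norm_nonneg _).trans (hM 0)
    have h1 : ‖∫ τ in (0 : ℝ)..t, -Complex.I • B τ (w τ • p τ)‖ ≤
        |∫ τ in (0 : ℝ)..t, |C| * M * w τ| := by
      refine intervalIntegral.norm_integral_le_abs_of_norm_le
        (Eventually.of_forall fun τ => ?_) ((continuous_const.mul hwc).intervalIntegrable _ _)
      rw [norm_smul, norm_neg, Complex.norm_I, one_mul]
      refine (hC' τ _).trans ?_
      rw [norm_smul, Real.norm_eq_abs, abs_of_pos (hwpos τ), mul_assoc, mul_comm M]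
      gcongr
      exact hM τ
    refine h1.trans ?_
    rw [intervalIntegral.integral_const_mul, abs_mul, abs_of_nonneg (by positivity)]
    gcongr
    exact abs_integral_exp_abs_le hL t
  have hcont : ∀ p : ℝ → H, Continuous p → Continuous fun t =>
      (w t)⁻¹ • (ψ + ∫ τ in (0 : ℝ)..t, -Complex.I • B τ (w τ • p τ)) := fun p hp =>
    (hwc.inv₀ fun t => (hwpos t).ne').smul (continuous_const.add
      (intervalIntegral.continuous_primitive (fun a b => (hint p hp).intervalIntegrable a b) 0))
  set Φ : (ℝ →ᵇ H) → (ℝ →ᵇ H) := fun p =>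
    BoundedContinuousFunction.ofNormedAddCommGroup
      (fun t => (w t)⁻¹ • (ψ + ∫ τ in (0 : ℝ)..t, -Complex.I • B τ (w τ • p τ)))
      (hcont p p.continuous) (‖ψ‖ + |C| * ‖p‖ / L) (fun t => by
        have h1 := hbound p ‖p‖ p.norm_coe_le_norm t
        have hw1 : 1 ≤ w t := Real.one_le_exp (by positivity)
        rw [norm_smul, norm_inv, Real.norm_eq_abs, abs_of_pos (hwpos t),
          inv_mul_le_iff₀ (hwpos t)]
        refine (norm_add_le _ _).trans ?_
        rw [mul_add]
        gcongr
        · exact le_mul_of_one_le_left (norm_nonneg _) hw1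
        · exact h1.trans (le_of_eq (by ring))) with hΦ
  have hK : ((|C| / L).toNNReal : ℝ) = |C| / L := Real.coe_toNNReal _ (by positivity)
  have hcontr : ContractingWith (|C| / L).toNNReal Φ := by
    refine ⟨?_, LipschitzWith.of_dist_le_mul fun p q => ?_⟩
    · rw [← NNReal.coe_lt_coe, hK, NNReal.coe_one, div_lt_one hL]
      linarith
    · rw [hK, BoundedContinuousFunction.dist_le (by positivity)]
      intro t
      simp only [hΦ, BoundedContinuousFunction.coe_ofNormedAddCommGroup]
      rw [dist_eq_norm, ← smul_sub, add_sub_add_left_eq_sub, ← intervalIntegral.integral_sub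
        ((hint p p.continuous).intervalIntegrable _ _)
        ((hint q q.continuous).intervalIntegrable _ _)]
      simp_rw [← smul_sub, ← map_sub, ← smul_sub]
      have h1 := hbound (fun τ => p τ - q τ) (dist p q)
        (fun τ => by rw [← dist_eq_norm]; exact BoundedContinuousFunction.dist_coe_le_dist τ) t
      rw [norm_smul, norm_inv, Real.norm_eq_abs, abs_of_pos (hwpos t), inv_mul_le_iff₀ (hwpos t)]
      exact h1.trans (le_of_eq (by ring))
  obtain ⟨p, hp⟩ : ∃ p, Φ p = p := ⟨_, hcontr.fixedPoint_isFixedPt⟩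
  have hv : ∀ t, w t • p t = ψ + ∫ τ in (0 : ℝ)..t, -Complex.I • B τ (w τ • p τ) := fun t => by
    conv_lhs => rw [← hp]
    simp only [hΦ, BoundedContinuousFunction.coe_ofNormedAddCommGroup]
    rw [smul_smul, mul_inv_cancel₀ (hwpos t).ne', one_smul]
  refine ⟨fun t => w t • p t, (hv 0).trans (by simp), fun t => ?_⟩
  have h1 := ((hint p p.continuous).integral_hasStrictDerivAt 0 t).hasDerivAt.const_add ψ
  exact h1.congr_of_eventuallyEq (Eventually.of_forall hv)

theorem exists_solution [CompleteSpace H] {B : ℝ → H →L[ℂ] H} {C : ℝ} (hC : ∀ t ψ, ‖B t ψ‖ ≤ C * ‖ψ‖)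
    (hB : ∀ ψ, Continuous fun t => B t ψ) (s : ℝ) (ψ : H) :
    ∃ v : ℝ → H, v s = ψ ∧ ∀ t, HasDerivAt v (-Complex.I • B t (v t)) t := by
  obtain ⟨v, hv0, hv⟩ := exists_solution_zero (B := fun t => B (t + s)) (fun t => hC _)
    (fun ψ => (hB ψ).comp (continuous_add_const s)) ψ
  refine ⟨fun t => v (t - s), by simpa using hv0, fun t => ?_⟩
  have := (hv (t - s)).comp_sub_const t s
  simpa using this

/-- Symmetry of `B t` cancels the two terms in the derivative of the inner product. -/
theorem inner_solution_eq {B : ℝ → H →L[ℂ] H}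
    (hs : ∀ t ψ χ, inner ℂ (B t ψ) χ = inner ℂ ψ (B t χ)) {v w : ℝ → H}
    (hv : ∀ t, HasDerivAt v (-Complex.I • B t (v t)) t)
    (hw : ∀ t, HasDerivAt w (-Complex.I • B t (w t)) t) (s t : ℝ) :
    inner ℂ (v t) (w t) = inner ℂ (v s) (w s) := by
  have hd : ∀ t, HasDerivAt (fun t => inner ℂ (v t) (w t)) 0 t := fun t => by
    refine ((hv t).inner ℂ (hw t)).congr_deriv ?_
    rw [inner_smul_left, inner_smul_right, hs]
    simp
  exact is_const_of_deriv_eq_zero (fun t => (hd t).differentiableAt) (fun t => (hd t).deriv) t s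

/-- The difference of two solutions is a solution, and its norm is conserved. Linearity and
surjectivity of the evolution rest on this. -/
theorem solution_unique {B : ℝ → H →L[ℂ] H}
    (hs : ∀ t ψ χ, inner ℂ (B t ψ) χ = inner ℂ ψ (B t χ)) {v w : ℝ → H}
    (hv : ∀ t, HasDerivAt v (-Complex.I • B t (v t)) t)
    (hw : ∀ t, HasDerivAt w (-Complex.I • B t (w t)) t) {s : ℝ} (h : v s = w s) (t : ℝ) :
    v t = w t := by
  have hd : ∀ t, HasDerivAt (fun t => v t - w t) (-Complex.I • B t (v t - w t)) t := fun t => by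
    rw [map_sub, smul_sub]
    exact (hv t).sub (hw t)
  have := inner_solution_eq hs hd hd s t
  rw [h, sub_self, inner_zero_left, inner_self_eq_zero, sub_eq_zero] at this
  exact this

/-- The unitary evolution generated by a bounded, strongly continuous family of symmetric
operators. -/
theorem exists_unitary_evolution [CompleteSpace H] {B : ℝ → H →L[ℂ] H} {C : ℝ} (hC : ∀ t ψ, ‖B t ψ‖ ≤ C * ‖ψ‖)
    (hB : ∀ ψ, Continuous fun t => B t ψ)
    (hs : ∀ t ψ χ, inner ℂ (B t ψ) χ = inner ℂ ψ (B t χ)) :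
    ∃ W : ℝ → H ≃ₗᵢ[ℂ] H,
      ∀ ψ t, HasDerivAt (fun t => W t ψ) (-Complex.I • B t (W t ψ)) t := by
  choose v hv0 hv using exists_solution_zero hC hB
  have hadd : ∀ ψ χ t, v (ψ + χ) t = v ψ t + v χ t := fun ψ χ t => by
    refine solution_unique hs (hv _) (w := fun t => v ψ t + v χ t) (fun t => ?_) (s := 0)
      (by rw [hv0, hv0, hv0]) t
    rw [map_add, smul_add]
    exact (hv ψ t).add (hv χ t)
  have hsmul : ∀ (c : ℂ) ψ t, v (c • ψ) t = c • v ψ t := fun c ψ t => by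
    refine solution_unique hs (hv _) (w := fun t => c • v ψ t) (fun t => ?_) (s := 0)
      (by rw [hv0, hv0]) t
    rw [map_smul, smul_comm]
    exact (hv ψ t).const_smul c
  have hnorm : ∀ ψ t, ‖v ψ t‖ = ‖ψ‖ := fun ψ t => by
    have h1 := inner_solution_eq hs (hv ψ) (hv ψ) 0 t
    rw [hv0, inner_self_eq_norm_sq_to_K, inner_self_eq_norm_sq_to_K] at h1
    have h2 : ‖v ψ t‖ ^ 2 = ‖ψ‖ ^ 2 := by exact_mod_cast h1
    exact (sq_eq_sq₀ (norm_nonneg _) (norm_nonneg _)).1 h2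
  refine ⟨fun t => LinearIsometryEquiv.ofSurjective
    ({ toFun := fun ψ => v ψ t, map_add' := fun ψ χ => hadd ψ χ t,
       map_smul' := fun c ψ => hsmul c ψ t, norm_map' := fun ψ => hnorm ψ t } : H →ₗᵢ[ℂ] H)
    (fun χ => ?_), fun ψ t => hv ψ t⟩
  -- Surjectivity: the solution through `χ` at time `t` provides its own initial value `y 0`.
  obtain ⟨y, hy, hyd⟩ := exists_solution hC hB t χ
  refine ⟨y 0, ?_⟩
  have := solution_unique hs (hv (y 0)) hyd (hv0 (y 0)) t
  exact this.trans hy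

end LinearEvolution

end

/-! ### Reparametrized time, interaction picture and existence of propagators -/

noncomputable section

open scoped BoundedContinuousFunction ComplexConjugate ContDiff FourierTransform

variable {n : ℕ}

theorem hasDerivAt_mul_abs_rpow_neg (a : ℝ) {t : ℝ} (ht : t ≠ 0) :
    HasDerivAt (fun t : ℝ => t * |t| ^ (-a)) ((1 - a) * |t| ^ (-a)) t := by
  have h1 : HasDerivAt (fun t : ℝ => |t| ^ (-a)) (SignType.sign t * (-a) * |t| ^ (-a - 1)) t :=
    (hasDerivAt_abs ht).rpow_const (Or.inl (abs_ne_zero.2 ht))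
  refine ((hasDerivAt_id t).mul h1).congr_deriv ?_
  have h2 : |t| ^ (-a) = |t| * |t| ^ (-a - 1) := by
    rw [Real.rpow_sub_one (abs_ne_zero.2 ht), mul_div_cancel₀ _ (abs_ne_zero.2 ht)]
  have h3 : t * (SignType.sign t : ℝ) = |t| := by rw [mul_comm]; exact sign_mul_self t
  simp only [id, one_mul]
  rw [h2]
  linear_combination -a * |t| ^ (-a - 1) * h3

theorem abs_mul_abs_rpow_neg (a : ℝ) {t : ℝ} (ht : t ≠ 0) : |t * |t| ^ (-a)| = |t| ^ (1 - a) := by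
  rw [abs_mul, abs_of_nonneg (Real.rpow_nonneg (abs_nonneg t) _), sub_eq_add_neg,
    Real.rpow_add (abs_pos.2 ht), Real.rpow_one]

/-- At `t = 0` continuity comes from the modulus being `|t|^{1-a}` off the origin. It lets both half
lines share one base time `0`. -/
theorem continuous_mul_abs_rpow_neg {a : ℝ} (ha : a < 1) :
    Continuous fun t : ℝ => t * |t| ^ (-a) := by
  rw [continuous_iff_continuousAt]
  intro t
  rcases eq_or_ne t 0 with rfl | ht
  · have h1 : Tendsto (fun t : ℝ => |t| ^ (1 - a)) (𝓝 0) (𝓝 0) := by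
      have : Continuous fun t : ℝ => |t| ^ (1 - a) :=
        continuous_abs.rpow_const fun t => Or.inr (by linarith)
      have h2 := this.tendsto 0
      rwa [abs_zero, Real.zero_rpow (by linarith)] at h2
    have h3 : Tendsto (fun t : ℝ => t * |t| ^ (-a)) (𝓝 0) (𝓝 0) := by
      refine squeeze_zero_norm (fun t => ?_) h1
      rcases eq_or_ne t 0 with rfl | ht
      · simp only [zero_mul, norm_zero]; positivity
      · rw [Real.norm_eq_abs, abs_mul_abs_rpow_neg a ht]
    simpa [ContinuousAt] using h3
  · exact (hasDerivAt_mul_abs_rpow_neg a ht).continuousAt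

/-- The reparametrized time `t |t|^{-2λ} / (m (1 - 2λ))`. -/
def tau (m lam t : ℝ) : ℝ := t * |t| ^ (-(2 * lam)) / (m * (1 - 2 * lam))

theorem continuous_tau (m : ℝ) {lam : ℝ} (hlam : lam < 1 / 2) : Continuous (tau m lam) :=
  (continuous_mul_abs_rpow_neg (by linarith)).div_const _

theorem hasDerivAt_tau {m lam t : ℝ} (hm : 0 < m) (hlam : lam < 1 / 2) (ht : t ≠ 0) :
    HasDerivAt (tau m lam) (1 / (m * |t| ^ (2 * lam))) t := by
  have h1 : 1 - 2 * lam ≠ 0 := by linarith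
  refine ((hasDerivAt_mul_abs_rpow_neg (2 * lam) ht).div_const _).congr_deriv ?_
  rw [Real.rpow_neg (abs_nonneg t)]
  have := Real.rpow_pos_of_pos (abs_pos.2 ht) (2 * lam)
  field_simp

theorem freeEvol_symm (θ : ℝ) (u : L2Space n) : (freeEvol θ).symm u = freeEvol (-θ) u := by
  rw [freeEvol_symm_apply, freeEvol_apply, phase_symm_eq, neg_smul]

theorem continuous_freeEvol {θ : ℝ → ℝ} (hθ : Continuous θ) (u : L2Space n) :
    Continuous fun t => freeEvol (θ t) u :=
  (fourierL n).symm.continuous.comp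
    (continuous_phase (fun x => by
      simp only [ContinuousMap.coe_smul, Pi.smul_apply, smul_eq_mul]; fun_prop) _)

theorem hasDerivAt_phase_normSq {p v : L2Space n}
    (hv : v =ᵐ[volume] fun x => ((‖x‖ ^ 2 : ℝ) : ℂ) * p x) (t : ℝ) :
    HasDerivAt (fun θ : ℝ => phase (θ • normSq n) p) (-Complex.I • phase (t • normSq n) v) t := by
  refine hasDerivAt_phase (a' := fun _ x => ‖x‖ ^ 2) (b := fun x => ‖x‖ ^ 2) (fun s x => ?_)
    (fun s x => by rw [abs_of_nonneg (by positivity)]) ?_ ?_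
  · simpa using (hasDerivAt_id s).mul_const (‖x‖ ^ 2)
  · refine (Lp.memLp v).norm.ae_eq ?_
    filter_upwards [hv] with x h1
    rw [h1, norm_mul, Complex.norm_real, Real.norm_eq_abs, abs_of_nonneg (by positivity)]
  · filter_upwards [Lp.coeFn_smul (-Complex.I) (phase (t • normSq n) v),
      coeFn_phase (t • normSq n) v, hv] with x h1 h2 h3
    rw [h1, Pi.smul_apply, h2, h3, smul_eq_mul]
    ring

theorem hasDerivAt_freeEvol {p v : L2Space n}
    (hv : fourierL n v =ᵐ[volume] fun x => ((‖x‖ ^ 2 : ℝ) : ℂ) * fourierL n p x) (t : ℝ) :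
    HasDerivAt (fun θ : ℝ => freeEvol θ p) (-Complex.I • freeEvol t v) t := by
  have h1 := hasDerivAt_phase_normSq hv t
  have h2 := ((fourierL n).symm.toContinuousLinearEquiv.toContinuousLinearMap.restrictScalars
    ℝ).hasFDerivAt.comp_hasDerivAt t h1
  refine h2.congr_deriv ?_
  simp [freeEvol_apply]

/-- The vector `-(2π)⁻² Δφ`, whose Fourier transform is `‖ξ‖²` times that of `φ`. -/
def negLaplacianL (φ : 𝓢(RSpace n, ℂ)) : L2Space n :=
  ((-((2 * Real.pi) ^ 2)⁻¹ : ℝ) : ℂ) • (Laplacian.laplacian φ).toLp 2 volume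

theorem coeFn_fourierL_negLaplacianL (φ : 𝓢(RSpace n, ℂ)) :
    fourierL n (negLaplacianL φ) =ᵐ[volume]
      fun x => ((‖x‖ ^ 2 : ℝ) : ℂ) * fourierL n (φ.toLp 2) x := by
  have h1 : 𝓕 (Laplacian.laplacian φ) =
      -(2 * Real.pi) ^ 2 • SchwartzMap.smulLeftCLM ℂ (fun x : RSpace n => ‖x‖ ^ 2) (𝓕 φ) := by
    rw [laplacian_eq_fourierMultiplierCLM, fourierMultiplierCLM_apply, ← FourierTransform.fourierInv_smul]
    exact FourierTransform.fourier_fourierInv_eq _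
  have h2 : fourierL n (negLaplacianL φ) =
      ((-((2 * Real.pi) ^ 2)⁻¹ : ℝ) : ℂ) • (𝓕 (Laplacian.laplacian φ)).toLp 2 := by
    rw [negLaplacianL, map_smul, fourierL_eq, toLp_fourier_eq]
  have h3 : fourierL n (φ.toLp 2) = (𝓕 φ).toLp 2 := by rw [fourierL_eq, toLp_fourier_eq]
  rw [h2, h3]
  filter_upwards [Lp.coeFn_smul ((-((2 * Real.pi) ^ 2)⁻¹ : ℝ) : ℂ)
    ((𝓕 (Laplacian.laplacian φ)).toLp 2), (𝓕 (Laplacian.laplacian φ)).coeFn_toLp 2 volume,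
    (𝓕 φ).coeFn_toLp 2 volume] with x k1 k2 k3
  rw [k1, Pi.smul_apply, k2, k3, h1]
  rw [_root_.smul_apply, smulLeftCLM_apply_apply (by fun_prop)]
  simp only [smul_eq_mul, Complex.real_smul]
  push_cast
  have : (Real.pi : ℂ) ≠ 0 := by exact_mod_cast Real.pi_ne_zero
  field_simp

/-- The multiplication function `x ↦ V(t, c x)` of a bounded continuous potential. -/
def potential {V : ℝ → RSpace n → ℝ} (hV : Continuous fun q : ℝ × RSpace n => V q.1 q.2) {C : ℝ}
    (hC : ∀ t x, |V t x| ≤ C) (t c : ℝ) : RSpace n →ᵇ ℂ :=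
  BoundedContinuousFunction.ofNormedAddCommGroup (fun x => ((V t (c • x) : ℝ) : ℂ))
    (Complex.continuous_ofReal.comp
      (hV.comp (by fun_prop : Continuous fun x : RSpace n => (t, c • x)))) C
    (fun x => by rw [Complex.norm_real]; exact hC t _)

section Interaction

variable {V : ℝ → RSpace n → ℝ} (hV : Continuous fun q : ℝ × RSpace n => V q.1 q.2) {C : ℝ}
  (hC : ∀ t x, |V t x| ≤ C)

@[simp] theorem potential_apply (t c : ℝ) (x : RSpace n) :
    potential hV hC t c x = ((V t (c • x) : ℝ) : ℂ) := rfl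

theorem norm_potential_le (t c : ℝ) (x : RSpace n) : ‖potential hV hC t c x‖ ≤ C := by
  rw [potential_apply, Complex.norm_real]; exact hC t _

theorem potential_comp_smul (t c c' : ℝ) :
    (potential hV hC t c).compContinuous ⟨fun x => c' • x, by fun_prop⟩ =
      potential hV hC t (c * c') := by
  ext x
  simp [smul_smul]

theorem star_potential (t c : ℝ) : star (potential hV hC t c) = potential hV hC t c := by
  ext x
  simp

theorem continuous_mulL_potential {c : ℝ → ℝ} (hc : Continuous c) (u : L2Space n) :
    Continuous fun t => mulL (potential hV hC t (c t)) u := by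
  refine continuous_mulL (C := C) (fun t x => norm_potential_le hV hC t _ x) (fun x => ?_) u
  simp only [potential_apply]
  exact Complex.continuous_ofReal.comp
    (hV.comp (continuous_id.prodMk (hc.smul (continuous_const (y := x)))))

/-- The free propagator from time `0` to time `t`. -/
def freeProp (n : ℕ) (m lam t : ℝ) : L2Space n ≃ₗᵢ[ℂ] L2Space n :=
  freeEvol (2 * Real.pi ^ 2 * tau m lam t)

/-- The potential in the interaction picture. -/
def interaction (m lam t : ℝ) : L2Space n →L[ℂ] L2Space n :=
  ((freeProp n m lam t).symm.toContinuousLinearEquiv.toContinuousLinearMap ∘L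
    mulL (potential hV hC t (|t| ^ lam))) ∘L
      (freeProp n m lam t).toContinuousLinearEquiv.toContinuousLinearMap

theorem interaction_apply (m lam t : ℝ) (u : L2Space n) : interaction hV hC m lam t u =
    (freeProp n m lam t).symm (mulL (potential hV hC t (|t| ^ lam)) (freeProp n m lam t u)) := rfl

theorem norm_interaction_le (m lam t : ℝ) (u : L2Space n) :
    ‖interaction hV hC m lam t u‖ ≤ C * ‖u‖ := by
  rw [interaction_apply, LinearIsometryEquiv.norm_map]
  simpa using norm_mulL_le (norm_potential_le hV hC t _) (freeProp n m lam t u)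

theorem interaction_symmetric (m lam t : ℝ) (u v : L2Space n) :
    inner ℂ (interaction hV hC m lam t u) v = inner ℂ u (interaction hV hC m lam t v) := by
  rw [interaction_apply, interaction_apply, ← LinearIsometryEquiv.inner_map_map (freeProp n m lam t),
    LinearIsometryEquiv.apply_symm_apply, inner_mulL_left, star_potential,
    ← LinearIsometryEquiv.inner_map_map (freeProp n m lam t) u,
    LinearIsometryEquiv.apply_symm_apply]

theorem continuous_freeProp (m : ℝ) {lam : ℝ} (hlam : lam < 1 / 2) (u : L2Space n) :
    Continuous fun t => freeProp n m lam t u :=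
  continuous_freeEvol (continuous_const.mul (continuous_tau m hlam)) u

theorem continuous_freeProp_symm (m : ℝ) {lam : ℝ} (hlam : lam < 1 / 2) (u : L2Space n) :
    Continuous fun t => (freeProp n m lam t).symm u := by
  simp only [freeProp, freeEvol_symm]
  exact continuous_freeEvol (continuous_const.mul (continuous_tau m hlam)).neg u

theorem continuous_interaction (m : ℝ) {lam : ℝ} (h0 : 0 ≤ lam) (hlam : lam < 1 / 2)
    (u : L2Space n) : Continuous fun t => interaction hV hC m lam t u := by
  have h1 := continuous_apply_of_strong (B := fun t => mulL (potential hV hC t (|t| ^ lam)))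
    (fun t ψ => norm_mulL_le (norm_potential_le hV hC t _) ψ)
    (continuous_mulL_potential hV hC (continuous_abs.rpow_const fun t => Or.inr h0))
    (continuous_freeProp m hlam u)
  exact continuous_apply_of_strong (C := 1)
    (B := fun t => (freeProp n m lam t).symm.toContinuousLinearEquiv.toContinuousLinearMap)
    (fun t ψ => by simp) (continuous_freeProp_symm m hlam) h1

/-- The reduced Hamiltonian applied to a Schwartz function, as an element of `L²`. -/
def hamiltonianL (m lam t : ℝ) (φ : 𝓢(RSpace n, ℂ)) : L2Space n :=
  ((2 * Real.pi ^ 2 * (1 / (m * |t| ^ (2 * lam))) : ℝ) : ℂ) • negLaplacianL φ +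
    mulL (potential hV hC t (|t| ^ lam)) (φ.toLp 2)

theorem coeFn_hamiltonianL (m lam t : ℝ) (φ : 𝓢(RSpace n, ℂ)) :
    hamiltonianL hV hC m lam t φ =ᵐ[volume] reducedHamiltonian m lam V t φ := by
  set c : ℂ := ((2 * Real.pi ^ 2 * (1 / (m * |t| ^ (2 * lam))) : ℝ) : ℂ) with hc
  set d : ℂ := ((-((2 * Real.pi) ^ 2)⁻¹ : ℝ) : ℂ) with hd
  filter_upwards [Lp.coeFn_add (c • negLaplacianL φ)
      (mulL (potential hV hC t (|t| ^ lam)) (φ.toLp 2)),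
    Lp.coeFn_smul c (negLaplacianL φ), Lp.coeFn_smul d ((Laplacian.laplacian φ).toLp 2),
    (Laplacian.laplacian φ).coeFn_toLp 2 volume, φ.coeFn_toLp 2 volume,
    coeFn_mulL (potential hV hC t (|t| ^ lam)) (φ.toLp 2)] with x h1 h2 h3 h4 h5 h6
  rw [hamiltonianL, h1, Pi.add_apply, h2, Pi.smul_apply, negLaplacianL, h3, Pi.smul_apply, h4, h6,
    h5, reducedHamiltonian, freeReducedHamiltonian, SchwartzMap.laplacian_apply, potential_apply,
    smul_eq_mul, smul_eq_mul, ← mul_assoc, hc, hd]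
  congr 2
  rw [← Complex.ofReal_mul, ← Complex.ofReal_neg]
  congr 1
  have := Real.pi_ne_zero
  rw [mul_assoc 2 m]
  -- `X = 0` is not excluded here; division by zero then makes both sides vanish. Otherwise
  -- `2π²·(2π)⁻² = 1/2` gives the kinetic factor.
  generalize m * |t| ^ (2 * lam) = X
  rcases eq_or_ne X 0 with rfl | hX
  · simp
  · field_simp

theorem l2Pairing_reducedHamiltonian (m lam t : ℝ) (φ : 𝓢(RSpace n, ℂ)) (u : L2Space n) :
    l2Pairing (reducedHamiltonian m lam V t φ) u = inner ℂ (hamiltonianL hV hC m lam t φ) u :=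
  l2Pairing_eq_inner (coeFn_hamiltonianL hV hC m lam t φ) u

theorem l2Pairing_schwartz (φ : 𝓢(RSpace n, ℂ)) (u : L2Space n) :
    l2Pairing φ u = inner ℂ (φ.toLp 2 : L2Space n) u :=
  l2Pairing_eq_inner (φ.coeFn_toLp 2 volume) u

theorem hasDerivAt_freeProp {m lam t : ℝ} (hm : 0 < m) (hlam : lam < 1 / 2) (ht : t ≠ 0)
    (φ : 𝓢(RSpace n, ℂ)) :
    HasDerivAt (fun t => freeProp n m lam t (φ.toLp 2))
      (((2 * Real.pi ^ 2 * (1 / (m * |t| ^ (2 * lam))) : ℝ) : ℂ) •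
        -Complex.I • freeProp n m lam t (negLaplacianL φ)) t := by
  have h1 := (hasDerivAt_freeEvol (coeFn_fourierL_negLaplacianL φ)
    (2 * Real.pi ^ 2 * tau m lam t)).scomp t
      ((hasDerivAt_tau hm hlam ht).const_mul (2 * Real.pi ^ 2))
  rw [Complex.coe_smul]
  exact h1

theorem hasDerivAt_freeProp_symm {m lam t : ℝ} (hm : 0 < m) (hlam : lam < 1 / 2) (ht : t ≠ 0)
    (φ : 𝓢(RSpace n, ℂ)) :
    HasDerivAt (fun t => (freeProp n m lam t).symm (φ.toLp 2))
      (((2 * Real.pi ^ 2 * (1 / (m * |t| ^ (2 * lam))) : ℝ) : ℂ) •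
        Complex.I • (freeProp n m lam t).symm (negLaplacianL φ)) t := by
  have h1 := (hasDerivAt_freeEvol (coeFn_fourierL_negLaplacianL φ)
    (-(2 * Real.pi ^ 2 * tau m lam t))).scomp t
      ((hasDerivAt_tau hm hlam ht).const_mul (2 * Real.pi ^ 2)).neg
  simp only [freeProp, freeEvol_symm]
  rw [Complex.coe_smul]
  refine h1.congr_deriv ?_
  rw [neg_smul, neg_smul, smul_neg, neg_neg]
  rfl

/-- For isometries `‖X⁻¹ψ - X₀⁻¹ψ‖ = ‖X₀φ - Xφ‖` with `φ = X₀⁻¹ψ`. -/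
theorem tendsto_symm_of_strong {H ι : Type*} [NormedAddCommGroup H] [NormedSpace ℂ H]
    {l : Filter ι} {X : ι → H ≃ₗᵢ[ℂ] H} {X₀ : H ≃ₗᵢ[ℂ] H}
    (h : ∀ ψ, Tendsto (fun i => X i ψ) l (𝓝 (X₀ ψ))) (ψ : H) :
    Tendsto (fun i => (X i).symm ψ) l (𝓝 (X₀.symm ψ)) := by
  rw [tendsto_iff_norm_sub_tendsto_zero]
  have h1 := tendsto_iff_norm_sub_tendsto_zero.1 (h (X₀.symm ψ))
  refine h1.congr fun i => ?_
  rw [LinearIsometryEquiv.apply_symm_apply, norm_sub_rev, ← LinearIsometryEquiv.norm_map (X i)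
    ((X i).symm ψ - X₀.symm ψ), map_sub, LinearIsometryEquiv.apply_symm_apply]

end Interaction

/-- Existence of the propagator of the reduced Hamiltonian with a bounded continuous potential. -/
theorem exists_isPropagator {V : ℝ → RSpace n → ℝ}
    (hV : Continuous fun q : ℝ × RSpace n => V q.1 q.2) {C : ℝ} (hC : ∀ t x, |V t x| ≤ C)
    {m lam : ℝ} (hm : 0 < m) (h0 : 0 ≤ lam) (hlam : lam < 1 / 2)
    {J : Set ℝ} (hJ : ∀ t ∈ J, t ≠ 0) :
    ∃ U : ℝ → ℝ → (L2Space n ≃ₗᵢ[ℂ] L2Space n), IsPropagator (reducedHamiltonian m lam V) J U := by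
  obtain ⟨W, hW⟩ := exists_unitary_evolution (norm_interaction_le hV hC m lam)
    (continuous_interaction hV hC m h0 hlam) (interaction_symmetric hV hC m lam)
  -- `X t` is the evolution from time `0` to `t`; the propagator is `X t (X s)⁻¹`. Strong continuity
  -- holds through `t = 0`, and only the equation itself needs `t ≠ 0`.
  set X : ℝ → (L2Space n ≃ₗᵢ[ℂ] L2Space n) := fun t => (W t).trans (freeProp n m lam t) with hX
  have hXc : ∀ ψ, Continuous fun t => X t ψ := fun ψ =>
    continuous_apply_of_strong (C := 1)
      (B := fun t => (freeProp n m lam t).toContinuousLinearEquiv.toContinuousLinearMap)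
      (fun t ψ => by simp) (continuous_freeProp m hlam)
      (continuous_iff_continuousAt.2 fun t => (hW ψ t).continuousAt)
  refine ⟨fun t s => (X s).symm.trans (X t), fun s _ ψ => by simp, fun t _ θ _ s _ ψ => by simp,
    fun ψ => Continuous.continuousOn ?_, fun s _ ψ φ t ht => ?_⟩
  · rw [continuous_iff_continuousAt]
    rintro ⟨t, s⟩
    exact tendsto_apply_of_strong (C := 1)
      (B := fun q : ℝ × ℝ => (X q.1).toContinuousLinearEquiv.toContinuousLinearMap)
      (B₀ := (X t).toContinuousLinearEquiv.toContinuousLinearMap)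
      (fun t ψ => by simp) (fun ψ => ((hXc ψ).tendsto t).comp (continuous_fst.tendsto (t, s)))
      ((tendsto_symm_of_strong (fun ψ => (hXc ψ).tendsto s) ψ).comp
        (continuous_snd.tendsto (t, s)))
  · set y := (X s).symm ψ with hy
    have h2 : ∀ τ, ∀ u v : L2Space n, inner ℂ ((freeProp n m lam τ).symm u) v =
        inner ℂ u (freeProp n m lam τ v) := fun τ u v => by
      rw [← LinearIsometryEquiv.inner_map_map (freeProp n m lam τ),
        LinearIsometryEquiv.apply_symm_apply]
    -- The free factor is put on the Schwartz function, where it is differentiable in norm; it need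
    -- not be so on `W τ y`.
    have h1 : ∀ τ, l2Pairing φ (((X s).symm.trans (X τ)) ψ) =
        inner ℂ ((freeProp n m lam τ).symm (φ.toLp 2)) (W τ y) := fun τ => by
      rw [l2Pairing_schwartz, h2]
      rfl
    simp_rw [h1]
    refine ((hasDerivAt_freeProp_symm hm hlam (hJ t ht) φ).inner ℂ (hW y t)).congr_deriv ?_
    rw [l2Pairing_reducedHamiltonian hV hC, hamiltonianL, inner_add_left, inner_smul_left,
      inner_smul_left, inner_smul_left, inner_smul_right, h2, h2, interaction_apply,
      LinearIsometryEquiv.apply_symm_apply, inner_mulL_left, star_potential, Complex.conj_ofReal,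
      Complex.conj_I]
    simp only [LinearIsometryEquiv.trans_apply, hX]
    ring

end

/-! ### Every weak propagator solves the interaction equation strongly -/

noncomputable section

open scoped BoundedContinuousFunction ComplexConjugate ContDiff FourierTransform

variable {n : ℕ}

/-- Smooth functions with compact support away from the origin are dense in `L²`. -/
theorem eq_zero_of_inner_test (hn : 1 ≤ n) {z : L2Space n}
    (h : ∀ κ : 𝓢(RSpace n, ℂ), HasCompactSupport κ → tsupport κ ⊆ {0}ᶜ →
      inner ℂ (κ.toLp 2 : L2Space n) z = 0) : z = 0 := by
  -- `n ≥ 1` makes the origin a null set, so test functions avoiding it still suffice.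
  have : Nonempty (Fin n) := ⟨⟨0, hn⟩⟩
  have h1 : ∀ᵐ x, x ∈ ({0}ᶜ : Set (RSpace n)) → z x = 0 := by
    refine isOpen_compl_singleton.ae_eq_zero_of_integral_contDiff_smul_eq_zero
      (((Lp.memLp z).locallyIntegrable (by norm_num)).locallyIntegrableOn _) ?_
    intro g g_smooth g_cpt g_supp
    have hg₁ : HasCompactSupport (Complex.ofRealCLM ∘ g) := g_cpt.comp_left rfl
    have hg₂ : ContDiff ℝ ∞ (Complex.ofRealCLM ∘ g) := by fun_prop
    have hg₃ : tsupport (Complex.ofRealCLM ∘ g) ⊆ {0}ᶜ :=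
      (tsupport_comp_subset (map_zero _) g).trans g_supp
    have h2 := h (hg₁.toSchwartzMap hg₂) hg₁ hg₃
    rw [L2.inner_def] at h2
    rw [← h2]
    refine integral_congr_ae ?_
    filter_upwards [(hg₁.toSchwartzMap hg₂).coeFn_toLp 2 volume] with x hx
    rw [RCLike.inner_apply, hx]
    simp [mul_comm]
  have h2 : ∀ᵐ x : RSpace n, x ∈ ({0}ᶜ : Set (RSpace n)) := by
    rw [ae_iff]
    simp
  apply Lp.ext
  filter_upwards [h1, h2, Lp.coeFn_zero ℂ 2 (volume : Measure (RSpace n))] with x k1 k2 k3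
  rw [k1 k2, k3, Pi.zero_apply]

theorem exists_schwartz_phase {κ : 𝓢(RSpace n, ℂ)} (hκ : HasCompactSupport κ) (c : ℝ) :
    ∃ κ' : 𝓢(RSpace n, ℂ), κ'.toLp 2 = phase (c • normSq n) (κ.toLp 2) := by
  have hs : ContDiff ℝ ∞ fun x => Complex.exp (-Complex.I * ((c * ‖x‖ ^ 2 : ℝ) : ℂ)) * κ x := by
    have h1 : ContDiff ℝ ∞ fun x : RSpace n => ((c * ‖x‖ ^ 2 : ℝ) : ℂ) :=
      Complex.ofRealCLM.contDiff.comp (contDiff_const.mul (contDiff_norm_sq ℝ))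
    exact (contDiff_const.mul h1).cexp.mul (κ.smooth ⊤)
  refine ⟨(hκ.mul_left).toSchwartzMap hs, ?_⟩
  apply Lp.ext
  filter_upwards [((hκ.mul_left).toSchwartzMap hs).coeFn_toLp 2 volume, κ.coeFn_toLp 2 volume,
    coeFn_phase (c • normSq n) (κ.toLp 2)] with x h1 h2 h3
  rw [h1, h3, h2]
  simp

/-- The free evolution multiplies `κ` by a smooth unimodular function, which keeps it smooth and
compactly supported. The evolved vector may thus be inserted into the weak Schrödinger equation, and
the Laplacian commutes with it as a Fourier multiplier. -/
theorem exists_schwartz_freeProp {κ : 𝓢(RSpace n, ℂ)} (hκ : HasCompactSupport κ)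
    (m lam t : ℝ) :
    ∃ φ : 𝓢(RSpace n, ℂ), φ.toLp 2 = freeProp n m lam t ((𝓕⁻ κ).toLp 2) ∧
      negLaplacianL φ = freeProp n m lam t (negLaplacianL (𝓕⁻ κ)) := by
  obtain ⟨κ', hκ'⟩ := exists_schwartz_phase hκ (2 * Real.pi ^ 2 * tau m lam t)
  have h1 : ∀ κ : 𝓢(RSpace n, ℂ), (𝓕⁻ κ).toLp 2 = (fourierL n).symm (κ.toLp 2) := fun κ => by
    rw [fourierL_symm_eq, toLp_fourierInv_eq]
  have h2 : (𝓕⁻ κ').toLp 2 = freeProp n m lam t ((𝓕⁻ κ).toLp 2) := by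
    rw [h1, h1, hκ', freeProp, freeEvol_apply, LinearIsometryEquiv.apply_symm_apply]
  refine ⟨𝓕⁻ κ', h2, ?_⟩
  apply (fourierL n).injective
  apply Lp.ext
  have h3 : ∀ u : L2Space n, fourierL n (freeProp n m lam t u) =
      phase ((2 * Real.pi ^ 2 * tau m lam t) • normSq n) (fourierL n u) := fun u => by
    rw [freeProp, freeEvol_apply, LinearIsometryEquiv.apply_symm_apply]
  rw [h3]
  have k1 := coeFn_fourierL_negLaplacianL (𝓕⁻ κ')
  rw [h2, h3] at k1
  filter_upwards [k1, coeFn_fourierL_negLaplacianL (𝓕⁻ κ),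
    coeFn_phase ((2 * Real.pi ^ 2 * tau m lam t) • normSq n) (fourierL n ((𝓕⁻ κ).toLp 2)),
    coeFn_phase ((2 * Real.pi ^ 2 * tau m lam t) • normSq n)
      (fourierL n (negLaplacianL (𝓕⁻ κ)))] with x k1 k2 k3 k4
  rw [k1, k3, k4, k2]
  ring

/-- Product rule for the inner product with a vector which is only weakly differentiable. -/
theorem hasDerivAt_inner_of_weak {H : Type*} [NormedAddCommGroup H] [InnerProductSpace ℂ H]
    {a u : ℝ → H} {a' : H} {d : ℂ} {t : ℝ} (ha : HasDerivAt a a' t) (hu : ContinuousAt u t)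
    (hd : HasDerivAt (fun s => inner ℂ (a t) (u s)) d t) :
    HasDerivAt (fun s => inner ℂ (a s) (u s)) (inner ℂ a' (u t) + d) t := by
  rw [hasDerivAt_iff_tendsto_slope] at ha hd ⊢
  have h1 := (ha.inner (𝕜 := ℂ) (hu.tendsto.mono_left (nhdsWithin_le_nhds (s := {t}ᶜ)))).add hd
  refine h1.congr fun s => ?_
  simp only [slope, vsub_eq_sub]
  rw [← Complex.coe_smul, inner_smul_left, Complex.conj_ofReal, inner_sub_left,
    Complex.real_smul, Complex.real_smul]
  ring

/-- A function which is weakly differentiable against a total set of vectors, with continuous weak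
derivative, is differentiable. -/
theorem hasDerivAt_of_weak {H : Type*} [NormedAddCommGroup H] [InnerProductSpace ℂ H]
    [CompleteSpace H] {w F : ℝ → H} {J : Set ℝ} (hJo : IsOpen J) (hJc : J.OrdConnected)
    (hF : ContinuousOn F J) {D : Set H} (hD : ∀ z : H, (∀ a ∈ D, inner ℂ a z = 0) → z = 0)
    (hweak : ∀ a ∈ D, ∀ t ∈ J, HasDerivAt (fun t => inner ℂ a (w t)) (inner ℂ a (F t)) t) {t : ℝ}
    (ht : t ∈ J) : HasDerivAt w (F t) t := by
  -- The candidate primitive: against each vector of `D`, `w - y` has zero derivative and vanishes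
  -- at `t`, so `w = y` by totality.
  set y : ℝ → H := fun u => w t + ∫ τ in t..u, F τ with hy
  have hyd : ∀ u ∈ J, HasDerivAt y (F u) u := fun u hu =>
    (intervalIntegral.integral_hasDerivAt_right
      ((hF.mono (hJc.uIcc_subset ht hu)).intervalIntegrable)
      (hF.stronglyMeasurableAtFilter hJo u hu) (hF.continuousAt (hJo.mem_nhds hu))).const_add _
  have hwy : ∀ u ∈ J, w u = y u := by
    intro u hu
    rw [← sub_eq_zero]
    refine hD _ fun a ha => ?_
    have hd : ∀ t ∈ J, HasDerivAt (fun t => inner ℂ a (w t - y t)) 0 t := fun t ht => by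
      have h3 := (hasDerivAt_const t a).inner ℂ (hyd t ht)
      simp only [inner_zero_left, add_zero] at h3
      have h4 := (hweak a ha t ht).sub h3
      rw [sub_self] at h4
      refine h4.congr_of_eventuallyEq (Eventually.of_forall fun t => ?_)
      simp
    rw [hJo.is_const_of_deriv_eq_zero hJc.isPreconnected
      (fun t ht => (hd t ht).differentiableAt.differentiableWithinAt)
      (fun t ht => (hd t ht).deriv) hu ht]
    simp [hy]
  exact (hyd t ht).congr_of_eventuallyEq (Filter.eventually_of_mem (hJo.mem_nhds ht) hwy)

theorem inner_freeProp_left (m lam t : ℝ) (u v : L2Space n) :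
    inner ℂ (freeProp n m lam t u) v = inner ℂ u ((freeProp n m lam t).symm v) := by
  rw [← LinearIsometryEquiv.inner_map_map (freeProp n m lam t) u,
    LinearIsometryEquiv.apply_symm_apply]

/-- In the interaction picture every propagator solves its equation strongly. -/
theorem IsPropagator.hasDerivAt_interaction {V : ℝ → RSpace n → ℝ}
    (hV : Continuous fun q : ℝ × RSpace n => V q.1 q.2) {C : ℝ} (hC : ∀ t x, |V t x| ≤ C)
    {m lam : ℝ} (hn : 1 ≤ n) (hm : 0 < m) (h0 : 0 ≤ lam) (hlam : lam < 1 / 2) {J : Set ℝ}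
    (hJo : IsOpen J) (hJc : J.OrdConnected) (hJ0 : ∀ t ∈ J, t ≠ 0)
    {U : ℝ → ℝ → (L2Space n ≃ₗᵢ[ℂ] L2Space n)} (hU : IsPropagator (reducedHamiltonian m lam V) J U)
    {s : ℝ} (hs : s ∈ J) (ψ : L2Space n) {t : ℝ} (ht : t ∈ J) :
    HasDerivAt (fun t => (freeProp n m lam t).symm (U t s ψ))
      (-Complex.I • interaction hV hC m lam t ((freeProp n m lam t).symm (U t s ψ))) t := by
  set w : ℝ → L2Space n := fun t => (freeProp n m lam t).symm (U t s ψ) with hw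
  set A := interaction hV hC m lam with hA
  have huc : ContinuousOn (fun t => U t s ψ) J :=
    (hU.continuousOn ψ).comp (f := fun t => (t, s)) (by fun_prop) fun t ht => ⟨ht, hs⟩
  have hwc : ContinuousOn w J := continuousOn_apply_of_strong (C := 1)
    (B := fun t => (freeProp n m lam t).symm.toContinuousLinearEquiv.toContinuousLinearMap)
    (fun t ψ => by simp) (continuous_freeProp_symm m hlam) huc
  have hF : ContinuousOn (fun t => -Complex.I • A t (w t)) J :=
    ContinuousOn.fun_const_smul (continuousOn_apply_of_strong (norm_interaction_le hV hC m lam)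
      (continuous_interaction hV hC m h0 hlam) hwc) _
  -- At the fixed time `t` the weak equation is used with `φ = freeProp t (𝓕⁻¹κ)`. Moving the test
  -- vector with the free flow cancels the kinetic term and leaves only the potential.
  have hweak : ∀ κ : 𝓢(RSpace n, ℂ), HasCompactSupport κ → ∀ t ∈ J,
      HasDerivAt (fun t => inner ℂ ((𝓕⁻ κ).toLp 2 : L2Space n) (w t))
        (inner ℂ ((𝓕⁻ κ).toLp 2 : L2Space n) (-Complex.I • A t (w t))) t := by
    intro κ hκ t ht
    obtain ⟨φ, hφ, hφ'⟩ := exists_schwartz_freeProp hκ m lam t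
    have h1 : ∀ t, inner ℂ ((𝓕⁻ κ).toLp 2 : L2Space n) (w t) =
        inner ℂ (freeProp n m lam t ((𝓕⁻ κ).toLp 2)) (U t s ψ) := fun t => by
      rw [inner_freeProp_left]
    simp_rw [h1]
    have h2 := hU.schrodinger s hs ψ φ t ht
    simp_rw [l2Pairing_schwartz, hφ] at h2
    refine (hasDerivAt_inner_of_weak (hasDerivAt_freeProp hm hlam (hJ0 t ht) (𝓕⁻ κ))
      (huc.continuousAt (hJo.mem_nhds ht)) h2).congr_deriv ?_
    rw [l2Pairing_reducedHamiltonian hV hC, hamiltonianL, hφ, hφ', inner_add_left, inner_smul_left,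
      inner_smul_left, inner_smul_left, inner_smul_right, hA, interaction_apply,
      ← inner_freeProp_left, inner_mulL_left, star_potential, Complex.conj_ofReal, map_neg,
      Complex.conj_I]
    simp only [hw, LinearIsometryEquiv.apply_symm_apply]
    ring
  refine hasDerivAt_of_weak hJo hJc hF (D := {a | ∃ κ : 𝓢(RSpace n, ℂ), HasCompactSupport κ ∧
    (𝓕⁻ κ).toLp 2 = a}) (fun z hz => ?_) ?_ ht
  · have h1 : fourierL n z = 0 := by
      refine eq_zero_of_inner_test hn fun κ hκ _ => ?_
      have h2 := hz _ ⟨κ, hκ, rfl⟩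
      rwa [← toLp_fourierInv_eq, ← fourierL_symm_eq,
        ← LinearIsometryEquiv.inner_map_map (fourierL n),
        LinearIsometryEquiv.apply_symm_apply] at h2
    rwa [LinearIsometryEquiv.map_eq_zero_iff] at h1
  · rintro _ ⟨κ, hκ, rfl⟩ t ht
    exact hweak κ hκ t ht

theorem reducedHamiltonian_zero (m lam : ℝ) :
    reducedHamiltonian (n := n) m lam (fun _ _ => 0) = freeReducedHamiltonian m lam := by
  funext t φ x
  simp [reducedHamiltonian]

/-- The free propagator is unique. -/
theorem IsPropagator.free_eq {m lam : ℝ} (hn : 1 ≤ n) (hm : 0 < m) (h0 : 0 ≤ lam)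
    (hlam : lam < 1 / 2) {J : Set ℝ} (hJo : IsOpen J) (hJc : J.OrdConnected)
    (hJ0 : ∀ t ∈ J, t ≠ 0) {U : ℝ → ℝ → (L2Space n ≃ₗᵢ[ℂ] L2Space n)}
    (hU : IsPropagator (freeReducedHamiltonian m lam) J U) {s t : ℝ} (hs : s ∈ J) (ht : t ∈ J)
    (ψ : L2Space n) : U t s ψ = freeProp n m lam t ((freeProp n m lam s).symm ψ) := by
  rw [← reducedHamiltonian_zero] at hU
  have hV : Continuous fun q : ℝ × RSpace n => (fun _ _ => 0 : ℝ → RSpace n → ℝ) q.1 q.2 :=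
    continuous_const
  have hC : ∀ t x, |(fun _ _ => 0 : ℝ → RSpace n → ℝ) t x| ≤ 0 := fun t x => by simp
  have hd : ∀ t ∈ J, HasDerivAt (fun t => (freeProp n m lam t).symm (U t s ψ)) 0 t := fun t ht => by
    refine (hU.hasDerivAt_interaction hV hC hn hm h0 hlam hJo hJc hJ0 hs ψ ht).congr_deriv ?_
    have := norm_interaction_le hV hC m lam t ((freeProp n m lam t).symm (U t s ψ))
    rw [zero_mul, norm_le_zero_iff] at this
    rw [this, smul_zero]
  have h5 := hJo.is_const_of_deriv_eq_zero hJc.isPreconnected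
    (fun t ht => (hd t ht).differentiableAt.differentiableWithinAt)
    (fun t ht => (hd t ht).deriv) ht hs
  rw [hU.self_eq s hs, LinearIsometryEquiv.symm_apply_eq] at h5
  exact h5

end

/-! ### Derivatives and second moments of the Dollard phase -/

noncomputable section

open scoped BoundedContinuousFunction ComplexConjugate ContDiff FourierTransform LineDeriv

variable {n : ℕ}

theorem hasDerivAt_intervalIntegral_param {b b' : ℝ → ℝ → ℝ}
    (hb : Continuous fun q : ℝ × ℝ => b q.1 q.2) (hb' : Continuous fun q : ℝ × ℝ => b' q.1 q.2)
    (hd : ∀ s r, HasDerivAt (fun r => b s r) (b' s r) r) (s t r : ℝ) :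
    HasDerivAt (fun r => ∫ τ in s..t, b τ r) (∫ τ in s..t, b' τ r) r := by
  obtain ⟨K, hK⟩ := (isCompact_uIcc (a := s) (b := t)).prod
    (isCompact_closedBall r 1) |>.exists_bound_of_continuousOn hb'.continuousOn
  have h1 : ∀ r, Continuous fun τ => b τ r := fun r => hb.comp (by fun_prop : Continuous (·, r))
  have h2 : ∀ r, Continuous fun τ => b' τ r := fun r => hb'.comp (by fun_prop : Continuous (·, r))
  refine (intervalIntegral.hasDerivAt_integral_of_dominated_loc_of_deriv_le
    (F := fun r τ => b τ r) (F' := fun r τ => b' τ r) (bound := fun _ => K)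
    (Metric.closedBall_mem_nhds r one_pos) (Eventually.of_forall fun r =>
      (h1 r).aestronglyMeasurable) ((h1 r).intervalIntegrable _ _)
    (h2 r).aestronglyMeasurable (Eventually.of_forall fun τ hτ x hx =>
      hK (τ, x) ⟨Set.uIoc_subset_uIcc hτ, hx⟩) intervalIntegrable_const
    (Eventually.of_forall fun τ _ x _ => hd τ x)).2

/-- The primitive `t |t|^{-p} / (1 - p)` of `|t|^{-p}`. -/
def primitiveAbs (p t : ℝ) : ℝ := t * |t| ^ (-p) / (1 - p)

theorem hasDerivAt_primitiveAbs {p t : ℝ} (hp : p ≠ 1) (ht : t ≠ 0) :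
    HasDerivAt (primitiveAbs p) (|t| ^ (-p)) t := by
  have : 1 - p ≠ 0 := sub_ne_zero.2 hp.symm
  refine ((hasDerivAt_mul_abs_rpow_neg p ht).div_const (1 - p)).congr_deriv ?_
  field_simp

/-- The two half lines on which the propagators live. -/
theorem halfLine_properties {J : Set ℝ} (hJ : J = Set.Ioi 0 ∨ J = Set.Iio 0) :
    IsOpen J ∧ J.OrdConnected ∧ ∀ t ∈ J, t ≠ 0 := by
  rcases hJ with rfl | rfl
  · exact ⟨isOpen_Ioi, Set.ordConnected_Ioi, fun t ht => ht.ne'⟩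
  · exact ⟨isOpen_Iio, Set.ordConnected_Iio, fun t ht => ht.ne⟩

/-- On a half line the primitive has constant sign and its modulus grows with `|t|`, so the
difference of its values is bounded by the value at the far end. -/
theorem abs_integral_abs_rpow_le {J : Set ℝ} (hJ : J = Set.Ioi 0 ∨ J = Set.Iio 0) {p s t : ℝ}
    (hp : p < 1) (hs : s ∈ J) (ht : t ∈ J) (hst : |s| ≤ |t|) :
    |∫ τ in s..t, |τ| ^ (-p)| ≤ |t| ^ (1 - p) / (1 - p) := by
  obtain ⟨_, hJc, hJ0⟩ := halfLine_properties hJ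
  have hsub := hJc.uIcc_subset hs ht
  have h1 : ∫ τ in s..t, |τ| ^ (-p) = primitiveAbs p t - primitiveAbs p s := by
    refine intervalIntegral.integral_eq_sub_of_hasDerivAt
      (fun τ hτ => hasDerivAt_primitiveAbs hp.ne (hJ0 τ (hsub hτ))) ?_
    refine ContinuousOn.intervalIntegrable fun τ hτ => ContinuousAt.continuousWithinAt ?_
    exact continuous_abs.continuousAt.rpow_const (Or.inl (abs_ne_zero.2 (hJ0 τ (hsub hτ))))
  have h2 : ∀ u ≠ 0, |primitiveAbs p u| = |u| ^ (1 - p) / (1 - p) := fun u hu => by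
    rw [primitiveAbs, abs_div, abs_mul_abs_rpow_neg p hu, abs_of_pos (by linarith : 0 < 1 - p)]
  have h3 : |primitiveAbs p s| ≤ |primitiveAbs p t| := by
    rw [h2 s (hJ0 s hs), h2 t (hJ0 t ht)]
    have : 0 ≤ 1 - p := by linarith
    gcongr
  rw [h1, ← h2 t (hJ0 t ht)]
  have hp' : 0 < 1 - p := by linarith
  have h4 : ∀ u, 0 ≤ u → 0 ≤ primitiveAbs p u := fun u hu =>
    div_nonneg (mul_nonneg hu (Real.rpow_nonneg (abs_nonneg u) _)) hp'.le
  have h5 : ∀ u, u ≤ 0 → primitiveAbs p u ≤ 0 := fun u hu =>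
    div_nonpos_of_nonpos_of_nonneg
      (mul_nonpos_of_nonpos_of_nonneg hu (Real.rpow_nonneg (abs_nonneg u) _)) hp'.le
  rcases hJ with rfl | rfl
  · have hs' := h4 s (le_of_lt hs)
    have ht' := h4 t (le_of_lt ht)
    rw [abs_of_nonneg hs', abs_of_nonneg ht'] at h3
    rw [abs_of_nonneg ht', abs_of_nonneg (by linarith)]
    linarith
  · have hs' := h5 s (le_of_lt hs)
    have ht' := h5 t (le_of_lt ht)
    rw [abs_of_nonpos hs', abs_of_nonpos ht'] at h3
    rw [abs_of_nonpos ht', abs_of_nonpos (by linarith)]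
    linarith

/-- `D₁` and `D₂` are the first two spatial derivatives of `V` in the direction `e`, and all three
are jointly continuous. -/
structure HasLineDerivs (e : RSpace n) (V D₁ D₂ : ℝ → RSpace n → ℝ) : Prop where
  cont : Continuous fun q : ℝ × RSpace n => V q.1 q.2
  cont₁ : Continuous fun q : ℝ × RSpace n => D₁ q.1 q.2
  cont₂ : Continuous fun q : ℝ × RSpace n => D₂ q.1 q.2
  deriv₁ : ∀ s x (r : ℝ), HasDerivAt (fun r : ℝ => V s (x + r • e)) (D₁ s (x + r • e)) r
  deriv₂ : ∀ s x (r : ℝ), HasDerivAt (fun r : ℝ => D₁ s (x + r • e)) (D₂ s (x + r • e)) r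

theorem hasDerivAt_line_scaled {e : RSpace n} {V D : ℝ → RSpace n → ℝ}
    (h : ∀ s x (r : ℝ), HasDerivAt (fun r : ℝ => V s (x + r • e)) (D s (x + r • e)) r)
    (c s : ℝ) (x : RSpace n) (r : ℝ) :
    HasDerivAt (fun r : ℝ => V s (c • (x + r • e))) (c * D s (c • (x + r • e))) r := by
  have h1 := (h s (c • x) (r * c)).comp r ((hasDerivAt_id r).mul_const c)
  simp only [one_mul] at h1
  have h2 : ∀ r : ℝ, c • (x + r • e) = c • x + (r * c) • e := fun r => by
    rw [smul_add, smul_smul, mul_comm]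
  simp_rw [h2, mul_comm c (D _ _)]
  exact h1

section DollardPhase

/-- The phase `ξ ↦ ∫ V(s, c(s) ξ) ds` of the Dollard modifier. -/
def dollardPhase {V : ℝ → RSpace n → ℝ} (hV : Continuous fun q : ℝ × RSpace n => V q.1 q.2)
    {c : ℝ → ℝ} (hc : Continuous c) (s t : ℝ) : C(RSpace n, ℝ) :=
  ⟨fun x => ∫ τ in s..t, V τ (c τ • x),
    intervalIntegral.continuous_parametric_intervalIntegral_of_continuous'
      (f := fun x τ => V τ (c τ • x))
      (hV.comp (by fun_prop : Continuous fun q : RSpace n × ℝ => (q.2, c q.2 • q.1))) s t⟩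

theorem dollardPhase_apply {V : ℝ → RSpace n → ℝ}
    (hV : Continuous fun q : ℝ × RSpace n => V q.1 q.2) {c : ℝ → ℝ} (hc : Continuous c) (s t : ℝ)
    (x : RSpace n) : dollardPhase hV hc s t x = ∫ τ in s..t, V τ (c τ • x) := rfl

theorem hasDerivAt_dollardPhase {V : ℝ → RSpace n → ℝ}
    (hV : Continuous fun q : ℝ × RSpace n => V q.1 q.2) {c : ℝ → ℝ} (hc : Continuous c) (s t : ℝ)
    (x : RSpace n) : HasDerivAt (fun t => dollardPhase hV hc s t x) (V t (c t • x)) t :=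
  ((hV.comp (continuous_id.prodMk (hc.smul
    (continuous_const (y := x))))).integral_hasStrictDerivAt s t).hasDerivAt

theorem hasDerivAt_phase_dollardPhase {V : ℝ → RSpace n → ℝ}
    (hV : Continuous fun q : ℝ × RSpace n => V q.1 q.2) {C : ℝ} (hC : ∀ t x, |V t x| ≤ C)
    {c : ℝ → ℝ} (hc : Continuous c) (s t : ℝ) (u : L2Space n) :
    HasDerivAt (fun t => phase (dollardPhase hV hc s t) u)
      (-Complex.I • mulL (potential hV hC t (c t)) (phase (dollardPhase hV hc s t) u)) t := by
  refine hasDerivAt_phase (b := fun _ => C) (fun t x => hasDerivAt_dollardPhase hV hc s t x)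
    (fun t x => hC t _) ((Lp.memLp u).norm.const_mul C) ?_
  filter_upwards [Lp.coeFn_smul (-Complex.I)
    (mulL (potential hV hC t (c t)) (phase (dollardPhase hV hc s t) u)),
    coeFn_mulL (potential hV hC t (c t)) (phase (dollardPhase hV hc s t) u),
    coeFn_phase (dollardPhase hV hc s t) u] with x h1 h2 h3
  rw [h1, Pi.smul_apply, h2, h3, potential_apply, smul_eq_mul, mul_assoc]

theorem hasDerivAt_integral_line {e : RSpace n} {V D : ℝ → RSpace n → ℝ}
    (hV : Continuous fun q : ℝ × RSpace n => V q.1 q.2)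
    (hD : Continuous fun q : ℝ × RSpace n => D q.1 q.2)
    (h : ∀ s x (r : ℝ), HasDerivAt (fun r : ℝ => V s (x + r • e)) (D s (x + r • e)) r)
    {c b : ℝ → ℝ} (hc : Continuous c) (hb : Continuous b) (s t : ℝ) (x : RSpace n) (r : ℝ) :
    HasDerivAt (fun r : ℝ => ∫ τ in s..t, b τ * V τ (c τ • (x + r • e)))
      (∫ τ in s..t, b τ * (c τ * D τ (c τ • (x + r • e)))) r := by
  have hcont : Continuous fun q : ℝ × ℝ => (q.1, c q.1 • (x + q.2 • e)) := by fun_prop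
  refine hasDerivAt_intervalIntegral_param
    (b := fun τ r => b τ * V τ (c τ • (x + r • e)))
    (b' := fun τ r => b τ * (c τ * D τ (c τ • (x + r • e))))
    ((hb.comp continuous_fst).mul (hV.comp hcont))
    ((hb.comp continuous_fst).mul ((hc.comp continuous_fst).mul (hD.comp hcont)))
    (fun τ r => (hasDerivAt_line_scaled h (c τ) τ x r).const_mul (b τ)) s t r

/-- The second derivative of the Dollard phase times a test function grows at most like
`|t|^{2(1-δ)}`. -/
theorem exists_second_moment_dollard {J : Set ℝ} (hJ : J = Set.Ioi 0 ∨ J = Set.Iio 0)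
    {e : RSpace n} (he : ‖e‖ = 1) {V D₁ D₂ : ℝ → RSpace n → ℝ} (h : HasLineDerivs e V D₁ D₂)
    {c : ℝ → ℝ} (hc : Continuous c) {δ : ℝ} (hδ : δ < 1) {A : ℝ → ℝ}
    (hA₁ : ∀ r, 0 < r → ∀ t ∈ J, ∀ x, r ≤ ‖x‖ → |c t * D₁ t (c t • x)| ≤ A r * |t| ^ (-δ))
    (hA₂ : ∀ r, 0 < r → ∀ t ∈ J, ∀ x, r ≤ ‖x‖ →
      |c t * (c t * D₂ t (c t • x))| ≤ A r * |t| ^ (-δ))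
    {s : ℝ} (hs : s ∈ J) {κ : 𝓢(RSpace n, ℂ)} (hκ : HasCompactSupport κ)
    (hκ0 : tsupport κ ⊆ {0}ᶜ) :
    ∃ K : ℝ, ∀ t ∈ J, |s| ≤ |t| → ∃ v : L2Space n,
      v =ᵐ[volume] (fun x => ((inner ℝ x e ^ 2 : ℝ) : ℂ) *
        (fourierL n).symm (phase (dollardPhase h.cont hc s t) (κ.toLp 2)) x) ∧
      ‖v‖ ≤ K * (|t| ^ (1 - δ)) ^ 2 := by
  obtain ⟨_, hJc, hJ0⟩ := halfLine_properties hJ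
  -- Only `‖x‖ ≥ r` matters on the support of `κ`, which is where the bounds on `D₁` and `D₂` are
  -- available.
  obtain ⟨r, hr, hrκ⟩ : ∃ r : ℝ, 0 < r ∧ ∀ x, ‖x‖ < r → x ∉ tsupport κ := by
    have h1 : (tsupport κ)ᶜ ∈ 𝓝 (0 : RSpace n) :=
      (isClosed_tsupport κ).isOpen_compl.mem_nhds fun h0 => hκ0 h0 rfl
    obtain ⟨r, hr, hball⟩ := Metric.mem_nhds_iff.1 h1
    exact ⟨r, hr, fun x hx => hball (by simpa using hx)⟩
  obtain ⟨R, hR⟩ := hκ.isBounded.exists_norm_le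
  set κ₁ : 𝓢(RSpace n, ℂ) := ∂_{e} κ with hκ₁
  set κ₂ : 𝓢(RSpace n, ℂ) := ∂_{e} κ₁ with hκ₂
  have hline : ∀ (g : 𝓢(RSpace n, ℂ)) (x : RSpace n) (r : ℝ),
      HasDerivAt (fun r : ℝ => g (x + r • e)) ((∂_{e} g : 𝓢(RSpace n, ℂ)) (x + r • e)) r := by
    intro g x r
    have h1 : HasDerivAt (fun r : ℝ => x + r • e) e r := by
      simpa using ((hasDerivAt_id r).smul_const e).const_add x
    rw [lineDerivOp_apply_eq_fderiv]
    exact (g.differentiableAt.hasFDerivAt (x := x + r • e)).comp_hasDerivAt r h1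
  have hts₁ : tsupport κ₁ ⊆ tsupport κ := tsupport_lineDerivOp_subset e κ
  have hts₂ : tsupport κ₂ ⊆ tsupport κ := (tsupport_lineDerivOp_subset e κ₁).trans hts₁
  set B := max (SchwartzMap.seminorm ℝ 0 0 κ) (max (SchwartzMap.seminorm ℝ 0 0 κ₁)
    (SchwartzMap.seminorm ℝ 0 0 κ₂)) with hB
  have hB0 : ∀ x, ‖κ x‖ ≤ B := fun x => (norm_le_seminorm ℝ κ x).trans (le_max_left _ _)
  have hB1 : ∀ x, ‖κ₁ x‖ ≤ B := fun x =>
    (norm_le_seminorm ℝ κ₁ x).trans ((le_max_left _ _).trans (le_max_right _ _))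
  have hB2 : ∀ x, ‖κ₂ x‖ ≤ B := fun x =>
    (norm_le_seminorm ℝ κ₂ x).trans ((le_max_right _ _).trans (le_max_right _ _))
  have hBn : 0 ≤ B := (norm_nonneg _).trans (hB0 0)
  set T₀ := |s| ^ (1 - δ) with hT₀
  have hT₀pos : 0 < T₀ := Real.rpow_pos_of_pos (abs_pos.2 (hJ0 s hs)) _
  set A' := |A r| / (1 - δ) with hA'
  have hδ' : 0 < 1 - δ := by linarith
  have hA'0 : 0 ≤ A' := by positivity
  -- The second derivative is at most `B(1 + 3A'T + A'²T²)`; since `T ≥ T₀`, the lower powers are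
  -- absorbed by `1 ≤ T²/T₀²` and `T ≤ T²/T₀`.
  set M := B * (1 / T₀ ^ 2 + 3 * A' / T₀ + A' ^ 2) with hM
  refine ⟨M * √(volume.real (Metric.closedBall (0 : RSpace n) (R + 2))), fun t ht hst => ?_⟩
  set T := |t| ^ (1 - δ) with hT
  have hTT : T₀ ≤ T := by
    rw [hT, hT₀]
    gcongr
  have hTpos : 0 < T := hT₀pos.trans_le hTT
  set a : RSpace n → ℝ := fun x => ∫ τ in s..t, V τ (c τ • x) with ha
  set a₁ : RSpace n → ℝ := fun x => ∫ τ in s..t, c τ * D₁ τ (c τ • x) with ha₁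
  set a₂ : RSpace n → ℝ := fun x => ∫ τ in s..t, c τ * (c τ * D₂ τ (c τ • x)) with ha₂
  have hbd : ∀ g : ℝ → ℝ, (∀ τ ∈ J, |g τ| ≤ A r * |τ| ^ (-δ)) → |∫ τ in s..t, g τ| ≤ A' * T := by
    intro g hg
    have hsub := hJc.uIcc_subset hs ht
    have h1 : ‖∫ τ in s..t, g τ‖ ≤ |∫ τ in s..t, |A r| * |τ| ^ (-δ)| := by
      refine intervalIntegral.norm_integral_le_abs_of_norm_le ?_ ?_
      · refine (ae_restrict_iff' measurableSet_uIoc).2 (Eventually.of_forall fun τ hτ => ?_)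
        refine (hg τ (hsub (Set.uIoc_subset_uIcc hτ))).trans ?_
        gcongr
        exact le_abs_self _
      · refine ContinuousOn.intervalIntegrable fun τ hτ => ContinuousAt.continuousWithinAt ?_
        exact continuousAt_const.mul (continuous_abs.continuousAt.rpow_const
          (Or.inl (abs_ne_zero.2 (hJ0 τ (hsub hτ)))))
    refine h1.trans ?_
    rw [intervalIntegral.integral_const_mul, abs_mul, abs_abs, hA', div_mul_eq_mul_div,
      mul_div_assoc]
    gcongr
    exact abs_integral_abs_rpow_le hJ hδ hs ht hst
  have had : ∀ x r, HasDerivAt (fun r : ℝ => a (x + r • e)) (a₁ (x + r • e)) r := fun x r => by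
    simpa only [one_mul] using hasDerivAt_integral_line h.cont h.cont₁ h.deriv₁ hc (continuous_const (y := 1))
      s t x r
  have had₁ : ∀ x r, HasDerivAt (fun r : ℝ => a₁ (x + r • e)) (a₂ (x + r • e)) r := fun x r =>
    hasDerivAt_integral_line h.cont₁ h.cont₂ h.deriv₂ hc hc s t x r
  set E : RSpace n → ℂ := fun x => Complex.exp (-Complex.I * (a x : ℂ)) with hE
  have hEd : ∀ x r, HasDerivAt (fun r : ℝ => E (x + r • e))
      (E (x + r • e) * (-Complex.I * (a₁ (x + r • e) : ℂ))) r := fun x r =>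
    ((had x r).ofReal_comp.const_mul (-Complex.I)).cexp
  have hEn : ∀ x, ‖E x‖ = 1 := fun x => by
    simp only [hE, Complex.norm_exp]
    simp
  -- `f₁` and `f₂` are the first two derivatives of `e^{-ia}κ` along `e`; the term `a₁²κ` is the one
  -- allowed to grow like `T²`.
  refine (exists_second_moment_fourier (R := R) he (f := fun x => E x * κ x)
    (f₁ := fun x => E x * (κ₁ x - Complex.I * (a₁ x : ℂ) * κ x))
    (f₂ := fun x => E x * (κ₂ x - 2 * Complex.I * (a₁ x : ℂ) * κ₁ x
      - Complex.I * (a₂ x : ℂ) * κ x - (a₁ x : ℂ) ^ 2 * κ x)) (M := M * T ^ 2)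
    (fun x r => ?_) (fun x r => ?_) (fun x => ?_) (fun x hx => ?_) ?_).imp
      fun v hv => ⟨hv.1, hv.2.trans (le_of_eq (by ring))⟩
  · refine ((hEd x r).mul (hline κ x r)).congr_deriv ?_
    simp only [← hκ₁]
    ring
  · refine ((hEd x r).mul ((hline κ₁ x r).sub
      (((had₁ x r).ofReal_comp.const_mul Complex.I).mul (hline κ x r)))).congr_deriv ?_
    simp only [← hκ₁, ← hκ₂, Pi.sub_apply, Pi.mul_apply]
    linear_combination (E (x + r • e) * (a₁ (x + r • e) : ℂ) ^ 2 * κ (x + r • e)) * Complex.I_sq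
  · rw [norm_mul, hEn, one_mul]
    rcases lt_or_ge ‖x‖ r with hx | hx
    · have h0 := hrκ x hx
      rw [image_eq_zero_of_notMem_tsupport h0,
        image_eq_zero_of_notMem_tsupport fun h1 => h0 (hts₁ h1),
        image_eq_zero_of_notMem_tsupport fun h2 => h0 (hts₂ h2)]
      simp only [mul_zero, sub_zero, norm_zero]
      positivity
    · have k1 : |a₁ x| ≤ A' * T := hbd _ fun τ hτ => hA₁ r hr τ hτ x hx
      have k2 : |a₂ x| ≤ A' * T := hbd _ fun τ hτ => hA₂ r hr τ hτ x hx
      have n1 : ‖2 * Complex.I * (a₁ x : ℂ) * κ₁ x‖ ≤ 2 * (A' * T) * B := by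
        rw [norm_mul, norm_mul, norm_mul, Complex.norm_I, Complex.norm_real, Real.norm_eq_abs,
          Complex.norm_two, mul_one]
        gcongr
        exact hB1 x
      have n2 : ‖Complex.I * (a₂ x : ℂ) * κ x‖ ≤ (A' * T) * B := by
        rw [norm_mul, norm_mul, Complex.norm_I, Complex.norm_real, Real.norm_eq_abs, one_mul]
        gcongr
        exact hB0 x
      have n3 : ‖(a₁ x : ℂ) ^ 2 * κ x‖ ≤ (A' * T) ^ 2 * B := by
        rw [norm_mul, norm_pow, Complex.norm_real, Real.norm_eq_abs]
        gcongr
        exact hB0 x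
      have n4 := norm_sub_le (κ₂ x - 2 * Complex.I * (a₁ x : ℂ) * κ₁ x
        - Complex.I * (a₂ x : ℂ) * κ x) ((a₁ x : ℂ) ^ 2 * κ x)
      have n5 := norm_sub_le (κ₂ x - 2 * Complex.I * (a₁ x : ℂ) * κ₁ x)
        (Complex.I * (a₂ x : ℂ) * κ x)
      have n6 := norm_sub_le (κ₂ x) (2 * Complex.I * (a₁ x : ℂ) * κ₁ x)
      have n7 := hB2 x
      have m1 : 1 ≤ T ^ 2 / T₀ ^ 2 := by
        rw [one_le_div (by positivity)]
        gcongr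
      have m2 : T ≤ T ^ 2 / T₀ := by
        rw [le_div_iff₀ hT₀pos, sq]
        gcongr
      have m3 : M * T ^ 2 = B * (T ^ 2 / T₀ ^ 2) + 3 * A' * B * (T ^ 2 / T₀) +
          (A' * T) ^ 2 * B := by
        rw [hM]
        ring
      have m4 : B * 1 ≤ B * (T ^ 2 / T₀ ^ 2) := by gcongr
      have m5 : 3 * A' * B * T ≤ 3 * A' * B * (T ^ 2 / T₀) := by gcongr
      rw [m3]
      linarith
  · have : κ x = 0 := by
      refine image_eq_zero_of_notMem_tsupport fun h1 => ?_
      exact absurd (hR x h1) (not_le.2 hx)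
    simp only [this, mul_zero]
  · filter_upwards [coeFn_phase (dollardPhase h.cont hc s t) (κ.toLp 2), κ.coeFn_toLp 2 volume]
      with x h1 h2
    rw [h1, h2, dollardPhase_apply]

end DollardPhase

end

/-! ### Half lines, Cook's method and convergence on total sets -/

noncomputable section

open scoped BoundedContinuousFunction ComplexConjugate ContDiff FourierTransform

variable {n : ℕ}

/-- A half line together with the filter of large times on it. -/
def IsHalfLine (J : Set ℝ) (l : Filter ℝ) : Prop :=
  (J = Set.Ioi 0 ∧ l = atTop) ∨ (J = Set.Iio 0 ∧ l = atBot)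

theorem IsHalfLine.eq_or {J : Set ℝ} {l : Filter ℝ} (h : IsHalfLine J l) :
    J = Set.Ioi 0 ∨ J = Set.Iio 0 := h.imp And.left And.left

theorem IsHalfLine.neBot {J : Set ℝ} {l : Filter ℝ} (h : IsHalfLine J l) : l.NeBot := by
  rcases h with ⟨_, rfl⟩ | ⟨_, rfl⟩ <;> infer_instance

theorem IsHalfLine.tendsto_abs {J : Set ℝ} {l : Filter ℝ} (h : IsHalfLine J l) :
    Tendsto (fun t : ℝ => |t|) l atTop := by
  rcases h with ⟨_, rfl⟩ | ⟨_, rfl⟩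
  · exact tendsto_abs_atTop_atTop
  · exact tendsto_abs_atBot_atTop

theorem IsHalfLine.eventually_mem {J : Set ℝ} {l : Filter ℝ} (h : IsHalfLine J l) (s : ℝ) :
    ∀ᶠ t in l, t ∈ J ∧ |s| ≤ |t| := by
  refine Eventually.and ?_ (h.tendsto_abs.eventually_ge_atTop _)
  rcases h with ⟨rfl, rfl⟩ | ⟨rfl, rfl⟩
  · exact eventually_gt_atTop 0
  · exact eventually_lt_atBot 0

theorem IsHalfLine.mem_of_mem_Icc {J : Set ℝ} {l : Filter ℝ} (h : IsHalfLine J l) {s a b x : ℝ}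
    (ha : a ∈ J ∧ |s| ≤ |a|) (hb : b ∈ J ∧ |s| ≤ |b|) (hx : x ∈ Set.Icc a b) :
    x ∈ J ∧ |s| ≤ |x| := by
  rcases h with ⟨rfl, _⟩ | ⟨rfl, _⟩
  · have h1 : 0 < a := ha.1
    have h2 : 0 < x := h1.trans_le hx.1
    refine ⟨h2, ha.2.trans ?_⟩
    rw [abs_of_pos h1, abs_of_pos h2]
    exact hx.1
  · have h1 : b < 0 := hb.1
    have h2 : x < 0 := hx.2.trans_lt h1
    refine ⟨h2, hb.2.trans ?_⟩
    rw [abs_of_neg h1, abs_of_neg h2]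
    exact neg_le_neg hx.2

theorem IsHalfLine.tendsto_rpow {J : Set ℝ} {l : Filter ℝ} (h : IsHalfLine J l) {q : ℝ}
    (hq : q < 0) : Tendsto (fun t : ℝ => |t| ^ q) l (𝓝 0) := by
  have := (tendsto_rpow_neg_atTop (y := -q) (by linarith)).comp h.tendsto_abs
  simpa [Function.comp_def] using this

/-- Cook's method, in a weak form. -/
theorem exists_limit_of_cook {H : Type*} [NormedAddCommGroup H] [InnerProductSpace ℂ H]
    [CompleteSpace H] {J : Set ℝ} {l : Filter ℝ} (hJl : IsHalfLine J l) {s : ℝ} {ζ : ℝ → H}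
    {K p : ℝ} (hp : 1 < p)
    (hd : ∀ χ : H, ∀ t ∈ J, |s| ≤ |t| → ∃ d : ℂ, ‖d‖ ≤ K * |t| ^ (-p) * ‖χ‖ ∧
      HasDerivAt (fun t => inner ℂ (ζ t) χ) d t) : ∃ z, Tendsto ζ l (𝓝 z) := by
  obtain ⟨_, _, hJ0⟩ := halfLine_properties hJl.eq_or
  have key : ∀ a b, (a ∈ J ∧ |s| ≤ |a|) → (b ∈ J ∧ |s| ≤ |b|) → a ≤ b →
      ‖ζ b - ζ a‖ ≤ |K| * |primitiveAbs p b - primitiveAbs p a| := by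
    intro a b ha hb hab
    -- Testing the increment against itself gives `‖χ‖²` on the left and one factor `‖χ‖` on the
    -- right; dividing turns the weak bound into a norm bound.
    set χ := ζ b - ζ a with hχ
    have hS := fun x hx => hJl.mem_of_mem_Icc (s := s) (x := x) ha hb hx
    have hd' : ∀ x ∈ Set.Icc a b, HasDerivAt (fun t => inner ℂ (ζ t) χ)
        (deriv (fun t => inner ℂ (ζ t) χ) x) x := fun x hx => by
      obtain ⟨d, _, h2⟩ := hd χ x (hS x hx).1 (hS x hx).2
      exact h2.differentiableAt.hasDerivAt
    have hQ : ∀ x ∈ Set.Icc a b, HasDerivAt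
        (fun x => K * ‖χ‖ * (primitiveAbs p x - primitiveAbs p a)) (K * ‖χ‖ * |x| ^ (-p)) x :=
      fun x hx => ((hasDerivAt_primitiveAbs hp.ne' (hJ0 x (hS x hx).1)).sub_const _).const_mul _
    have h1 := image_norm_le_of_norm_deriv_right_le_deriv_boundary'
      (f := fun t => inner ℂ (ζ t) χ - inner ℂ (ζ a) χ) (a := a) (b := b)
      (fun x hx => ((hd' x hx).continuousAt.sub continuousAt_const).continuousWithinAt)
      (fun x hx => ((hd' x (Set.Ico_subset_Icc_self hx)).sub_const _).hasDerivWithinAt)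
      (B := fun x => K * ‖χ‖ * (primitiveAbs p x - primitiveAbs p a)) (by simp)
      (fun x hx => (hQ x hx).continuousAt.continuousWithinAt)
      (fun x hx => (hQ x (Set.Ico_subset_Icc_self hx)).hasDerivWithinAt)
      (fun x hx => by
        obtain ⟨d, h1, h2⟩ := hd χ x (hS x (Set.Ico_subset_Icc_self hx)).1
          (hS x (Set.Ico_subset_Icc_self hx)).2
        rw [h2.deriv]
        exact h1.trans (le_of_eq (by ring)))
      (Set.right_mem_Icc.2 hab)
    rw [← inner_sub_left, ← hχ, inner_self_eq_norm_sq_to_K] at h1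
    have h2 : ‖χ‖ * ‖χ‖ ≤ K * (primitiveAbs p b - primitiveAbs p a) * ‖χ‖ := by
      simp only [norm_pow, RCLike.norm_ofReal, abs_norm] at h1
      linarith
    rcases (norm_nonneg χ).eq_or_lt with h0 | h0
    · rw [← h0]
      positivity
    · rw [← abs_mul]
      exact (le_of_mul_le_mul_right h2 h0).trans (le_abs_self _)
  have key' : ∀ a b, (a ∈ J ∧ |s| ≤ |a|) → (b ∈ J ∧ |s| ≤ |b|) →
      dist (ζ a) (ζ b) ≤ |K| * |primitiveAbs p a - primitiveAbs p b| := by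
    intro a b ha hb
    rcases le_total a b with h | h
    · rw [dist_comm, dist_eq_norm, abs_sub_comm]
      exact key a b ha hb h
    · rw [dist_eq_norm]
      exact key b a hb ha h
  -- Since `p > 1` the primitive vanishes at infinity, so `ζ` is Cauchy along `l`.
  have hQ : Tendsto (primitiveAbs p) l (𝓝 0) := by
    rw [tendsto_zero_iff_abs_tendsto_zero]
    have h1 := (hJl.tendsto_rpow (q := 1 - p) (by linarith)).div_const (p - 1)
    rw [zero_div] at h1
    refine h1.congr' ?_
    filter_upwards [hJl.eventually_mem s] with t ht
    simp only [Function.comp_apply, primitiveAbs]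
    rw [abs_div, abs_mul_abs_rpow_neg p (hJ0 t ht.1), abs_of_neg (by linarith : 1 - p < 0), neg_sub]
  have := hJl.neBot
  refine CompleteSpace.complete (cauchy_map_iff.2 ⟨this, ?_⟩)
  rw [tendsto_uniformity_iff_dist_tendsto_zero]
  have hlim : Tendsto (fun q : ℝ × ℝ => |K| * |primitiveAbs p q.1 - primitiveAbs p q.2|) (l ×ˢ l)
      (𝓝 0) := by
    have := (((hQ.comp tendsto_fst).sub (hQ.comp tendsto_snd)).abs).const_mul |K|
    simpa [Function.comp_def] using this
  refine squeeze_zero' (Eventually.of_forall fun _ => dist_nonneg) ?_ hlim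
  filter_upwards [(hJl.eventually_mem s).prod_mk (hJl.eventually_mem s)] with q hq
  exact key' q.1 q.2 hq.1 hq.2

/-- A family of linear isometries which converges on a total set converges strongly. -/
theorem exists_clm_of_total {H : Type*} [NormedAddCommGroup H] [InnerProductSpace ℂ H]
    [CompleteSpace H] {l : Filter ℝ} [l.NeBot] {Z : ℝ → H →ₗᵢ[ℂ] H} {D : Set H}
    (hD : ∀ z : H, (∀ a ∈ D, inner ℂ a z = 0) → z = 0)
    (hZ : ∀ a ∈ D, ∃ z, Tendsto (fun t => Z t a) l (𝓝 z)) :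
    ∃ W : H →L[ℂ] H, ∀ ψ, Tendsto (fun t => Z t ψ) l (𝓝 (W ψ)) := by
  let S : Submodule ℂ H :=
    { carrier := {a | ∃ z, Tendsto (fun t => Z t a) l (𝓝 z)}
      add_mem' := by
        rintro a b ⟨z, hz⟩ ⟨w, hw⟩
        exact ⟨z + w, by simpa using hz.add hw⟩
      zero_mem' := ⟨0, by simp⟩
      smul_mem' := by
        rintro c a ⟨z, hz⟩
        exact ⟨c • z, by simpa using hz.const_smul c⟩ }
  have hdense : S.topologicalClosure = ⊤ := by
    rw [Submodule.topologicalClosure_eq_top_iff, Submodule.eq_bot_iff]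
    exact fun z hz => hD z fun a ha => (Submodule.mem_orthogonal _ _).1 hz a (hZ a ha)
  have hall : ∀ ψ, ∃ z, Tendsto (fun t => Z t ψ) l (𝓝 z) := by
    intro ψ
    refine CompleteSpace.complete (Metric.cauchy_iff.2 ⟨inferInstance, fun ε hε => ?_⟩)
    have hψ : ψ ∈ closure (S : Set H) := by
      rw [← Submodule.topologicalClosure_coe, hdense]
      trivial
    obtain ⟨a, ⟨z, hz⟩, ha⟩ := Metric.mem_closure_iff.1 hψ (ε / 3) (by positivity)
    obtain ⟨T, hT, hTd⟩ := (Metric.cauchy_iff.1 hz.cauchy_map).2 (ε / 3) (by positivity)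
    refine ⟨(fun t => Z t ψ) '' ((fun t => Z t a) ⁻¹' T), image_mem_map hT, ?_⟩
    rintro _ ⟨t, ht, rfl⟩ _ ⟨t', ht', rfl⟩
    have h1 := hTd _ ht _ ht'
    have h2 : dist (Z t ψ) (Z t a) < ε / 3 := by rwa [(Z t).dist_map]
    have h3 : dist (Z t' a) (Z t' ψ) < ε / 3 := by rwa [(Z t').dist_map, dist_comm]
    have h4 := dist_triangle4 (Z t ψ) (Z t a) (Z t' a) (Z t' ψ)
    simp only at h1 ⊢
    linarith
  choose W hW using hall
  refine ⟨LinearMap.mkContinuous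
    { toFun := W
      map_add' := fun a b => tendsto_nhds_unique (hW (a + b)) (by simpa using (hW a).add (hW b))
      map_smul' := fun c a => tendsto_nhds_unique (hW (c • a))
        (by simpa using (hW a).const_smul c) } 1 (fun a => ?_), hW⟩
  rw [one_mul]
  exact le_of_tendsto (hW a).norm (Eventually.of_forall fun t => ((Z t).norm_map a).le)

/-- Multiplying `|1 - e^{-iθ}| ≤ 2` by `|1 - e^{-iθ}| ≤ |θ|` gives `|1 - e^{-iθ}|² ≤ 2|θ|`, and `∫
‖x‖²|u|² = ⟨u, v⟩` is estimated by Cauchy–Schwarz. It is what allows the auxiliary quadratic phase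
to be dropped at the end. -/
theorem norm_sub_phase_normSq_sq_le {u v : L2Space n}
    (hv : v =ᵐ[volume] fun x => ((‖x‖ ^ 2 : ℝ) : ℂ) * u x) (c : ℝ) :
    ‖u - phase (c • normSq n) u‖ ^ 2 ≤ 2 * |c| * (‖u‖ * ‖v‖) := by
  have h1 : ∀ θ : ℝ, ‖1 - Complex.exp (-Complex.I * (θ : ℂ))‖ ^ 2 ≤ 2 * |θ| := by
    intro θ
    have h2 : ‖1 - Complex.exp (-Complex.I * (θ : ℂ))‖ ≤ |θ| := by
      have := Real.norm_exp_I_mul_ofReal_sub_one_le (x := -θ)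
      rw [norm_sub_rev, Real.norm_eq_abs, abs_neg] at this
      refine le_trans (le_of_eq ?_) this
      congr 3
      push_cast
      ring
    have h3 : ‖1 - Complex.exp (-Complex.I * (θ : ℂ))‖ ≤ 2 := by
      refine (norm_sub_le _ _).trans ?_
      rw [Complex.norm_exp]
      norm_num
    rw [sq]
    exact mul_le_mul h3 h2 (norm_nonneg _) (by norm_num)
  have h4 : ‖(inner ℂ u v : ℂ)‖ = ∫ x, ‖x‖ ^ 2 * ‖u x‖ ^ 2 := by
    have : (inner ℂ u v : ℂ) = ((∫ x, ‖x‖ ^ 2 * ‖u x‖ ^ 2 : ℝ) : ℂ) := by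
      rw [L2.inner_def, ← integral_complex_ofReal]
      refine integral_congr_ae ?_
      filter_upwards [hv] with x hx
      rw [hx, RCLike.inner_apply, mul_assoc, Complex.mul_conj, Complex.normSq_eq_norm_sq]
      push_cast
      ring
    rw [this, Complex.norm_real, Real.norm_of_nonneg (integral_nonneg fun x => by positivity)]
  have hint : Integrable fun x => ‖x‖ ^ 2 * ‖u x‖ ^ 2 := by
    refine (L2.integrable_inner (𝕜 := ℂ) u v).norm.congr ?_
    filter_upwards [hv] with x hx
    rw [hx, RCLike.inner_apply, norm_mul, norm_mul, Complex.norm_real, RCLike.norm_conj,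
      Real.norm_of_nonneg (by positivity)]
    ring
  calc ‖u - phase (c • normSq n) u‖ ^ 2
      = ∫ x, ‖(u - phase (c • normSq n) u : L2Space n) x‖ ^ 2 := norm_sq_eq_integral_norm_sq _
    _ ≤ ∫ x, 2 * |c| * (‖x‖ ^ 2 * ‖u x‖ ^ 2) := by
      refine integral_mono_ae (integrable_norm_sq _) (hint.const_mul _) ?_
      filter_upwards [Lp.coeFn_sub u (phase (c • normSq n) u), coeFn_phase (c • normSq n) u]
        with x k1 k2
      rw [k1, Pi.sub_apply, k2]
      have k3 := h1 (c * ‖x‖ ^ 2)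
      have k4 : u x - Complex.exp (-Complex.I * (((c • normSq n) x : ℝ) : ℂ)) * u x =
          (1 - Complex.exp (-Complex.I * ((c * ‖x‖ ^ 2 : ℝ) : ℂ))) * u x := by
        simp only [ContinuousMap.coe_smul, Pi.smul_apply, normSq_apply, smul_eq_mul]
        ring
      rw [k4, norm_mul, mul_pow]
      rw [abs_mul, abs_of_nonneg (by positivity : (0 : ℝ) ≤ ‖x‖ ^ 2)] at k3
      calc _ ≤ 2 * (|c| * ‖x‖ ^ 2) * ‖u x‖ ^ 2 := by gcongr
        _ = _ := by ring
    _ = 2 * |c| * ‖(inner ℂ u v : ℂ)‖ := by rw [integral_const_mul, h4]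
    _ ≤ 2 * |c| * (‖u‖ * ‖v‖) := by
      gcongr
      exact norm_inner_le_norm u v

/-- Trades a fast decay rate for a slower one away from zero, so that two error terms can be given a
common rate. -/
theorem rpow_neg_le_mul_rpow_neg {r x p q : ℝ} (hr : 0 < r) (hx : r ≤ x) (hpq : p ≤ q) :
    x ^ (-q) ≤ r ^ (p - q) * x ^ (-p) := by
  have hx0 : 0 < x := hr.trans_le hx
  rw [show -q = (p - q) + -p by ring, Real.rpow_add hx0]
  gcongr ?_ * _
  exact Real.rpow_le_rpow_of_nonpos hr hx (by linarith)

/-! ### The scale of classical trajectories -/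

/-- The coefficient `2π t|t|^{-λ} / (m (1 - 2λ))` in the argument of the Dollard modifier, in
Mathlib's normalization of the Fourier transform. -/
def dollardScale (m lam t : ℝ) : ℝ := t * |t| ^ (-lam) / (m * (1 - 2 * lam)) * (2 * Real.pi)

theorem continuous_dollardScale (m : ℝ) {lam : ℝ} (hlam : lam < 1 / 2) :
    Continuous (dollardScale m lam) :=
  ((continuous_mul_abs_rpow_neg (by linarith)).div_const _).mul_const _

/-- The dilation `|t|^λ` in the reduced Hamiltonian and the factor `2πτ` from the Galilei
transformation combine exactly into the trajectory in the Dollard modifier. -/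
theorem abs_rpow_mul_tau {m lam t : ℝ} (ht : t ≠ 0) :
    |t| ^ lam * (2 * Real.pi * tau m lam t) = dollardScale m lam t := by
  rw [tau, dollardScale]
  have : |t| ^ lam * |t| ^ (-(2 * lam)) = |t| ^ (-lam) := by
    rw [← Real.rpow_add (abs_pos.2 ht)]
    congr 1
    ring
  rw [← this]
  ring

theorem tau_ne_zero {m lam t : ℝ} (hm : 0 < m) (hlam : lam < 1 / 2) (ht : t ≠ 0) :
    tau m lam t ≠ 0 := by
  have : 0 < m * (1 - 2 * lam) := mul_pos hm (by linarith)
  exact div_ne_zero (mul_ne_zero ht (Real.rpow_pos_of_pos (abs_pos.2 ht) _).ne') this.ne'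

theorem abs_tau {m lam t : ℝ} (hm : 0 < m) (hlam : lam < 1 / 2) (ht : t ≠ 0) :
    |tau m lam t| = |t| ^ (1 - 2 * lam) / (m * (1 - 2 * lam)) := by
  rw [tau, abs_div, abs_mul_abs_rpow_neg _ ht, abs_of_pos (mul_pos hm (by linarith))]

theorem abs_dollardScale {m lam t : ℝ} (hm : 0 < m) (hlam : lam < 1 / 2) (ht : t ≠ 0) :
    |dollardScale m lam t| = |t| ^ (1 - lam) * (2 * Real.pi / (m * (1 - 2 * lam))) := by
  rw [dollardScale, abs_mul, abs_div, abs_mul_abs_rpow_neg _ ht,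
    abs_of_pos (mul_pos hm (by linarith : 0 < 1 - 2 * lam)),
    abs_of_pos (by positivity : 0 < 2 * Real.pi)]
  ring

/-- The free evolution of the localized asymptotic profile intertwines the potential with its
value along classical trajectories. -/
theorem interaction_phase_fourierL_symm {V : ℝ → RSpace n → ℝ}
    (hV : Continuous fun q : ℝ × RSpace n => V q.1 q.2) {C : ℝ} (hC : ∀ t x, |V t x| ≤ C)
    {m lam t : ℝ} (hm : 0 < m) (hlam : lam < 1 / 2) (ht : t ≠ 0) (f : L2Space n) :
    interaction hV hC m lam t (phase ((2 * tau m lam t)⁻¹ • normSq n) ((fourierL n).symm f)) =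
      phase ((2 * tau m lam t)⁻¹ • normSq n)
        ((fourierL n).symm (mulL (potential hV hC t (dollardScale m lam t)) f)) := by
  have h1 : ∀ f : L2Space n, freeProp n m lam t
      (phase ((2 * tau m lam t)⁻¹ • normSq n) ((fourierL n).symm f)) =
        galilei (tau m lam t) f := fun f => rfl
  rw [interaction_apply, h1, mulL_galilei (tau_ne_zero hm hlam ht), potential_comp_smul,
    abs_rpow_mul_tau ht, ← h1, LinearIsometryEquiv.symm_apply_apply]

end

/-! ### Convergence on localized test vectors -/

noncomputable section

open scoped BoundedContinuousFunction ComplexConjugate ContDiff FourierTransform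

variable {n : ℕ}

section Convergence

variable {VS VD : ℝ → RSpace n → ℝ} (hS : Continuous fun q : ℝ × RSpace n => VS q.1 q.2)
  (hD : Continuous fun q : ℝ × RSpace n => VD q.1 q.2) {CS CD : ℝ} (hCS : ∀ t x, |VS t x| ≤ CS)
  (hCD : ∀ t x, |VD t x| ≤ CD) {m lam : ℝ}

theorem potential_add
    (hV : Continuous fun q : ℝ × RSpace n => (fun t x => VS t x + VD t x : ℝ → RSpace n → ℝ) q.1 q.2)
    {C : ℝ} (hC : ∀ t x, |(fun t x => VS t x + VD t x : ℝ → RSpace n → ℝ) t x| ≤ C) (t c : ℝ) :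
    potential hV hC t c = potential hS hCS t c + potential hD hCD t c := by
  ext x
  simp

/-- The derivative of the approximate solution in the interaction picture. -/
theorem hasDerivAt_profile (hm : 0 < m) (hlam : lam < 1 / 2) {c : ℝ → ℝ} (hc : Continuous c)
    (s : ℝ) {t : ℝ} (ht : t ≠ 0) (κ : L2Space n) {v : L2Space n}
    (hv : v =ᵐ[volume] fun x => ((‖x‖ ^ 2 : ℝ) : ℂ) *
      (fourierL n).symm (phase (dollardPhase hD hc s t) κ) x) :
    HasDerivAt (fun t => phase ((2 * tau m lam t)⁻¹ • normSq n)
        ((fourierL n).symm (phase (dollardPhase hD hc s t) κ)))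
      ((-(2 * (1 / (m * |t| ^ (2 * lam)))) / (2 * tau m lam t) ^ 2) •
          (-Complex.I • phase ((2 * tau m lam t)⁻¹ • normSq n) v) +
        phase ((2 * tau m lam t)⁻¹ • normSq n) ((fourierL n).symm (-Complex.I •
          mulL (potential hD hCD t (c t)) (phase (dollardPhase hD hc s t) κ)))) t := by
  have hτ := tau_ne_zero hm hlam ht
  have h1 : HasDerivAt (fun t => (2 * tau m lam t)⁻¹)
      (-(2 * (1 / (m * |t| ^ (2 * lam)))) / (2 * tau m lam t) ^ 2) t :=
    ((hasDerivAt_tau hm hlam ht).const_mul 2).fun_inv (mul_ne_zero two_ne_zero hτ)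
  have h2 := ((fourierL n).symm.toContinuousLinearEquiv.toContinuousLinearMap.restrictScalars
    ℝ).hasFDerivAt.comp_hasDerivAt t (hasDerivAt_phase_dollardPhase hD hCD hc s t κ)
  refine hasDerivAt_apply_of_strong (C := 1) (B := fun t =>
    (phase ((2 * tau m lam t)⁻¹ • normSq n)).toContinuousLinearEquiv.toContinuousLinearMap)
    (fun t ψ => by simp) (fun ψ => ?_) h2 ((hasDerivAt_phase_normSq hv _).scomp t h1)
  have h3 : Continuous fun c : ℝ => phase (c • normSq n) ψ :=
    continuous_phase (fun x => by
      simp only [ContinuousMap.coe_smul, Pi.smul_apply, smul_eq_mul]; fun_prop) ψ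
  exact h3.continuousAt.comp h1.continuousAt

end Convergence

/-- The analytic core. Cook's method applies to the vector with the quadratic phase inserted, whose
derivative has only a second-moment term and a short-range term; then the phase is removed. Both
steps use `δ > λ + 1/2`. -/
theorem exists_limit_of_test {VS VD : ℝ → RSpace n → ℝ}
    (hS : Continuous fun q : ℝ × RSpace n => VS q.1 q.2)
    (hD : Continuous fun q : ℝ × RSpace n => VD q.1 q.2) {CS CD : ℝ}
    (hCS : ∀ t x, |VS t x| ≤ CS) (hCD : ∀ t x, |VD t x| ≤ CD) {m lam : ℝ} (hn : 1 ≤ n) (hm : 0 < m) (h0 : 0 ≤ lam) (hlam : lam < 1 / 2)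
    {J : Set ℝ} {l : Filter ℝ} (hJl : IsHalfLine J l)
    {U : ℝ → ℝ → (L2Space n ≃ₗᵢ[ℂ] L2Space n)}
    (hU : IsPropagator (reducedHamiltonian m lam fun t x => VS t x + VD t x) J U) {s : ℝ}
    (hs : s ∈ J) {κ : L2Space n} {δ : ℝ} (hδ : lam + 1 / 2 < δ) {K : ℝ}
    (hmom : ∀ t ∈ J, |s| ≤ |t| → ∃ v : L2Space n,
      v =ᵐ[volume] (fun x => ((‖x‖ ^ 2 : ℝ) : ℂ) * (fourierL n).symm (phase
        (dollardPhase hD (continuous_dollardScale m hlam) s t) κ) x) ∧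
      ‖v‖ ≤ K * (|t| ^ (1 - δ)) ^ 2) {K' p : ℝ} (hp : 1 < p)
    (hdec : ∀ t ∈ J, |s| ≤ |t| → ∀ᵐ x, κ x ≠ 0 →
      |VS t (dollardScale m lam t • x)| ≤ K' * |t| ^ (-p)) :
    ∃ z, Tendsto (fun t => (U t s).symm (freeProp n m lam t ((fourierL n).symm
      (phase (dollardPhase hD (continuous_dollardScale m hlam) s t) κ)))) l (𝓝 z) := by
  obtain ⟨hJo, hJc, hJ0⟩ := halfLine_properties hJl.eq_or
  have hV : Continuous fun q : ℝ × RSpace n =>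
      (fun t x => VS t x + VD t x : ℝ → RSpace n → ℝ) q.1 q.2 := hS.add hD
  have hC : ∀ t x, |(fun t x => VS t x + VD t x : ℝ → RSpace n → ℝ) t x| ≤ CS + CD := fun t x =>
    (abs_add_le _ _).trans (add_le_add (hCS t x) (hCD t x))
  set hc := continuous_dollardScale m hlam
  set f : ℝ → L2Space n := fun t => phase (dollardPhase hD hc s t) κ with hf
  set P : ℝ → (L2Space n ≃ₗᵢ[ℂ] L2Space n) := fun t => phase ((2 * tau m lam t)⁻¹ • normSq n)
    with hP
  set u : ℝ → L2Space n := fun t => (fourierL n).symm (f t) with hu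
  set ζ : ℝ → L2Space n := fun t => (U t s).symm (freeProp n m lam t (P t (u t))) with hζ
  have hs0 : 0 < |s| := abs_pos.2 (hJ0 s hs)
  have hκn : ∀ t, ‖f t‖ = ‖κ‖ := fun t => LinearIsometryEquiv.norm_map _ _
  set N := ‖κ‖ with hN
  have hζlim : ∃ z, Tendsto ζ l (𝓝 z) := by
    -- The constant in `|d/dt (2τ)⁻¹| = τ'/(2τ²) = B |t|^{2λ-2}`.
    set B := m * (1 - 2 * lam) ^ 2 / 2 with hB
    have hBpos : 0 < B := by
      have : 0 < 1 - 2 * lam := by linarith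
      positivity
    set q := 2 * δ - 2 * lam with hq
    -- `q` is the rate of the second-moment term, `|t|^{2λ-2} |t|^{2(1-δ)} = |t|^{-q}`, and `p` that
    -- of the short-range term; `q > 1` is the condition on `δ`.
    set p' := min q p with hp'
    refine exists_limit_of_cook hJl (s := s) (p := p')
      (K := B * |K| * |s| ^ (p' - q) + |K'| * N * |s| ^ (p' - p))
      (lt_min (by linarith) hp) fun χ t ht hst => ?_
    obtain ⟨v, hv, hvn⟩ := hmom t ht hst
    have ht0 := abs_pos.2 (hJ0 t ht)
    have hη := hasDerivAt_profile hD hCD hm hlam hc s (hJ0 t ht) κ hv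
    have hw := hU.hasDerivAt_interaction hV hC hn hm h0 hlam hJo hJc hJ0 hs χ ht
    -- `U(t,s)*` is moved onto `χ`: then both factors are differentiable in norm, one as an explicit
    -- profile and the other by the interaction equation.
    have hinner : ∀ t, inner ℂ (ζ t) χ =
        inner ℂ (P t (u t)) ((freeProp n m lam t).symm (U t s χ)) := fun t => by
      rw [← inner_freeProp_left, ← LinearIsometryEquiv.inner_map_map (U t s),
        LinearIsometryEquiv.apply_symm_apply]
    simp_rw [hinner]
    set w := (freeProp n m lam t).symm (U t s χ) with hwdef
    have hwn : ‖w‖ = ‖χ‖ := by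
      rw [hwdef, LinearIsometryEquiv.norm_map, LinearIsometryEquiv.norm_map]
    set r : ℝ := -(2 * (1 / (m * |t| ^ (2 * lam)))) / (2 * tau m lam t) ^ 2 with hr
    -- What survives of the derivative: the `V_D` part of the interaction cancels the derivative of
    -- the Dollard phase.
    set g : L2Space n := r • (-Complex.I • P t v) +
      Complex.I • P t ((fourierL n).symm
        (mulL (potential hS hCS t (dollardScale m lam t)) (f t))) with hg
    refine ⟨inner ℂ g w, ?_, ?_⟩
    · refine (norm_inner_le_norm g w).trans ?_
      rw [hwn]
      gcongr
      have hr' : |r| = B * |t| ^ (2 * lam - 2) := by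
        have e1 : |r| = 2 * (1 / (m * |t| ^ (2 * lam))) / (4 * |tau m lam t| ^ 2) := by
          have e0 : 0 ≤ 2 * (1 / (m * |t| ^ (2 * lam))) := by positivity
          rw [hr, abs_div, abs_neg, abs_of_nonneg e0, abs_pow, abs_mul, abs_two, mul_pow]
          norm_num
        have e2 : |t| ^ (1 - 2 * lam) = |t| / |t| ^ (2 * lam) := by
          rw [Real.rpow_sub ht0, Real.rpow_one]
        have e3 : |t| ^ (2 * lam - 2) = |t| ^ (2 * lam) / |t| ^ 2 := by
          rw [Real.rpow_sub ht0, Real.rpow_two]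
        rw [e1, abs_tau hm hlam (hJ0 t ht), e2, e3, hB]
        have := Real.rpow_pos_of_pos ht0 (2 * lam)
        have : 0 < 1 - 2 * lam := by linarith
        field_simp
        norm_num
      have n1 : ‖r • (-Complex.I • P t v)‖ ≤ B * |K| * (|s| ^ (p' - q) * |t| ^ (-p')) := by
        rw [norm_smul, norm_smul, norm_neg, Complex.norm_I, one_mul, LinearIsometryEquiv.norm_map,
          Real.norm_eq_abs, hr']
        have e4 : |t| ^ (2 * lam - 2) * (|t| ^ (1 - δ)) ^ 2 = |t| ^ (-q) := by
          rw [← Real.rpow_mul_natCast ht0.le, ← Real.rpow_add ht0]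
          congr 1
          rw [hq]
          push_cast
          ring
        calc B * |t| ^ (2 * lam - 2) * ‖v‖
            ≤ B * |t| ^ (2 * lam - 2) * (|K| * (|t| ^ (1 - δ)) ^ 2) := by
              gcongr
              refine hvn.trans ?_
              gcongr
              exact le_abs_self K
          _ = B * |K| * |t| ^ (-q) := by rw [← e4]; ring
          _ ≤ _ := by
              gcongr
              exact rpow_neg_le_mul_rpow_neg hs0 hst (min_le_left _ _)
      have n2 : ‖Complex.I • P t ((fourierL n).symm
          (mulL (potential hS hCS t (dollardScale m lam t)) (f t)))‖ ≤
          |K'| * N * (|s| ^ (p' - p) * |t| ^ (-p')) := by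
        rw [norm_smul, Complex.norm_I, one_mul, LinearIsometryEquiv.norm_map,
          LinearIsometryEquiv.norm_map]
        have e5 : ‖mulL (potential hS hCS t (dollardScale m lam t)) (f t)‖ ≤
            (|K'| * |t| ^ (-p)) * ‖f t‖ := by
          refine norm_mulL_le_of_ae ?_
          filter_upwards [coeFn_phase (dollardPhase hD hc s t) κ, hdec t ht hst] with x k1 k2
          by_cases hx : κ x = 0
          · have : f t x = 0 := by rw [hf, k1, hx, mul_zero]
            rw [this]
            simp
          · rw [norm_mul, potential_apply, Complex.norm_real, Real.norm_eq_abs]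
            gcongr
            refine (k2 hx).trans ?_
            gcongr
            exact le_abs_self K'
        refine e5.trans ?_
        rw [hκn, mul_right_comm]
        gcongr
        exact rpow_neg_le_mul_rpow_neg hs0 hst (min_le_right _ _)
      refine (norm_add_le _ _).trans ((add_le_add n1 n2).trans (le_of_eq ?_))
      ring
    · refine (hη.inner ℂ hw).congr_deriv ?_
      have hA := interaction_phase_fourierL_symm hV hC hm hlam (hJ0 t ht) (f t)
      rw [potential_add hS hD hCS hCD hV hC, mulL_add] at hA
      have e1 : inner ℂ (P t (u t)) (-Complex.I • interaction hV hC m lam t w) =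
          inner ℂ (Complex.I • interaction hV hC m lam t (P t (u t))) w := by
        rw [inner_smul_right, inner_smul_left, Complex.conj_I, interaction_symmetric]
      refine (congrArg (· + _) e1).trans ?_
      rw [← inner_add_left]
      congr 1
      rw [show interaction hV hC m lam t (P t (u t)) = _ from hA, hg]
      simp only [map_add, map_smul, smul_add, neg_smul, smul_neg, map_neg]
      abel
  obtain ⟨z, hz⟩ := hζlim
  refine ⟨z, ?_⟩
  -- Removing the quadratic phase: the squared error is at most a constant times `|t|^{-(1-2λ)}
  -- |t|^{2(1-δ)}`, whose exponent `1 + 2λ - 2δ` is negative.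
  have hdiff : Tendsto (fun t => (U t s).symm (freeProp n m lam t (u t)) - ζ t) l (𝓝 0) := by
    have h1 : Tendsto (fun t => √((m * (1 - 2 * lam)) * N * |K| * |t| ^ (1 + 2 * lam - 2 * δ))) l
        (𝓝 0) := by
      have := ((hJl.tendsto_rpow (q := 1 + 2 * lam - 2 * δ) (by linarith)).const_mul
        ((m * (1 - 2 * lam)) * N * |K|)).sqrt
      simpa using this
    refine squeeze_zero_norm' ?_ h1
    filter_upwards [hJl.eventually_mem s] with t ht
    obtain ⟨v, hv, hvn⟩ := hmom t ht.1 ht.2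
    have ht0 := abs_pos.2 (hJ0 t ht.1)
    rw [hζ, ← map_sub, ← map_sub, LinearIsometryEquiv.norm_map, LinearIsometryEquiv.norm_map]
    apply Real.le_sqrt_of_sq_le
    refine (norm_sub_phase_normSq_sq_le hv _).trans ?_
    have e1 : ‖(fourierL n).symm (phase (dollardPhase hD hc s t) κ)‖ = N := by
      rw [LinearIsometryEquiv.norm_map, LinearIsometryEquiv.norm_map]
    rw [e1, abs_inv, abs_mul, abs_two, abs_tau hm hlam (hJ0 t ht.1)]
    have e2 : |t| ^ (1 + 2 * lam - 2 * δ) = (|t| ^ (1 - 2 * lam))⁻¹ * (|t| ^ (1 - δ)) ^ 2 := by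
      rw [← Real.rpow_mul_natCast ht0.le, ← Real.rpow_neg ht0.le, ← Real.rpow_add ht0]
      congr 1
      push_cast
      ring
    have hl : 0 < 1 - 2 * lam := by linarith
    have hpos := Real.rpow_pos_of_pos ht0 (1 - 2 * lam)
    calc 2 * (2 * (|t| ^ (1 - 2 * lam) / (m * (1 - 2 * lam))))⁻¹ * (N * ‖v‖)
        ≤ 2 * (2 * (|t| ^ (1 - 2 * lam) / (m * (1 - 2 * lam))))⁻¹ *
          (N * (|K| * (|t| ^ (1 - δ)) ^ 2)) := by
          gcongr
          refine hvn.trans ?_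
          gcongr
          exact le_abs_self K
      _ = _ := by
          rw [e2]
          field_simp
  have := hdiff.add hz
  simpa using this

end

/-! ### Decay of the potentials along trajectories and assembly -/

noncomputable section

open scoped BoundedContinuousFunction ComplexConjugate ContDiff FourierTransform

variable {n : ℕ}

theorem coeFn_sum_L2 {ι : Type*} (S : Finset ι) (v : ι → L2Space n) :
    ((∑ i ∈ S, v i : L2Space n) : RSpace n → ℂ) =ᵐ[volume] fun x => ∑ i ∈ S, v i x := by
  classical
  induction S using Finset.induction_on with
  | empty => exact Lp.coeFn_zero ℂ 2 (volume : Measure (RSpace n))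
  | insert a S ha ih =>
    rw [Finset.sum_insert ha]
    filter_upwards [Lp.coeFn_add (v a) (∑ i ∈ S, v i), ih] with x h1 h2
    rw [h1, Pi.add_apply, h2, Finset.sum_insert ha]

theorem exists_second_moment_of_basis {w : L2Space n} {K : Fin n → ℝ} {b : ℝ}
    (h : ∀ i, ∃ v : L2Space n, v =ᵐ[volume] (fun x =>
      ((inner ℝ x (EuclideanSpace.basisFun (Fin n) ℝ i) ^ 2 : ℝ) : ℂ) * w x) ∧ ‖v‖ ≤ K i * b) :
    ∃ v : L2Space n, v =ᵐ[volume] (fun x => ((‖x‖ ^ 2 : ℝ) : ℂ) * w x) ∧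
      ‖v‖ ≤ (∑ i, K i) * b := by
  choose v hv hvn using h
  refine ⟨∑ i, v i, ?_, ?_⟩
  · filter_upwards [coeFn_sum_L2 Finset.univ v, ae_all_iff.2 hv] with x h1 h2
    rw [h1, ← (EuclideanSpace.basisFun (Fin n) ℝ).sum_sq_inner_left x, Complex.ofReal_sum,
      Finset.sum_mul]
    exact Finset.sum_congr rfl fun i _ => h2 i
  · rw [Finset.sum_mul]
    exact (norm_sum_le _ _).trans (Finset.sum_le_sum fun i _ => hvn i)

/-- On `‖x‖ ≥ r` one has `1 + ‖cx‖ ≥ |c| r`; the `j` powers of `c` from the chain rule are paid for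
by the `j` extra orders of decay of the derivative. -/
theorem pow_mul_abs_le_of_decay {ρ ρ' r C c y : ℝ} {j : ℕ} {x : RSpace n} (hρ' : 0 < ρ')
    (hρ : ρ' ≤ ρ) (hr : 0 < r) (hx : r ≤ ‖x‖) (hC : 0 ≤ C) (hc : c ≠ 0)
    (hy : |y| ≤ C * (1 + ‖c • x‖) ^ (-ρ - j)) :
    |c| ^ j * |y| ≤ C * r ^ (-(ρ' + j)) * |c| ^ (-ρ') := by
  have hc0 := abs_pos.2 hc
  have hbase : |c| * r ≤ 1 + ‖c • x‖ := by
    rw [norm_smul, Real.norm_eq_abs]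
    have := mul_le_mul_of_nonneg_left hx hc0.le
    linarith
  have h1 : (1 + ‖c • x‖) ^ (-ρ - j) ≤ (|c| * r) ^ (-(ρ' + j)) :=
    (Real.rpow_le_rpow_of_exponent_le (by simp) (by linarith)).trans
      (Real.rpow_le_rpow_of_nonpos (by positivity) hbase
        (neg_nonpos.2 (by positivity)))
  have h2 : |c| ^ j * (|c| * r) ^ (-(ρ' + j)) = r ^ (-(ρ' + j)) * |c| ^ (-ρ') := by
    rw [Real.mul_rpow hc0.le hr.le, ← Real.rpow_natCast, ← mul_assoc, ← Real.rpow_add hc0,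
      mul_comm]
    congr 2
    ring
  calc |c| ^ j * |y| ≤ |c| ^ j * (C * (|c| * r) ^ (-(ρ' + j))) := by
        gcongr
        exact hy.trans (mul_le_mul_of_nonneg_left h1 hC)
    _ = C * (|c| ^ j * (|c| * r) ^ (-(ρ' + j))) := by ring
    _ = _ := by rw [h2, mul_assoc]

theorem IsDollardLongRange.continuous {lam : ℝ} {V : ℝ → RSpace n → ℝ}
    (h : IsDollardLongRange lam V) : Continuous fun q : ℝ × RSpace n => V q.1 q.2 :=
  (ContinuousMultilinearMap.apply ℝ (fun _ : Fin 0 => RSpace n) ℝ 0).continuous.comp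
    (h.2.1 0 (by norm_num))

theorem IsDollardLongRange.hasLineDerivs {lam : ℝ} {V : ℝ → RSpace n → ℝ}
    (h : IsDollardLongRange lam V) (e : RSpace n) :
    HasLineDerivs e V (fun s x => iteratedFDeriv ℝ 1 (V s) x fun _ => e)
      (fun s x => iteratedFDeriv ℝ 2 (V s) x fun _ => e) where
  cont := h.continuous
  cont₁ := (ContinuousMultilinearMap.apply ℝ (fun _ : Fin 1 => RSpace n) ℝ
    fun _ => e).continuous.comp (h.2.1 1 (by norm_num))
  cont₂ := (ContinuousMultilinearMap.apply ℝ (fun _ : Fin 2 => RSpace n) ℝ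
    fun _ => e).continuous.comp (h.2.1 2 le_rfl)
  deriv₁ s x r := by
    have h1 : HasDerivAt (fun r : ℝ => x + r • e) e r := by
      simpa using ((hasDerivAt_id r).smul_const e).const_add x
    rw [iteratedFDeriv_one_apply]
    exact ((h.1 s).differentiable (by norm_num) (x + r • e)).hasFDerivAt.comp_hasDerivAt r h1
  deriv₂ s x r := by
    have h1 : HasDerivAt (fun r : ℝ => x + r • e) e r := by
      simpa using ((hasDerivAt_id r).smul_const e).const_add x
    simp only [iteratedFDeriv_one_apply, iteratedFDeriv_two_apply]
    have h2 : ContDiff ℝ 1 (fderiv ℝ (V s)) := (h.1 s).fderiv_right (by norm_num)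
    have h3 := (h2.differentiable (by norm_num) (x + r • e)).hasFDerivAt.comp_hasDerivAt r h1
    simpa using h3.clm_apply (hasDerivAt_const r e)

theorem abs_iteratedFDeriv_apply_le {f : RSpace n → ℝ} {x e : RSpace n} (he : ‖e‖ = 1) (j : ℕ) :
    |iteratedFDeriv ℝ j f x fun _ => e| ≤ ‖iteratedFDeriv ℝ j f x‖ := by
  simpa [he] using (iteratedFDeriv ℝ j f x).le_opNorm fun _ => e

theorem IsDollardLongRange.bounded {lam : ℝ} (h0 : 0 ≤ lam) (hlam : lam < 1 / 2)
    {V : ℝ → RSpace n → ℝ} (h : IsDollardLongRange lam V) : ∃ C, ∀ t x, |V t x| ≤ C := by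
  obtain ⟨ρ, h1, _, h3⟩ := h.2.2
  obtain ⟨C, hC, hb⟩ := h3 0 (by norm_num)
  have hρ : 0 < ρ := lt_trans (div_pos (by linarith) (by linarith)) h1
  refine ⟨C, fun t x => ?_⟩
  have := hb t x
  rw [norm_iteratedFDeriv_zero, Real.norm_eq_abs] at this
  refine this.trans (mul_le_of_le_one_right hC.le ?_)
  exact Real.rpow_le_one_of_one_le_of_nonpos (by simp) (by simp [hρ.le])

theorem IsShortRange.bounded {lam : ℝ} (hlam : lam < 1 / 2)
    {V : ℝ → RSpace n → ℝ} (h : IsShortRange lam V) : ∃ C, ∀ t x, |V t x| ≤ C := by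
  obtain ⟨ρ, h1, C, hC, hb⟩ := h.2
  have hρ : 0 < ρ := lt_trans (div_pos one_pos (by linarith)) h1
  refine ⟨C, fun t x => (hb t x).trans (mul_le_of_le_one_right hC.le ?_)⟩
  exact Real.rpow_le_one_of_one_le_of_nonpos (by simp) (by linarith)

theorem dollardScale_ne_zero {m lam t : ℝ} (hm : 0 < m) (hlam : lam < 1 / 2) (ht : t ≠ 0) :
    dollardScale m lam t ≠ 0 := by
  rw [← abs_pos, abs_dollardScale hm hlam ht]
  have : 0 < 1 - 2 * lam := by linarith
  have := abs_pos.2 ht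
  positivity

theorem abs_dollardScale_rpow_neg {m lam t : ℝ} (hm : 0 < m) (hlam : lam < 1 / 2) (ht : t ≠ 0)
    (ρ : ℝ) : |dollardScale m lam t| ^ (-ρ) =
      (2 * Real.pi / (m * (1 - 2 * lam))) ^ (-ρ) * |t| ^ (-((1 - lam) * ρ)) := by
  have : 0 < 1 - 2 * lam := by linarith
  rw [abs_dollardScale hm hlam ht, Real.mul_rpow (by positivity) (by positivity),
    ← Real.rpow_mul (abs_nonneg t), mul_comm, mul_neg]

theorem IsDollardLongRange.exists_second_moment {m lam : ℝ} (hm : 0 < m) (h0 : 0 ≤ lam)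
    (hlam : lam < 1 / 2) {V : ℝ → RSpace n → ℝ} (h : IsDollardLongRange lam V) {J : Set ℝ}
    (hJ : J = Set.Ioi 0 ∨ J = Set.Iio 0) {s : ℝ} (hs : s ∈ J) {κ : 𝓢(RSpace n, ℂ)}
    (hκ : HasCompactSupport κ) (hκ0 : tsupport κ ⊆ {0}ᶜ) :
    ∃ δ, lam + 1 / 2 < δ ∧ ∃ K : ℝ, ∀ t ∈ J, |s| ≤ |t| → ∃ v : L2Space n,
      v =ᵐ[volume] (fun x => ((‖x‖ ^ 2 : ℝ) : ℂ) * (fourierL n).symm (phase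
        (dollardPhase h.continuous (continuous_dollardScale m hlam) s t) (κ.toLp 2)) x) ∧
      ‖v‖ ≤ K * (|t| ^ (1 - δ)) ^ 2 := by
  obtain ⟨_, _, hJ0⟩ := halfLine_properties hJ
  obtain ⟨ρ, h1, h2, h3⟩ := h.2.2
  obtain ⟨C₁, hC₁, hb₁⟩ := h3 1 (by norm_num)
  obtain ⟨C₂, hC₂, hb₂⟩ := h3 2 le_rfl
  have hl : 0 < 1 - lam := by linarith
  -- The exponent is lowered strictly so that `δ = (1-λ)ρ' < 1` even at the endpoint `ρ = 1/(1-λ)`,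
  -- where integrating `|t|^{-δ}` would give a logarithm.
  obtain ⟨ρ', h4, h5⟩ := exists_between h1
  have hρ' : 0 < ρ' := lt_trans (div_pos (by linarith) (by linarith)) h4
  have hδ1 : (1 - lam) * ρ' < 1 := by
    have := h5.trans_le h2
    rw [lt_div_iff₀ hl] at this
    linarith
  have hδ2 : lam + 1 / 2 < (1 - lam) * ρ' := by
    rw [div_lt_iff₀ (by linarith)] at h4
    linarith
  set b := (2 * Real.pi / (m * (1 - 2 * lam))) ^ (-ρ') with hb
  have hb0 : 0 ≤ b := by
    have : 0 < 1 - 2 * lam := by linarith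
    positivity
  have hdir : ∀ i : Fin n, ∃ K : ℝ, ∀ t ∈ J, |s| ≤ |t| → ∃ v : L2Space n,
      v =ᵐ[volume] (fun x =>
        ((inner ℝ x (EuclideanSpace.basisFun (Fin n) ℝ i) ^ 2 : ℝ) : ℂ) * (fourierL n).symm (phase
        (dollardPhase h.continuous (continuous_dollardScale m hlam) s t) (κ.toLp 2)) x) ∧
      ‖v‖ ≤ K * (|t| ^ (1 - (1 - lam) * ρ')) ^ 2 := by
    intro i
    have he : ‖EuclideanSpace.basisFun (Fin n) ℝ i‖ = 1 :=
      (EuclideanSpace.basisFun (Fin n) ℝ).norm_eq_one i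
    refine exists_second_moment_dollard hJ he
      (h.hasLineDerivs _) (continuous_dollardScale m hlam) hδ1
      (A := fun r => (C₁ * r ^ (-(ρ' + (1 : ℕ))) + C₂ * r ^ (-(ρ' + (2 : ℕ)))) * b)
      (fun r hr t ht x hx => ?_) (fun r hr t ht x hx => ?_) hs hκ hκ0
    · have hc := dollardScale_ne_zero hm hlam (hJ0 t ht)
      have := pow_mul_abs_le_of_decay (j := 1) hρ' h5.le hr hx hC₁.le hc
        ((abs_iteratedFDeriv_apply_le he 1).trans (hb₁ t _))
      rw [abs_dollardScale_rpow_neg hm hlam (hJ0 t ht), ← hb, ← mul_assoc] at this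
      rw [abs_mul, ← pow_one |dollardScale m lam t|]
      refine this.trans ?_
      gcongr
      exact le_add_of_nonneg_right (by positivity)
    · have hc := dollardScale_ne_zero hm hlam (hJ0 t ht)
      have := pow_mul_abs_le_of_decay (j := 2) hρ' h5.le hr hx hC₂.le hc
        ((abs_iteratedFDeriv_apply_le he 2).trans (hb₂ t _))
      rw [abs_dollardScale_rpow_neg hm hlam (hJ0 t ht), ← hb, ← mul_assoc] at this
      rw [abs_mul, abs_mul, ← mul_assoc, ← pow_two]
      refine this.trans ?_
      gcongr
      exact le_add_of_nonneg_left (by positivity)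
  choose K hK using hdir
  exact ⟨(1 - lam) * ρ', hδ2, ∑ i, K i, fun t ht hst =>
    exists_second_moment_of_basis fun i => hK i t ht hst⟩

/-- Along `x ↦ c(t)x`, with `|c(t)|` proportional to `|t|^{1-λ}`, the decay in space becomes decay
in time at rate `p = (1-λ)ρ`, and `p > 1` is exactly the short-range condition. -/
theorem IsShortRange.exists_decay {m lam : ℝ} (hm : 0 < m) (hlam : lam < 1 / 2)
    {V : ℝ → RSpace n → ℝ} (h : IsShortRange lam V) {κ : RSpace n → ℂ}
    (hκ0 : tsupport κ ⊆ {0}ᶜ) : ∃ p : ℝ, 1 < p ∧ ∃ K : ℝ, ∀ t ≠ 0, ∀ x, κ x ≠ 0 →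
      |V t (dollardScale m lam t • x)| ≤ K * |t| ^ (-p) := by
  obtain ⟨ρ, h1, C, hC, hb⟩ := h.2
  have hl : 0 < 1 - lam := by linarith
  have hρ : 0 < ρ := lt_trans (div_pos one_pos hl) h1
  obtain ⟨r, hr, hball⟩ := Metric.mem_nhds_iff.1
    ((isClosed_tsupport κ).isOpen_compl.mem_nhds fun h0 => hκ0 h0 rfl)
  refine ⟨(1 - lam) * ρ, ?_, C * r ^ (-(ρ + (0 : ℕ))) *
    (2 * Real.pi / (m * (1 - 2 * lam))) ^ (-ρ), fun t ht x hx => ?_⟩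
  · rw [div_lt_iff₀ hl] at h1
    linarith
  · have hrx : r ≤ ‖x‖ := by
      by_contra! hlt
      exact hball (by simpa using hlt) (subset_tsupport κ hx)
    have := pow_mul_abs_le_of_decay (j := 0) hρ le_rfl hr hrx hC.le
      (dollardScale_ne_zero hm hlam ht) (by simpa using hb t (dollardScale m lam t • x))
    rwa [pow_zero, one_mul, abs_dollardScale_rpow_neg hm hlam ht, ← mul_assoc] at this

theorem dollardModifier_eq {m lam : ℝ} (hlam : lam < 1 / 2) {V : ℝ → RSpace n → ℝ}
    (hV : Continuous fun q : ℝ × RSpace n => V q.1 q.2) (s t : ℝ) (ψ : L2Space n) :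
    dollardModifier m lam V s t ψ = (fourierL n).symm
      (phase (dollardPhase hV (continuous_dollardScale m hlam) s t) (fourierL n ψ)) := by
  rw [dollardModifier, momentumPhase, ← phaseMul_eq_phase]
  simp only [smul_smul]
  rfl

theorem dollardModifier_zero (m lam s t : ℝ) (ψ : L2Space n) :
    dollardModifier m lam (fun _ _ => 0) s t ψ = ψ := by
  have h : (fun _ => 0 : RSpace n → ℝ) = ((0 : C(RSpace n, ℝ)) : RSpace n → ℝ) := rfl
  simp only [dollardModifier, momentumPhase, intervalIntegral.integral_zero]
  rw [h, phaseMul_eq_phase, phase_zero, LinearIsometryEquiv.symm_apply_apply]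

/-- The endpoint `ρ = 1/(1-λ)` serves, being admissible since `λ < 1/2`. With `V_D = 0` the modified
statement contains the short-range one. -/
theorem isDollardLongRange_zero {lam : ℝ} (hlam : lam < 1 / 2) :
    IsDollardLongRange (n := n) lam fun _ _ => 0 := by
  have hl : 0 < 1 - lam := by linarith
  refine ⟨fun _ => contDiff_const, fun j _ => ?_, 1 / (1 - lam), ?_, le_rfl, fun j _ =>
    ⟨1, one_pos, fun t x => ?_⟩⟩
  · simp [iteratedFDeriv_fun_zero, continuous_const]
  · rw [div_lt_div_iff₀ (by linarith) hl]
    nlinarith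
  · simp only [iteratedFDeriv_fun_zero, Pi.zero_apply, norm_zero]
    positivity

/-- Both operators are Fourier multipliers, so the free evolution up to the base time cancels. -/
theorem freeProp_symm_dollardModifier {m lam : ℝ} (hlam : lam < 1 / 2) {V : ℝ → RSpace n → ℝ}
    (hV : Continuous fun q : ℝ × RSpace n => V q.1 q.2) (s t : ℝ) (f : L2Space n) :
    (freeProp n m lam s).symm
        (dollardModifier m lam V s t (freeProp n m lam s ((fourierL n).symm f))) =
      (fourierL n).symm (phase (dollardPhase hV (continuous_dollardScale m hlam) s t) f) := by
  rw [LinearIsometryEquiv.symm_apply_eq, dollardModifier_eq hlam hV, freeProp, freeEvol_apply,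
    freeEvol_apply]
  simp only [LinearIsometryEquiv.apply_symm_apply, phase_phase]
  rw [add_comm]

theorem reducedWaveOperatorExists_dollard (hn : 1 ≤ n) {m lam : ℝ} (hm : 0 < m) (h0 : 0 ≤ lam)
    (hlam : lam < 1 / 2) {VS VD : ℝ → RSpace n → ℝ} (hS : IsShortRange lam VS)
    (hD : IsDollardLongRange lam VD) {J : Set ℝ} {l : Filter ℝ} (hJl : IsHalfLine J l) {s : ℝ}
    (hs : s ∈ J) : ReducedWaveOperatorExists m lam (fun t x => VS t x + VD t x) J s l
      (dollardModifier m lam VD s) := by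
  obtain ⟨hJo, hJc, hJ0⟩ := halfLine_properties hJl.eq_or
  obtain ⟨CS, hCS⟩ := hS.bounded hlam
  obtain ⟨CD, hCD⟩ := hD.bounded h0 hlam
  have hV : Continuous fun q : ℝ × RSpace n =>
      (fun t x => VS t x + VD t x : ℝ → RSpace n → ℝ) q.1 q.2 := hS.1.add hD.continuous
  have hC : ∀ t x, |(fun t x => VS t x + VD t x : ℝ → RSpace n → ℝ) t x| ≤ CS + CD := fun t x =>
    (abs_add_le _ _).trans (add_le_add (hCS t x) (hCD t x))
  refine ⟨?_, exists_isPropagator hV hC hm h0 hlam hJ0, fun U₀ U hU₀ hU => ?_⟩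
  · rw [← reducedHamiltonian_zero]
    exact exists_isPropagator (C := 0) continuous_const (fun t x => by simp) hm h0 hlam hJ0
  have := hJl.neBot
  -- The modifier is written as a unitary, so the whole family is isometric. The test vectors carry
  -- a factor `freeProp s` because the propagators start at time `s`, not at `0`.
  refine exists_clm_of_total (Z := fun t => ((((fourierL n).trans
      (phase (dollardPhase hD.continuous (continuous_dollardScale m hlam) s t))).trans
      (fourierL n).symm).trans ((U₀ t s).trans (U t s).symm)).toLinearIsometry)
    (D := {ψ | ∃ κ : 𝓢(RSpace n, ℂ), HasCompactSupport κ ∧ tsupport κ ⊆ {0}ᶜ ∧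
      ψ = freeProp n m lam s ((fourierL n).symm (κ.toLp 2))}) (fun z hz => ?_) ?_ |>.imp
    fun W hW ψ => (hW ψ).congr fun t => ?_
  · have h1 := eq_zero_of_inner_test hn (z := fourierL n ((freeProp n m lam s).symm z))
      fun κ hκ hκ0 => by
        rw [← hz _ ⟨κ, hκ, hκ0, rfl⟩, ← LinearIsometryEquiv.inner_map_map (fourierL n).symm,
          LinearIsometryEquiv.symm_apply_apply,
          ← LinearIsometryEquiv.inner_map_map (freeProp n m lam s),
          LinearIsometryEquiv.apply_symm_apply]
    simpa using h1
  · rintro _ ⟨κ, hκ, hκ0, rfl⟩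
    obtain ⟨δ, hδ, K, hK⟩ := hD.exists_second_moment hm h0 hlam hJl.eq_or hs hκ hκ0
    obtain ⟨p, hp, K', hK'⟩ := hS.exists_decay hm hlam hκ0
    obtain ⟨z, hz⟩ := exists_limit_of_test hS.1 hD.continuous hCS hCD hn hm h0 hlam hJl hU hs hδ hK
      hp (K' := K') fun t ht _ => by
        filter_upwards [κ.coeFn_toLp 2 volume] with x hx hx0
        exact hK' t (hJ0 t ht) x (hx ▸ hx0)
    refine ⟨z, hz.congr' ?_⟩
    filter_upwards [hJl.eventually_mem s] with t ht
    rw [← freeProp_symm_dollardModifier hlam, ← hU₀.free_eq hn hm h0 hlam hJo hJc hJ0 hs ht.1,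
      dollardModifier_eq hlam hD.continuous]
    rfl
  · rw [dollardModifier_eq hlam hD.continuous]
    rfl

theorem reducedWaveOperatorExists_shortRange (hn : 1 ≤ n) {m lam : ℝ} (hm : 0 < m) (h0 : 0 ≤ lam)
    (hlam : lam < 1 / 2) {V : ℝ → RSpace n → ℝ} (hV : IsShortRange lam V) {J : Set ℝ}
    {l : Filter ℝ} (hJl : IsHalfLine J l) {s : ℝ} (hs : s ∈ J) :
    ReducedWaveOperatorExists m lam V J s l (fun _ ψ => ψ) := by
  have := reducedWaveOperatorExists_dollard hn hm h0 hlam hV (isDollardLongRange_zero hlam) hJl hs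
  have hG : dollardModifier (n := n) m lam (fun _ _ => 0) s = fun _ ψ => ψ := by
    funext t ψ
    exact dollardModifier_zero m lam s t ψ
  simpa only [add_zero, hG] using this

/-- The oscillator constant `k` enters only through `0 ≤ λ < 1/2`. -/
theorem theorem1 {n : ℕ} (hn : 1 ≤ n) (m k r₀ lam : ℝ) (hm : 0 < m) (hr₀ : 0 < r₀)
    (hk₀ : 0 ≤ k) (hk : k < m / 4) (hlam : lam = (1 - √(1 - 4 * k / m)) / 2) :
    (∀ VS : ℝ → RSpace n → ℝ, IsShortRange lam VS →
      ReducedWaveOperatorExists m lam VS (Set.Ioi 0) r₀ atTop (fun _ ψ => ψ) ∧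
      ReducedWaveOperatorExists m lam VS (Set.Iio 0) (-r₀) atBot (fun _ ψ => ψ)) ∧
    (∀ VS VD : ℝ → RSpace n → ℝ, IsShortRange lam VS → IsDollardLongRange lam VD →
      ReducedWaveOperatorExists m lam (fun t x => VS t x + VD t x) (Set.Ioi 0) r₀ atTop
        (dollardModifier m lam VD r₀) ∧
      ReducedWaveOperatorExists m lam (fun t x => VS t x + VD t x) (Set.Iio 0) (-r₀) atBot
        (dollardModifier m lam VD (-r₀))) := by
  have hpos : 0 < 1 - 4 * k / m := by
    rw [sub_pos, div_lt_one hm]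
    linarith
  have hlt : lam < 1 / 2 := by
    have := Real.sqrt_pos.2 hpos
    linarith
  have h0 : 0 ≤ lam := by
    have : √(1 - 4 * k / m) ≤ 1 := by
      have : 0 ≤ 4 * k / m := by positivity
      exact Real.sqrt_le_one.2 (by linarith)
    linarith
  have hs : -r₀ ∈ Set.Iio (0 : ℝ) := neg_neg_of_pos hr₀
  exact ⟨fun VS hS => ⟨reducedWaveOperatorExists_shortRange hn hm h0 hlt hS (.inl ⟨rfl, rfl⟩) hr₀,
      reducedWaveOperatorExists_shortRange hn hm h0 hlt hS (.inr ⟨rfl, rfl⟩) hs⟩,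
    fun VS VD hS hD =>
      ⟨reducedWaveOperatorExists_dollard hn hm h0 hlt hS hD (.inl ⟨rfl, rfl⟩) hr₀,
      reducedWaveOperatorExists_dollard hn hm h0 hlt hS hD (.inr ⟨rfl, rfl⟩) hs⟩⟩

end
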